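/- For integers $0<a\le b$ let $[a,b]=\{a,a+1,\dots,b\}$ and $[n]=[1,n]$, and let $\binom{[n]}{k}$ be the family of all $k$-subsets of $[n]$. A family $\mathcal F\subseteq\binom{[n]}{k}$ is \emph{$3$-wise intersecting} if $F_1\cap F_2\cap F_3\ne\emptyset$ for all $F_1,F_2,F_3\in\mathcal F$; it is \emph{non-trivial} if no element of $[n]$ lies in all of its members; a $3$-wise intersecting $\mathcal F$ is \emph{maximal} if $\mathcal F\cup\{A\}$ is not $3$-wise intersecting for any $A\in\binom{[n]}{k}\setminus\mathcal F$. Write $\mathcal F\cong\mathcal F'$ if some permutation of $[n]$ maps $\mathcal F$ onto $\mathcal F'$. A maximal non-trivial $3$-wise intersecting family $\mathcal F\subseteq\binom{[n]}{k}$ is called \emph{sixth largest} if exactly five distinct numbers greater than $|\mathcal F|$ occur as sizes of maximal non-trivial $3$-wise intersecting families in $\binom{[n]}{k}$. Define, for $2\le l\le k-1$, $$\mathcal H(k,3,l)=\{F\in\tbinom{[n]}{k}:[2]\subseteq F,\ F\cap[3,l+2]\ne\emptyset\}\cup\{F\in\tbinom{[n]}{k}:|[2]\cap F|=1,\ [3,l+2]\subseteq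 F\},$$ and, with $\mathcal P=\{F\in\binom{[n]}{k}:[2]\subseteq F,\ F\cap[3,k-1]\neq\emptyset\}$, $$\mathcal S(k,3)=\mathcal P\cup\{F\in\tbinom{[n]}{k}:[2]\cup[k,k+2]\subseteq F\}\cup\bigcup_{i=1}^{2}\{F\in\tbinom{[n]}{k}:\{i\}\cup[3,k-1]\subseteq F,\ |[k,k+2]\cap F|=2\},$$ $$\begin{aligned}\mathcal S_1(k,3)=\mathcal P&\cup\{F\in\tbinom{[n]}{k}:[2]\cup[k,k+2]\subseteq F\}\cup\{[2,k]\cup\{i\}:i\in[k+1,n]\}\\&\cup\{[2,k+2]\setminus\{k\},\ [k+1]\setminus\{2\},\ [k+2]\setminus\{2,k+1\}\},\end{aligned}$$ $$\begin{aligned}\mathcal S_2(k,3)=\mathcal P&\cup\{F\in\tbinom{[n]}{k}:[2]\cup[k,k+3]\subseteq F\}\\&\cup\{[2,k+1],\ [2,k-1]\cup\{k+2,k+3\},\ [2,k]\cup\{k+3\},\ [2,k+2]\setminus\{k\}\}\\&\cup\{[3,k]\cup\{1,k+2\},\ [3,k-1]\cup\{1,k+1,k+3\}\},\end{aligned}$$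 $$\begin{aligned}\mathcal S_3(k,3)=\mathcal P&\cup\{F\in\tbinom{[n]}{k}:[2]\cup[k,k+3]\subseteq F\}\\&\cup\{[2,k]\cup\{k+2\},\ [2,k+2]\setminus\{k\},\ [2,k-1]\cup\{k+1,k+3\}\}\\&\cup\{[3,k+1]\cup\{1\},\ [3,k-1]\cup\{1,k+1,k+2\},\ [3,k-1]\cup\{1,k+2,k+3\}\}.\end{aligned}$$ **Corollary.** Let $k\ge5$ and $n>n_1(k,3)=3+2(k-3)^2(k^{k-3}-1)^k\,k!$. A sixth largest maximal non-trivial $3$-wise intersecting family in $\binom{[n]}{k}$ exists, and every such family $\mathcal F$ satisfies: 1. if $k=5$, then $\mathcal F\cong\mathcal S(5,3)$; 2. if $k\in\{6,7\}$, then $\mathcal F\cong\mathcal S_1(k,3)$; 3. if $k=8$, then $\mathcal F\cong\mathcal H(8,3,5)$; 4. if $k\ge9$, then $\mathcal F\cong\mathcal S_2(k,3)$ or $\mathcal F\cong\mathcal S_3(k,3)$. -/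

import Mathlib

namespace DWise

/-- The family `binom([n], k)` of all `k`-subsets of `[n] = {1, …, n}`. -/
def kSubsets (n k : ℕ) : Finset (Finset ℕ) := (Finset.Icc 1 n).powersetCard k

/-- `|F₁ ∩ ⋯ ∩ F_d| ≥ 1` for all (not necessarily distinct) members `F₁, …, F_d`. -/
def IsDWiseIntersecting (d : ℕ) (𝓕 : Finset (Finset ℕ)) : Prop :=
  ∀ F : Fin d → Finset ℕ, (∀ i, F i ∈ 𝓕) → ∃ x, ∀ i, x ∈ F i

/-- All members of the family contain a common element of `[n]`. -/
def IsTrivialFamily (n : ℕ) (𝓕 : Finset (Finset ℕ)) : Prop :=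
  ∃ x ∈ Finset.Icc 1 n, ∀ F ∈ 𝓕, x ∈ F

/-- `𝓕 ⊆ binom([n], k)` is a maximal non-trivial `d`-wise intersecting family: no further `k`-subset
of `[n]` can be added to `𝓕` without destroying the `d`-wise intersecting property. -/
structure IsMaximalNontrivial (n k d : ℕ) (𝓕 : Finset (Finset ℕ)) : Prop where
  uniform : 𝓕 ⊆ kSubsets n k
  intersecting : IsDWiseIntersecting d 𝓕
  nontrivial : ¬ IsTrivialFamily n 𝓕
  maximal : ∀ A ∈ kSubsets n k \ 𝓕, ¬ IsDWiseIntersecting d (insert A 𝓕)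

/-- Isomorphism of families of subsets of `[n]`: some permutation of `[n]` carries one to the other.
(Permutations of `[n]` are the restrictions of the permutations of `ℕ` that preserve `[n]`.) -/
def Isomorphic (n : ℕ) (𝓕 𝓕' : Finset (Finset ℕ)) : Prop :=
  ∃ π : Equiv.Perm ℕ, (Finset.Icc 1 n).image π = Finset.Icc 1 n ∧
    𝓕.image (fun F => F.image π) = 𝓕'

/-- `𝓕` is an `r`-th largest maximal non-trivial `d`-wise intersecting `k`-uniform family on `[n]`:
its size is the `r`-th largest among the sizes of such families, that is, exactly `r - 1` different
larger sizes occur. -/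
def IsNthLargest (n k d r : ℕ) (𝓕 : Finset (Finset ℕ)) : Prop :=
  IsMaximalNontrivial n k d 𝓕 ∧
    {m : ℕ | 𝓕.card < m ∧ ∃ 𝓖, IsMaximalNontrivial n k d 𝓖 ∧ 𝓖.card = m}.encard + 1 = r

/-- `n₁(k, d) = d + 2 (k - d)² (k^{k-d} - 1)^k k!` (used for `k ≥ d + 2`). -/
def n₁ (k d : ℕ) : ℕ := d + 2 * (k - d) ^ 2 * (k ^ (k - d) - 1) ^ k * k.factorial

/-- The family `H(k, d, l)` on `[n]`. -/
def famH (n k d l : ℕ) : Finset (Finset ℕ) :=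
  {F ∈ kSubsets n k | Finset.Icc 1 (d - 1) ⊆ F ∧ (F ∩ Finset.Icc d (d + l - 1)).Nonempty} ∪
  {F ∈ kSubsets n k |
    (Finset.Icc 1 (d - 1) ∩ F).card = d - 2 ∧ Finset.Icc d (d + l - 1) ⊆ F}

/-- The family `S(k, 3)` on `[n]`. -/
def famS (n k : ℕ) : Finset (Finset ℕ) :=
  {F ∈ kSubsets n k | Finset.Icc 1 2 ⊆ F ∧ (F ∩ Finset.Icc 3 (k - 1)).Nonempty} ∪
  {F ∈ kSubsets n k | Finset.Icc 1 2 ∪ Finset.Icc k (k + 2) ⊆ F} ∪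
  (Finset.Icc 1 2).biUnion fun i =>
    {F ∈ kSubsets n k |
      {i} ∪ Finset.Icc 3 (k - 1) ⊆ F ∧ (Finset.Icc k (k + 2) ∩ F).card = 2}

/-- The family `S₁(k, 3)` on `[n]`. -/
def famS₁ (n k : ℕ) : Finset (Finset ℕ) :=
  {F ∈ kSubsets n k | Finset.Icc 1 2 ⊆ F ∧ (F ∩ Finset.Icc 3 (k - 1)).Nonempty} ∪
  {F ∈ kSubsets n k | Finset.Icc 1 2 ∪ Finset.Icc k (k + 2) ⊆ F} ∪
  (Finset.Icc (k + 1) n).image (fun i => Finset.Icc 2 k ∪ {i}) ∪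
  {Finset.Icc 2 (k + 2) \ {k}, Finset.Icc 1 (k + 1) \ {2}, Finset.Icc 1 (k + 2) \ {2, k + 1}}

/-- The family `S₂(k, 3)` on `[n]`. -/
def famS₂ (n k : ℕ) : Finset (Finset ℕ) :=
  {F ∈ kSubsets n k | Finset.Icc 1 2 ⊆ F ∧ (F ∩ Finset.Icc 3 (k - 1)).Nonempty} ∪
  {F ∈ kSubsets n k | Finset.Icc 1 2 ∪ Finset.Icc k (k + 3) ⊆ F} ∪
  {Finset.Icc 2 (k + 1), Finset.Icc 2 (k - 1) ∪ {k + 2, k + 3},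
    Finset.Icc 2 k ∪ {k + 3}, Finset.Icc 2 (k + 2) \ {k}} ∪
  {Finset.Icc 3 k ∪ {1, k + 2}, Finset.Icc 3 (k - 1) ∪ {1, k + 1, k + 3}}

/-- The family `S₃(k, 3)` on `[n]`. -/
def famS₃ (n k : ℕ) : Finset (Finset ℕ) :=
  {F ∈ kSubsets n k | Finset.Icc 1 2 ⊆ F ∧ (F ∩ Finset.Icc 3 (k - 1)).Nonempty} ∪
  {F ∈ kSubsets n k | Finset.Icc 1 2 ∪ Finset.Icc k (k + 3) ⊆ F} ∪
  {Finset.Icc 2 k ∪ {k + 2}, Finset.Icc 2 (k + 2) \ {k},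
    Finset.Icc 2 (k - 1) ∪ {k + 1, k + 3}} ∪
  {Finset.Icc 3 (k + 1) ∪ {1}, Finset.Icc 3 (k - 1) ∪ {1, k + 1, k + 2},
    Finset.Icc 3 (k - 1) ∪ {1, k + 2, k + 3}}

end DWise

namespace DWise
open Finset

/-! Everything is governed by transversals, the sets that meet `F ∩ G` for all members `F`, `G`. By
maximality every `k`-set that is a transversal is a member (`mem_of_isTransversal`). By
non-triviality no transversal has fewer than three elements, and two transversals of size at most
`k` share at least two elements. Hence either all transversals of size three contain one pair `{p,
q}`, or every member meets some fixed `4`-set in three elements, which makes the family a copy of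
`H(k, 3, 2)` (`four_set_or_star`).

In the star case let `L` be the set of petals, the `i` for which `{p, q, i}` is a transversal.
Branching bounds the number of members without a transversal of size three by `k ^ 4 * (n -
4).choose (k - 4)`; all others contain `p`, `q` and a petal. One more petal enlarges this main term
by far more than the error once `n` exceeds `n₁ k 3`, so a family with at most `k - 4` petals has
fewer than `pairCount n k (k - 3)` members. A member missing `p` or `q` must contain `L`; so there
are at most `k - 1` petals.

With `k - 1` or `k - 2` petals the family is `H(k, 3, l)`, `l` being the number of petals. With `k -
3` petals, the members missing `q` and those missing `p` are `L`, a kernel point and a pair, so they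
define two graphs. Unless the family is `H(k, 3, k - 3)`, every edge of one graph meets every edge
of the other, and no vertex lies on all edges, since it would be a further petal. The classification
`exists_fits` then leaves five graphs: an edge (`famG`), two edges at a vertex (`famS₁`), a triangle
(`famS`), two disjoint edges (`famS₂`) and a path with three edges (`famS₃`).

The rest compares sizes, measured as the excess over `pairCount n k (k - 3)`. The excess of `H(k, 3,
k - 1)` and `H(k, 3, k - 2)` has order `n ^ (k - 3)`, that of `famG` order `n ^ (k - 4)`, that of
`famS₁` (never below linear) and `famS` order `n ^ (k - 5)`, and that of `famS₂` and `famS₃`, which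
have equal size, order `n ^ (k - 6)`. The excess of `H(k, 3, k - 3)` is about `n ^ 2` for every `k`,
so this family sinks in the ranking as `k` grows; and `H(k, 3, 2)` drops out at `k = 8`. This is why
the small values of `k` behave differently. -/

theorem mem_kSubsets {n k : ℕ} {F : Finset ℕ} : F ∈ kSubsets n k ↔ F ⊆ Icc 1 n ∧ F.card = k :=
  mem_powersetCard

theorem IsDWiseIntersecting.exists_mem {𝓕 : Finset (Finset ℕ)} (h : IsDWiseIntersecting 3 𝓕)
    {A B C : Finset ℕ} (hA : A ∈ 𝓕) (hB : B ∈ 𝓕) (hC : C ∈ 𝓕) : ∃ x, x ∈ A ∧ x ∈ B ∧ x ∈ C := by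
  obtain ⟨x, hx⟩ := h ![A, B, C] (by intro i; fin_cases i <;> simpa)
  exact ⟨x, hx 0, hx 1, hx 2⟩

theorem isDWiseIntersecting_three {𝓕 : Finset (Finset ℕ)}
    (h : ∀ A ∈ 𝓕, ∀ B ∈ 𝓕, ∀ C ∈ 𝓕, ∃ x, x ∈ A ∧ x ∈ B ∧ x ∈ C) : IsDWiseIntersecting 3 𝓕 := by
  intro F hF
  obtain ⟨x, h0, h1, h2⟩ := h _ (hF 0) _ (hF 1) _ (hF 2)
  exact ⟨x, by intro i; fin_cases i <;> assumption⟩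

theorem exists_notMem_of_not_isTrivial {n : ℕ} {𝓕 : Finset (Finset ℕ)}
    (h : ¬ IsTrivialFamily n 𝓕) {x : ℕ} (hx : x ∈ Icc 1 n) : ∃ F ∈ 𝓕, x ∉ F := by
  by_contra! hc
  exact h ⟨x, hx, hc⟩

/-- Any two members of a non-trivial `3`-wise intersecting family have two common elements. -/
theorem exists_ne_mem_inter {n k : ℕ} {𝓕 : Finset (Finset ℕ)} (hu : 𝓕 ⊆ kSubsets n k)
    (hi : IsDWiseIntersecting 3 𝓕) (hn : ¬ IsTrivialFamily n 𝓕) {F G : Finset ℕ} (hF : F ∈ 𝓕)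
    (hG : G ∈ 𝓕) (x : ℕ) : ∃ y ∈ F, y ∈ G ∧ y ≠ x := by
  by_cases hx : x ∈ Icc 1 n
  · obtain ⟨H, hH, hxH⟩ := exists_notMem_of_not_isTrivial hn hx
    obtain ⟨y, h1, h2, h3⟩ := hi.exists_mem hF hG hH
    exact ⟨y, h1, h2, fun h => hxH (h ▸ h3)⟩
  · obtain ⟨y, h1, h2, h3⟩ := hi.exists_mem hF hG hG
    exact ⟨y, h1, h2, fun h => hx (h ▸ (mem_kSubsets.1 (hu hF)).1 h1)⟩

/-! ### Transversals of a maximal non-trivial family -/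

/-- A set meeting all pairwise intersections of members of the family. -/
def IsTransversal (𝓕 : Finset (Finset ℕ)) (T : Finset ℕ) : Prop :=
  ∀ F ∈ 𝓕, ∀ G ∈ 𝓕, ∃ x ∈ T, x ∈ F ∧ x ∈ G

/-- The added points avoid `S`, so `A` meets `S` only inside `D`. This turns a small transversal
into a member whose intersection with a prescribed set is controlled. -/
theorem exists_kSubset_extending {n k : ℕ} {D : Finset ℕ} (hD : D ⊆ Icc 1 n) (hDk : D.card ≤ k)
    (S : Finset ℕ) (hS : D.card + S.card + k ≤ n) :
    ∃ A ∈ kSubsets n k, D ⊆ A ∧ ∀ x ∈ A, x ∈ S → x ∈ D := by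
  have h1 : k - D.card ≤ (Icc 1 n \ (D ∪ S)).card := by
    have := le_card_sdiff (D ∪ S) (Icc 1 n)
    have h2 := card_union_le D S
    simp only [Nat.card_Icc] at this
    omega
  obtain ⟨B, hB, hBc⟩ := exists_subset_card_eq h1
  have hdis : Disjoint D B := by
    rw [disjoint_left]
    intro x hx hxB
    have := hB hxB
    simp [hx] at this
  refine ⟨D ∪ B, mem_kSubsets.2 ⟨union_subset hD (hB.trans sdiff_subset), ?_⟩,
    subset_union_left, ?_⟩
  · rw [card_union_of_disjoint hdis]; omega
  · intro x hx hxS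
    rcases mem_union.1 hx with h | h
    · exact h
    · have := hB h
      simp [hxS] at this

namespace IsMaximalNontrivial

variable {n k : ℕ} {𝓕 : Finset (Finset ℕ)}

/-- Any triple containing `A` reduces to the transversal condition for one pair of members: a single
other member is paired with itself, and `F₀` takes care of the triple `A, A, A`. -/
theorem mem_of_isTransversal (h : IsMaximalNontrivial n k 3 𝓕) (hn : 1 ≤ n) {A : Finset ℕ} (hA : A ∈ kSubsets n k)
    (hT : IsTransversal 𝓕 A) : A ∈ 𝓕 := by
  by_contra hAF
  refine h.maximal A (by simp [hA, hAF]) (isDWiseIntersecting_three ?_)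
  have hne : ∃ F, F ∈ 𝓕 := by
    by_contra! hc
    exact h.nontrivial ⟨1, by simp [hn], fun F hF => (hc F hF).elim⟩
  obtain ⟨F₀, hF₀⟩ := hne
  have key : ∀ B ∈ insert A 𝓕, ∀ C ∈ insert A 𝓕, ∃ x, x ∈ A ∧ x ∈ B ∧ x ∈ C := by
    intro B hB C hC
    rcases mem_insert.1 hB with rfl | hB' <;> rcases mem_insert.1 hC with rfl | hC'
    · obtain ⟨x, hx, -⟩ := hT F₀ hF₀ F₀ hF₀
      exact ⟨x, hx, hx, hx⟩
    · obtain ⟨x, hx, h1, h2⟩ := hT C hC' C hC'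
      exact ⟨x, hx, hx, h1⟩
    · obtain ⟨x, hx, h1, h2⟩ := hT B hB' B hB'
      exact ⟨x, hx, h1, hx⟩
    · obtain ⟨x, hx, h1, h2⟩ := hT B hB' C hC'
      exact ⟨x, hx, h1, h2⟩
  intro B hB C hC D hD
  rcases mem_insert.1 hB with rfl | hB'
  · exact key C hC D hD
  rcases mem_insert.1 hC with rfl | hC'
  · obtain ⟨x, h1, h2, h3⟩ := key B hB D hD
    exact ⟨x, h2, h1, h3⟩
  rcases mem_insert.1 hD with rfl | hD'
  · obtain ⟨x, h1, h2, h3⟩ := key B hB C hC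
    exact ⟨x, h2, h3, h1⟩
  exact h.intersecting.exists_mem hB' hC' hD'

theorem exists_notMem (h : IsMaximalNontrivial n k 3 𝓕) (hn : 1 ≤ n) (x : ℕ) :
    ∃ F ∈ 𝓕, x ∉ F := by
  by_cases hx : x ∈ Icc 1 n
  · exact exists_notMem_of_not_isTrivial h.nontrivial hx
  · obtain ⟨F, hF, -⟩ := exists_notMem_of_not_isTrivial h.nontrivial (x := 1) (by simp [hn])
    exact ⟨F, hF, fun h' => hx ((mem_kSubsets.1 (h.uniform hF)).1 h')⟩

/-- A maximal family is equal to every `3`-wise intersecting family of `k`-sets containing it. -/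
theorem eq_of_subset (h : IsMaximalNontrivial n k 3 𝓕) {𝓖 : Finset (Finset ℕ)} (hsub : 𝓕 ⊆ 𝓖)
    (hu : 𝓖 ⊆ kSubsets n k) (hi : IsDWiseIntersecting 3 𝓖) : 𝓕 = 𝓖 := by
  refine hsub.antisymm fun A hA => ?_
  by_contra hAF
  refine h.maximal A (by simp [hAF, hu hA]) fun F hF => hi F fun i => ?_
  rcases mem_insert.1 (hF i) with h' | h'
  · exact h' ▸ hA
  · exact hsub h'

/-- Members of the family meet transversals of size at most `k` in at least two elements. -/
theorem exists_ne_of_isTransversal (h : IsMaximalNontrivial n k 3 𝓕) (hn : 3 * k < n)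
    {T : Finset ℕ} (hT : IsTransversal 𝓕 T) (hTn : T ⊆ Icc 1 n) (hTk : T.card ≤ k)
    {F : Finset ℕ} (hF : F ∈ 𝓕) (x : ℕ) : ∃ y ∈ T, y ∈ F ∧ y ≠ x := by
  have hFc := (mem_kSubsets.1 (h.uniform hF)).2
  -- An extension `A` of `T` with `A ∩ F ⊆ T` is a member, and two members share two elements.
  obtain ⟨A, hA, hTA, hAF⟩ := exists_kSubset_extending hTn hTk F (by omega)
  have hA' : A ∈ 𝓕 := h.mem_of_isTransversal (by omega) hA fun F hF G hG => by
    obtain ⟨x, hx, h'⟩ := hT F hF G hG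
    exact ⟨x, hTA hx, h'⟩
  obtain ⟨y, hy, hyF, hyx⟩ := exists_ne_mem_inter h.uniform h.intersecting h.nontrivial hA' hF x
  exact ⟨y, hAF y hy hyF, hyF, hyx⟩

theorem exists_ne_of_isTransversal_of_isTransversal (h : IsMaximalNontrivial n k 3 𝓕)
    (hn : 3 * k < n) {T T' : Finset ℕ} (hT : IsTransversal 𝓕 T) (hTn : T ⊆ Icc 1 n)
    (hTk : T.card ≤ k) (hT' : IsTransversal 𝓕 T') (hTn' : T' ⊆ Icc 1 n) (hTk' : T'.card ≤ k)
    (x : ℕ) : ∃ y ∈ T, y ∈ T' ∧ y ≠ x := by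
  obtain ⟨A, hA, hTA, hAT⟩ := exists_kSubset_extending hTn hTk T' (by omega)
  have hA' : A ∈ 𝓕 := h.mem_of_isTransversal (by omega) hA fun F hF G hG => by
    obtain ⟨x, hx, h'⟩ := hT F hF G hG
    exact ⟨x, hTA hx, h'⟩
  obtain ⟨y, hy, hyA, hyx⟩ := h.exists_ne_of_isTransversal hn hT' hTn' hTk' hA' x
  exact ⟨y, hAT y hyA hy, hy, hyx⟩

/-- A member missing `a` and a member missing `b` have an intersection disjoint from `{a, b}`. -/
theorem not_isTransversal_of_card_le_two (h : IsMaximalNontrivial n k 3 𝓕) (hn : 1 ≤ n)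
    {T : Finset ℕ} (hT : T.card ≤ 2) : ¬ IsTransversal 𝓕 T := by
  intro hTr
  obtain ⟨a, b, hab⟩ : ∃ a b, T ⊆ {a, b} := by
    rcases Nat.lt_or_ge T.card 2 with h1 | h1
    · obtain ⟨a, ha⟩ := card_le_one_iff_subset_singleton.1 (Nat.lt_succ_iff.1 h1)
      exact ⟨a, a, by simpa using ha⟩
    · obtain ⟨a, b, -, rfl⟩ := card_eq_two.1 (le_antisymm hT h1)
      exact ⟨a, b, subset_rfl⟩
  obtain ⟨F, hF, haF⟩ := h.exists_notMem hn a
  obtain ⟨G, hG, hbG⟩ := h.exists_notMem hn b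
  obtain ⟨x, hx, h1, h2⟩ := hTr F hF G hG
  have := hab hx
  simp only [mem_insert, mem_singleton] at this
  rcases this with rfl | rfl <;> contradiction

/-- The transversals of size three form a star through a pair, unless all members of the family
meet a fixed `4`-set in at least three elements. -/
theorem four_set_or_star (h : IsMaximalNontrivial n k 3 𝓕) (hk : 3 ≤ k) (hn : 3 * k < n) :
    (∃ Q ⊆ Icc 1 n, Q.card = 4 ∧ ∀ F ∈ 𝓕, 3 ≤ (F ∩ Q).card) ∨
    ∃ p ∈ Icc 1 n, ∃ q ∈ Icc 1 n, p ≠ q ∧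
      ∀ T ⊆ Icc 1 n, T.card = 3 → IsTransversal 𝓕 T → p ∈ T ∧ q ∈ T := by
  by_cases h0 : ∃ T₀ ⊆ Icc 1 n, T₀.card = 3 ∧ IsTransversal 𝓕 T₀
  swap
  · push Not at h0
    -- Without transversals of size three the star condition is vacuous, and any pair serves.
    exact Or.inr ⟨1, by simp; omega, 2, by simp; omega, by omega,
      fun T hT hc ht => (h0 T hT hc ht).elim⟩
  obtain ⟨T₀, hT₀, hc₀, ht₀⟩ := h0
  by_cases h1 : ∃ T₁ ⊆ Icc 1 n, T₁.card = 3 ∧ IsTransversal 𝓕 T₁ ∧ T₁ ≠ T₀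
  swap
  · push Not at h1
    obtain ⟨a, b, c, hab, hac, hbc, rfl⟩ := card_eq_three.1 hc₀
    refine Or.inr ⟨a, hT₀ (by simp), b, hT₀ (by simp), hab, fun T hT hc ht => ?_⟩
    rw [h1 T hT hc ht]
    simp
  obtain ⟨T₁, hT₁, hc₁, ht₁, hne⟩ := h1
  obtain ⟨p, hp0, hp1, -⟩ := h.exists_ne_of_isTransversal_of_isTransversal hn ht₀ hT₀ (by omega)
    ht₁ hT₁ (by omega) 0
  obtain ⟨q, hq0, hq1, hpq⟩ := h.exists_ne_of_isTransversal_of_isTransversal hn ht₀ hT₀ (by omega)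
    ht₁ hT₁ (by omega) p
  by_cases h2 : ∀ T ⊆ Icc 1 n, T.card = 3 → IsTransversal 𝓕 T → p ∈ T ∧ q ∈ T
  · exact Or.inr ⟨p, hT₀ hp0, q, hT₀ hq0, hpq.symm, h2⟩
  push Not at h2
  obtain ⟨T₂, hT₂, hc₂, ht₂, h2⟩ := h2
  have third : ∀ T : Finset ℕ, T.card = 3 → p ∈ T → q ∈ T → ∃ a, a ≠ p ∧ a ≠ q ∧ T = {p, q, a} := by
    intro T hc hp hq
    have : ((T.erase p).erase q).card = 1 := by
      rw [card_erase_of_mem (by simp [hq, hpq]), card_erase_of_mem hp, hc]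
    obtain ⟨a, ha⟩ := card_eq_one.1 this
    have ha' : a ∈ (T.erase p).erase q := by simp [ha]
    simp only [mem_erase] at ha'
    refine ⟨a, ha'.2.1, ha'.1, ?_⟩
    rw [← insert_erase hp, ← insert_erase (mem_erase.2 ⟨hpq, hq⟩), ha]
  obtain ⟨a, hap, haq, rfl⟩ := third T₀ hc₀ hp0 hq0
  obtain ⟨b, hbp, hbq, rfl⟩ := third T₁ hc₁ hp1 hq1
  have hab : a ≠ b := by
    rintro rfl
    exact hne rfl
  refine Or.inl ⟨{p, q, a, b}, ?_, ?_, ?_⟩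
  · intro x hx
    simp only [mem_insert, mem_singleton] at hx
    rcases hx with rfl | rfl | rfl | rfl
    · exact hT₀ (by simp)
    · exact hT₀ (by simp)
    · exact hT₀ (by simp)
    · exact hT₁ (by simp)
  · grind
  intro F hF
  have e0 := h.exists_ne_of_isTransversal hn ht₀ hT₀ (by omega) hF
  have e1 := h.exists_ne_of_isTransversal hn ht₁ hT₁ (by omega) hF
  have e2 := h.exists_ne_of_isTransversal hn ht₂ hT₂ (by omega) hF
  have e3 := h.exists_ne_of_isTransversal_of_isTransversal hn ht₀ hT₀ (by omega) ht₂ hT₂ (by omega)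
  have e4 := h.exists_ne_of_isTransversal_of_isTransversal hn ht₁ hT₁ (by omega) ht₂ hT₂ (by omega)
  -- `T₂` misses `p` or `q` but shares two points with `{p, q, a}` and with `{p, q, b}`; this leaves
  -- only `a`, `b` and one of `p`, `q`.
  have ha2 : a ∈ T₂ ∧ b ∈ T₂ ∧ (p ∈ T₂ ∨ q ∈ T₂) := by
    obtain ⟨x, hx⟩ := e3 p
    obtain ⟨y, hy⟩ := e3 q
    obtain ⟨x', hx'⟩ := e4 p
    obtain ⟨y', hy'⟩ := e4 q
    obtain ⟨z, hz⟩ := e3 a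
    clear e0 e1 e2 e3 e4 third hc₀ hc₁
    simp only [mem_insert, mem_singleton] at hx hy hx' hy' hz
    grind
  obtain ⟨r, hr, hT2⟩ : ∃ r, (r = p ∨ r = q) ∧ T₂ = {r, a, b} := by
    rcases ha2 with ⟨h3, h4, h5 | h5⟩
    · exact ⟨p, Or.inl rfl, (eq_of_subset_of_card_le (by grind) (by grind)).symm⟩
    · exact ⟨q, Or.inr rfl, (eq_of_subset_of_card_le (by grind) (by grind)).symm⟩
  subst hT2
  -- Sharing two points with each of the three transversals forces `F` to contain three of the four
  -- points.
  have pts : (a ∈ F ∧ b ∈ F ∧ (p ∈ F ∨ q ∈ F)) ∨ (p ∈ F ∧ q ∈ F ∧ (a ∈ F ∨ b ∈ F)) := by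
    obtain ⟨x, hx⟩ := e0 p
    obtain ⟨y, hy⟩ := e0 q
    obtain ⟨z, hz⟩ := e0 a
    obtain ⟨x', hx'⟩ := e1 p
    obtain ⟨y', hy'⟩ := e1 q
    obtain ⟨z', hz'⟩ := e1 b
    obtain ⟨u, hu⟩ := e2 a
    obtain ⟨v, hv⟩ := e2 b
    obtain ⟨w, hw⟩ := e2 r
    simp only [mem_insert, mem_singleton] at hx hy hx' hy' hz hz' hu hv hw
    grind
  have card3 : ∀ x y z, x ≠ y → x ≠ z → y ≠ z → x ∈ F → y ∈ F → z ∈ F →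
      x ∈ ({p, q, a, b} : Finset ℕ) → y ∈ ({p, q, a, b} : Finset ℕ) →
      z ∈ ({p, q, a, b} : Finset ℕ) → 3 ≤ (F ∩ {p, q, a, b}).card := by
    intro x y z hxy hxz hyz hx hy hz hx' hy' hz'
    rw [← card_eq_three.2 ⟨x, y, z, hxy, hxz, hyz, rfl⟩]
    apply card_le_card
    intro w hw
    rw [mem_insert, mem_insert, mem_singleton] at hw
    rw [mem_inter]
    rcases hw with rfl | rfl | rfl <;> constructor <;> assumption
  rcases pts with ⟨h3, h4, h5 | h5⟩ | ⟨h3, h4, h5 | h5⟩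
  · exact card3 a b p hab hap hbp h3 h4 h5 (by simp) (by simp) (by simp)
  · exact card3 a b q hab haq hbq h3 h4 h5 (by simp) (by simp) (by simp)
  · exact card3 p q a hpq.symm hap.symm haq.symm h3 h4 h5 (by simp) (by simp) (by simp)
  · exact card3 p q b hpq.symm hbp.symm hbq.symm h3 h4 h5 (by simp) (by simp) (by simp)

end IsMaximalNontrivial
-- Counting: the main term and the error term
theorem card_filter_subset_disjoint {n k : ℕ} {D D' : Finset ℕ} (hD : D ⊆ Icc 1 n)
    (hD' : D' ⊆ Icc 1 n) (hdis : Disjoint D D') (hDk : D.card ≤ k) :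
    #{F ∈ kSubsets n k | D ⊆ F ∧ Disjoint F D'} =
      (n - D.card - D'.card).choose (k - D.card) := by
  have hc : (Icc 1 n \ (D ∪ D')).card = n - D.card - D'.card := by
    rw [card_sdiff_of_subset (union_subset hD hD'), card_union_of_disjoint hdis]
    simp
    omega
  rw [← hc, ← card_powersetCard]
  refine card_bij' (fun F _ => F \ D) (fun X _ => D ∪ X) ?_ ?_ ?_ ?_
  · intro F hF
    simp only [mem_filter, mem_kSubsets] at hF
    obtain ⟨⟨hFn, hFk⟩, hDF, hFD'⟩ := hF
    rw [mem_powersetCard, card_sdiff_of_subset hDF, hFk]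
    refine ⟨fun x hx => ?_, rfl⟩
    simp only [mem_sdiff, mem_union] at hx ⊢
    exact ⟨hFn hx.1, fun h => h.elim hx.2 (disjoint_left.1 hFD' hx.1)⟩
  · intro X hX
    rw [mem_powersetCard] at hX
    obtain ⟨hX, hXk⟩ := hX
    have h1 : ∀ x ∈ X, x ∈ Icc 1 n ∧ x ∉ D ∧ x ∉ D' := fun x hx => by
      have := hX hx
      simp only [mem_sdiff, mem_union] at this
      tauto
    simp only [mem_filter, mem_kSubsets]
    refine ⟨⟨union_subset hD fun x hx => (h1 x hx).1, ?_⟩, subset_union_left, ?_⟩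
    · rw [card_union_of_disjoint (disjoint_right.2 fun x hx => (h1 x hx).2.1), hXk]
      omega
    · rw [disjoint_union_left]
      exact ⟨hdis, disjoint_left.2 fun x hx => (h1 x hx).2.2⟩
  · intro F hF
    simp only [mem_filter] at hF
    exact union_sdiff_of_subset hF.2.1
  · intro X hX
    rw [mem_powersetCard] at hX
    rw [union_sdiff_left, Finset.sdiff_eq_self_iff_disjoint]
    refine disjoint_left.2 fun x hx => ?_
    have := hX.1 hx
    simp only [mem_sdiff, mem_union] at this
    tauto

/-- The number of `k`-subsets of `[n]` containing a given pair and meeting a given `l`-set. -/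
def pairCount (n k l : ℕ) : ℕ := (n - 2).choose (k - 2) - (n - 2 - l).choose (k - 2)

theorem card_filter_pair {n k p q : ℕ} {L : Finset ℕ} (hk : 2 ≤ k) (hp : p ∈ Icc 1 n)
    (hq : q ∈ Icc 1 n) (hpq : p ≠ q) (hL : L ⊆ Icc 1 n) (hpL : p ∉ L) (hqL : q ∉ L) :
    #{F ∈ kSubsets n k | p ∈ F ∧ q ∈ F ∧ ∃ x ∈ L, x ∈ F} = pairCount n k L.card := by
  have hD : ({p, q} : Finset ℕ) ⊆ Icc 1 n := by
    intro x hx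
    rcases mem_insert.1 hx with rfl | hx
    · exact hp
    · exact (mem_singleton.1 hx) ▸ hq
  have hDc : ({p, q} : Finset ℕ).card = 2 := card_pair hpq
  have e1 := card_filter_subset_disjoint (k := k) hD (empty_subset _) (disjoint_empty_right _)
    (by omega)
  have e2 := card_filter_subset_disjoint (k := k) hD hL
    (by simp [hpL, hqL]) (by omega)
  rw [hDc] at e1 e2
  simp only [card_empty, Nat.sub_zero, disjoint_empty_right, and_true] at e1
  rw [pairCount, ← e1, ← e2, ← card_sdiff_of_subset]
  · congr 1
    ext F
    simp only [mem_filter, mem_sdiff, insert_subset_iff, singleton_subset_iff,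
      disjoint_right]
    constructor
    · rintro ⟨h1, h2, h3, x, hx, hxF⟩
      exact ⟨⟨h1, h2, h3⟩, fun h => h.2.2 hx hxF⟩
    · rintro ⟨⟨h1, h2, h3⟩, h4⟩
      refine ⟨h1, h2, h3, ?_⟩
      by_contra! hc
      exact h4 ⟨h1, ⟨h2, h3⟩, fun x hx => hc x hx⟩
  · intro F hF
    simp only [mem_filter] at hF ⊢
    exact ⟨hF.1, hF.2.1⟩

namespace IsMaximalNontrivial

variable {n k : ℕ} {𝓕 : Finset (Finset ℕ)}

/-- Branching: if `T` is not a transversal, some `F₁ ∩ F₂` is disjoint from `T`, and every member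
containing `T` also contains one of the at most `k` points of `F₁ ∩ F₂`. A transversal has at least
three elements, and sets in `𝓗` contain none of size exactly three, so the branching continues until
`T` has four elements. -/
theorem card_filter_superset_le (h : IsMaximalNontrivial n k 3 𝓕) (hn : 1 ≤ n) (hk : 4 ≤ k)
    {𝓗 : Finset (Finset ℕ)} (hsub : 𝓗 ⊆ 𝓕)
    (hT : ∀ F ∈ 𝓗, ∀ T ⊆ F, T.card = 3 → ¬ IsTransversal 𝓕 T) (j : ℕ) :
    ∀ T ⊆ Icc 1 n, T.card + j = 4 →
      #{F ∈ 𝓗 | T ⊆ F} ≤ k ^ j * (n - 4).choose (k - 4) := by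
  induction j with
  | zero =>
    intro T hTn hTc
    have := card_filter_subset_disjoint (k := k) hTn (empty_subset _) (disjoint_empty_right _)
      (by omega)
    simp only [disjoint_empty_right, and_true, card_empty, Nat.sub_zero] at this
    rw [pow_zero, one_mul, show 4 = T.card by omega, ← this]
    exact card_le_card (filter_subset_filter _ (hsub.trans h.uniform))
  | succ j ih =>
    intro T hTn hTc
    by_cases htr : IsTransversal 𝓕 T
    · have h3 : T.card = 3 := by
        by_contra h3
        exact h.not_isTransversal_of_card_le_two hn (by omega) htr
      rw [filter_false_of_mem fun F hF hTF => hT F hF T hTF h3 htr]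
      simp
    · unfold IsTransversal at htr
      push Not at htr
      obtain ⟨F₁, hF₁, F₂, hF₂, hx⟩ := htr
      have hF₁' := mem_kSubsets.1 (h.uniform hF₁)
      have hcover : {F ∈ 𝓗 | T ⊆ F} ⊆ (F₁ ∩ F₂).biUnion fun x => {F ∈ 𝓗 | insert x T ⊆ F} := by
        intro F hF
        rw [mem_filter] at hF
        obtain ⟨x, hxF, h1, h2⟩ := h.intersecting.exists_mem (hsub hF.1) hF₁ hF₂
        rw [mem_biUnion]
        exact ⟨x, mem_inter.2 ⟨h1, h2⟩, mem_filter.2 ⟨hF.1, insert_subset hxF hF.2⟩⟩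
      refine (card_le_card hcover).trans (card_biUnion_le.trans ?_)
      refine (sum_le_card_nsmul _ _ (k ^ j * (n - 4).choose (k - 4)) fun x hxm => ?_).trans ?_
      · obtain ⟨h1, h2⟩ := mem_inter.1 hxm
        refine ih _ (insert_subset (hF₁'.1 h1) hTn) ?_
        rw [card_insert_of_notMem fun hxT => hx x hxT h1 h2]
        omega
      · rw [smul_eq_mul, pow_succ, mul_comm (k ^ j) k, mul_assoc]
        exact Nat.mul_le_mul_right _ ((card_le_card inter_subset_left).trans hF₁'.2.le)

/-- Members containing a transversal of size three contain `p`, `q` and a point of `L`; the others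
are counted by branching from the empty set. -/
theorem card_le_of_star (h : IsMaximalNontrivial n k 3 𝓕) (hn : 1 ≤ n) (hk : 4 ≤ k)
    {p q : ℕ} {L : Finset ℕ} (hp : p ∈ Icc 1 n) (hq : q ∈ Icc 1 n) (hpq : p ≠ q)
    (hL : L ⊆ Icc 1 n) (hpL : p ∉ L) (hqL : q ∉ L)
    (hT : ∀ T ⊆ Icc 1 n, T.card = 3 → IsTransversal 𝓕 T → p ∈ T ∧ q ∈ T ∧ ∃ x ∈ L, x ∈ T) :
    𝓕.card ≤ pairCount n k L.card + k ^ 4 * (n - 4).choose (k - 4) := by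
  classical
  rw [← card_filter_pair (k := k) (by omega) hp hq hpq hL hpL hqL]
  set 𝓗 := {F ∈ 𝓕 | ∀ T ⊆ F, T.card = 3 → ¬ IsTransversal 𝓕 T} with h𝓗
  have h1 := h.card_filter_superset_le hn hk (𝓗 := 𝓗) (filter_subset _ _)
    (fun F hF => (mem_filter.1 hF).2) 4 ∅ (empty_subset _) rfl
  simp only [empty_subset, filter_true] at h1
  refine le_trans (card_le_card ?_) ((card_union_le _ 𝓗).trans (Nat.add_le_add_left h1 _))
  intro F hF
  rw [mem_union]
  by_cases hF' : F ∈ 𝓗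
  · exact Or.inr hF'
  · left
    rw [h𝓗, mem_filter] at hF'
    push Not at hF'
    obtain ⟨T, hTF, hTc, hTt⟩ := hF' hF
    have hFk := h.uniform hF
    obtain ⟨h2, h3, x, hx, hxT⟩ := hT T (hTF.trans (mem_kSubsets.1 hFk).1) hTc hTt
    rw [mem_filter]
    exact ⟨hFk, hTF h2, hTF h3, x, hx, hTF hxT⟩

end IsMaximalNontrivial
-- The two shapes of large families, and permutations to standard position
/-- The Hilton–Milner type family with kernel `{p, q}` and petal set `L`. -/
def hilFam (n k p q : ℕ) (L : Finset ℕ) : Finset (Finset ℕ) :=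
  {F ∈ kSubsets n k | (p ∈ F ∧ q ∈ F ∧ ∃ x ∈ L, x ∈ F) ∨ (p ∈ F ∧ q ∉ F ∧ L ⊆ F) ∨
    (p ∉ F ∧ q ∈ F ∧ L ⊆ F)}

/-- The family with kernel `{p, q}` and petal set `L` whose members avoiding `q` contain an edge
of the graph `𝒜`, and whose members avoiding `p` meet all edges of `𝒜`. -/
def starFam (n k p q : ℕ) (L M : Finset ℕ) (𝒜 : Finset (Finset ℕ)) : Finset (Finset ℕ) :=
  {F ∈ kSubsets n k | (p ∈ F ∧ q ∈ F ∧ ((∃ x ∈ L, x ∈ F) ∨ M ⊆ F)) ∨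
    (p ∈ F ∧ q ∉ F ∧ L ⊆ F ∧ ∃ X ∈ 𝒜, X ⊆ F) ∨
    (p ∉ F ∧ q ∈ F ∧ L ⊆ F ∧ ∀ X ∈ 𝒜, ∃ x ∈ X, x ∈ F)}

theorem hilFam_subset {n k p q : ℕ} {L : Finset ℕ} : hilFam n k p q L ⊆ kSubsets n k :=
  filter_subset _ _

theorem starFam_subset {n k p q : ℕ} {L M : Finset ℕ} {𝒜 : Finset (Finset ℕ)} :
    starFam n k p q L M 𝒜 ⊆ kSubsets n k :=
  filter_subset _ _

theorem hilFam_intersecting {n k p q : ℕ} {L : Finset ℕ} (hL : L.Nonempty) :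
    IsDWiseIntersecting 3 (hilFam n k p q L) := by
  obtain ⟨y, hy⟩ := hL
  refine isDWiseIntersecting_three fun A hA B hB C hC => ?_
  simp only [hilFam, mem_filter] at hA hB hC
  have hA := hA.2
  have hB := hB.2
  have hC := hC.2
  rcases hA with ⟨a1, a2, x, a3, a4⟩ | ⟨a1, a2, a3⟩ | ⟨a1, a2, a3⟩ <;>
  rcases hB with ⟨b1, b2, z, b3, b4⟩ | ⟨b1, b2, b3⟩ | ⟨b1, b2, b3⟩ <;>
  rcases hC with ⟨c1, c2, w, c3, c4⟩ | ⟨c1, c2, c3⟩ | ⟨c1, c2, c3⟩ <;>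
  first
    | exact ⟨p, by assumption, by assumption, by assumption⟩
    | exact ⟨q, by assumption, by assumption, by assumption⟩
    | exact ⟨y, a3 hy, b3 hy, c3 hy⟩
    | exact ⟨x, a4, b3 a3, c3 a3⟩
    | exact ⟨z, a3 b3, b4, c3 b3⟩
    | exact ⟨w, a3 c3, b3 c3, c4⟩

theorem starFam_intersecting {n k p q : ℕ} {L M : Finset ℕ} {𝒜 : Finset (Finset ℕ)}
    (hL : L.Nonempty) (h𝒜 : ∀ X ∈ 𝒜, X ⊆ M) :
    IsDWiseIntersecting 3 (starFam n k p q L M 𝒜) := by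
  obtain ⟨y, hy⟩ := hL
  -- The critical triple has one set of each kind. If `A` contains no petal, it contains `M` and so
  -- the edge `X ⊆ B`, and `C` meets `X`.
  have key : ∀ A B C : Finset ℕ, ((∃ x ∈ L, x ∈ A) ∨ M ⊆ A) → (L ⊆ B ∧ ∃ X ∈ 𝒜, X ⊆ B) →
      (L ⊆ C ∧ ∀ X ∈ 𝒜, ∃ x ∈ X, x ∈ C) → ∃ x, x ∈ A ∧ x ∈ B ∧ x ∈ C := by
    rintro A B C (⟨x, hx, hxA⟩ | hM) ⟨hB, X, hX, hXB⟩ ⟨hC, hXC⟩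
    · exact ⟨x, hxA, hB hx, hC hx⟩
    · obtain ⟨x, hx, hxC⟩ := hXC X hX
      exact ⟨x, hM (h𝒜 X hX hx), hXB hx, hxC⟩
  refine isDWiseIntersecting_three fun A hA B hB C hC => ?_
  simp only [starFam, mem_filter] at hA hB hC
  have hA := hA.2
  have hB := hB.2
  have hC := hC.2
  rcases hA with ⟨a1, a2, a3⟩ | ⟨a1, a2, a3⟩ | ⟨a1, a2, a3⟩ <;>
  rcases hB with ⟨b1, b2, b3⟩ | ⟨b1, b2, b3⟩ | ⟨b1, b2, b3⟩ <;>
  rcases hC with ⟨c1, c2, c3⟩ | ⟨c1, c2, c3⟩ | ⟨c1, c2, c3⟩ <;>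
  first
    | exact ⟨p, by assumption, by assumption, by assumption⟩
    | exact ⟨q, by assumption, by assumption, by assumption⟩
    | exact ⟨y, a3.1 hy, b3.1 hy, c3.1 hy⟩
    | exact (key A B C a3 b3 c3).imp fun x h => ⟨h.1, h.2.1, h.2.2⟩
    | exact (key A C B a3 c3 b3).imp fun x h => ⟨h.1, h.2.2, h.2.1⟩
    | exact (key B A C b3 a3 c3).imp fun x h => ⟨h.2.1, h.1, h.2.2⟩
    | exact (key B C A b3 c3 a3).imp fun x h => ⟨h.2.2, h.1, h.2.1⟩
    | exact (key C A B c3 a3 b3).imp fun x h => ⟨h.2.1, h.2.2, h.1⟩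
    | exact (key C B A c3 b3 a3).imp fun x h => ⟨h.2.2, h.2.1, h.1⟩

theorem exists_perm_extending {n : ℕ} {S : Finset ℕ} (hS : S ⊆ Icc 1 n) {f : ℕ → ℕ}
    (hf : Set.InjOn f S) (hfS : ∀ x ∈ S, f x ∈ Icc 1 n) :
    ∃ π : Equiv.Perm ℕ, (Icc 1 n).image π = Icc 1 n ∧ ∀ x ∈ S, π x = f x := by
  obtain ⟨g, hg⟩ := Finset.exists_equiv_extend_of_card_eq (α := {x // x ∈ Icc 1 n}) (β := ℕ)
    (t := Icc 1 n) (by simp) (s := S.subtype (· ∈ Icc 1 n)) (f := fun x => f x)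
    (by
      intro y hy
      simp only [mem_image, mem_subtype] at hy
      obtain ⟨x, hx, rfl⟩ := hy
      exact hfS _ hx)
    (by
      intro x hx y hy hxy
      simp only [mem_coe, mem_subtype] at hx hy
      exact Subtype.ext (hf hx hy hxy))
  refine ⟨Equiv.Perm.ofSubtype g, ?_, fun x hx => ?_⟩
  · apply eq_of_subset_of_card_le
    · intro y hy
      obtain ⟨x, hx, rfl⟩ := mem_image.1 hy
      rw [Equiv.Perm.ofSubtype_apply_of_mem g hx]
      exact (g ⟨x, hx⟩).2
    · rw [card_image_of_injective _ (Equiv.injective _)]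
  · rw [Equiv.Perm.ofSubtype_apply_of_mem g (hS hx)]
    exact hg _ (by simpa using hx)

theorem image_filter_kSubsets {n k : ℕ} {π : Equiv.Perm ℕ} (hπ : (Icc 1 n).image π = Icc 1 n)
    {P Q : Finset ℕ → Prop} [DecidablePred P] [DecidablePred Q]
    (h : ∀ F, P F ↔ Q (F.image π)) :
    {F ∈ kSubsets n k | P F}.image (fun F => F.image π) = {F ∈ kSubsets n k | Q F} := by
  ext G
  simp only [mem_image, mem_filter, mem_kSubsets]
  constructor
  · rintro ⟨F, ⟨⟨h1, h2⟩, h3⟩, rfl⟩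
    exact ⟨⟨hπ ▸ image_subset_image h1, (card_image_of_injective _ π.injective).trans h2⟩,
      (h F).1 h3⟩
  · rintro ⟨⟨h1, h2⟩, h3⟩
    have hG : (G.image π.symm).image π = G := by
      rw [image_image]
      simp
    refine ⟨G.image π.symm, ⟨⟨?_, (card_image_of_injective _ π.symm.injective).trans h2⟩,
      (h _).2 (by rwa [hG])⟩, hG⟩
    rw [← hG, ← hπ] at h1
    exact (image_subset_image_iff π.injective).1 h1

theorem image_hilFam {n k p q : ℕ} {L : Finset ℕ} {π : Equiv.Perm ℕ}
    (hπ : (Icc 1 n).image π = Icc 1 n) :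
    (hilFam n k p q L).image (fun F => F.image π) = hilFam n k (π p) (π q) (L.image π) := by
  refine image_filter_kSubsets hπ fun F => ?_
  simp only [π.injective.mem_finset_image, image_subset_image_iff π.injective,
    exists_mem_image]

theorem image_starFam {n k p q : ℕ} {L M : Finset ℕ} {𝒜 : Finset (Finset ℕ)} {π : Equiv.Perm ℕ}
    (hπ : (Icc 1 n).image π = Icc 1 n) :
    (starFam n k p q L M 𝒜).image (fun F => F.image π) =
      starFam n k (π p) (π q) (L.image π) (M.image π) (𝒜.image fun X => X.image π) := by
  refine image_filter_kSubsets hπ fun F => ?_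
  simp only [π.injective.mem_finset_image, image_subset_image_iff π.injective,
    exists_mem_image, forall_mem_image]

/-- The permutation also follows a prescribed injection `f` on the set `S` of graph vertices. The
values of `f` begin at `l + 3`, just above the places reserved for the kernel and the petals. -/
theorem exists_perm_standard {n p q l : ℕ} {L : Finset ℕ} (hp : p ∈ Icc 1 n) (hq : q ∈ Icc 1 n)
    (hpq : p ≠ q) (hL : L ⊆ Icc 1 n) (hpL : p ∉ L) (hqL : q ∉ L) (hl : L.card = l)
    {S : Finset ℕ} (hS : S ⊆ Icc 1 n) (hpS : p ∉ S) (hqS : q ∉ S) (hLS : Disjoint L S)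
    {f : ℕ → ℕ} (hf : Set.InjOn f S) (hfS : ∀ x ∈ S, f x ∈ Icc (l + 3) n) (hn : l + 2 ≤ n) :
    ∃ π : Equiv.Perm ℕ, (Icc 1 n).image π = Icc 1 n ∧ π p = 1 ∧ π q = 2 ∧
      L.image π = Icc 3 (l + 2) ∧ ∀ x ∈ S, π x = f x := by
  obtain ⟨e⟩ : Nonempty ({x // x ∈ L} ≃ {x // x ∈ Icc 3 (l + 2)}) :=
    ⟨Finset.equivOfCardEq (by simp [hl])⟩
  let g : ℕ → ℕ := fun x => if x = p then 1 else if x = q then 2 else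
    if h : x ∈ L then e ⟨x, h⟩ else f x
  have gp : g p = 1 := by simp [g]
  have gq : g q = 2 := by simp [g, hpq.symm]
  have gL : ∀ x (h : x ∈ L), g x = e ⟨x, h⟩ := fun x h => by
    have h1 : x ≠ p := fun h' => hpL (h' ▸ h)
    have h2 : x ≠ q := fun h' => hqL (h' ▸ h)
    simp [g, h1, h2, h]
  have gS : ∀ x ∈ S, g x = f x := fun x h => by
    have h1 : x ≠ p := fun h' => hpS (h' ▸ h)
    have h2 : x ≠ q := fun h' => hqS (h' ▸ h)
    simp [g, h1, h2, disjoint_right.1 hLS h]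
  have gL' : ∀ x ∈ L, 3 ≤ g x ∧ g x ≤ l + 2 := fun x h => by
    rw [gL x h]
    exact mem_Icc.1 (e ⟨x, h⟩).2
  have gS' : ∀ x ∈ S, l + 3 ≤ g x ∧ g x ≤ n := fun x h => by
    rw [gS x h]
    simpa using hfS x h
  obtain ⟨π, hπ, hπg⟩ := exists_perm_extending (n := n) (S := insert p (insert q (L ∪ S))) (f := g)
    (insert_subset hp (insert_subset hq (union_subset hL hS)))
    (by
      intro x hx y hy hxy
      simp only [coe_insert, coe_union, Set.mem_insert_iff, Set.mem_union, mem_coe] at hx hy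
      rcases hx with rfl | rfl | hx | hx <;> rcases hy with rfl | rfl | hy | hy
      · rfl
      · omega
      · have := gL' y hy; omega
      · have := gS' y hy; omega
      · omega
      · rfl
      · have := gL' y hy; omega
      · have := gS' y hy; omega
      · have := gL' x hx; omega
      · have := gL' x hx; omega
      · rw [gL x hx, gL y hy] at hxy
        simpa using e.injective (Subtype.ext hxy)
      · have := gL' x hx; have := gS' y hy; omega
      · have := gS' x hx; omega
      · have := gS' x hx; omega
      · have := gL' y hy; have := gS' x hx; omega
      · rw [gS x hx, gS y hy] at hxy
        exact hf hx hy hxy)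
    (by
      intro x hx
      simp only [mem_insert, mem_union] at hx
      rw [mem_Icc]
      rcases hx with rfl | rfl | hx | hx
      · omega
      · omega
      · have := gL' x hx; omega
      · have := gS' x hx; omega)
  refine ⟨π, hπ, (hπg p (by simp)).trans gp, (hπg q (by simp)).trans gq, ?_, fun x hx => ?_⟩
  · apply eq_of_subset_of_card_le
    · intro y hy
      obtain ⟨x, hx, rfl⟩ := mem_image.1 hy
      rw [hπg x (by simp [hx]), mem_Icc]
      exact gL' x hx
    · rw [card_image_of_injective _ π.injective]
      simp [hl]
  · rw [hπg x (by simp [hx]), gS x hx]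

theorem famH_eq (n k l : ℕ) : famH n k 3 l = hilFam n k 1 2 (Icc 3 (l + 2)) := by
  have h12 : Icc 1 (3 - 1) = ({1, 2} : Finset ℕ) := rfl
  have hl : 3 + l - 1 = l + 2 := by omega
  ext F
  simp only [famH, hilFam, mem_union, mem_filter, hl, h12, insert_subset_iff,
    singleton_subset_iff, Finset.Nonempty, mem_inter]
  have hc : (({1, 2} : Finset ℕ) ∩ F).card = 3 - 2 ↔ (1 ∈ F ∧ 2 ∉ F) ∨ (1 ∉ F ∧ 2 ∈ F) := by
    by_cases h1 : 1 ∈ F <;> by_cases h2 : 2 ∈ F <;> simp [h1, h2,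
      insert_inter_of_mem, insert_inter_of_notMem]
  rw [hc]
  constructor
  · rintro (⟨h, ⟨h1, h2⟩, x, h3, h4⟩ | ⟨h, h1, h2⟩)
    · exact ⟨h, Or.inl ⟨h1, h2, x, h4, h3⟩⟩
    · exact ⟨h, Or.inr (by tauto)⟩
  · rintro ⟨h, ⟨h1, h2, x, h3, h4⟩ | h1 | h1⟩
    · exact Or.inl ⟨h, ⟨h1, h2⟩, x, h4, h3⟩
    · exact Or.inr ⟨h, by tauto⟩
    · exact Or.inr ⟨h, by tauto⟩

theorem hilFam_isomorphic {n k p q l : ℕ} {L : Finset ℕ} (hp : p ∈ Icc 1 n) (hq : q ∈ Icc 1 n)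
    (hpq : p ≠ q) (hL : L ⊆ Icc 1 n) (hpL : p ∉ L) (hqL : q ∉ L) (hl : L.card = l)
    (hn : l + 2 ≤ n) : Isomorphic n (hilFam n k p q L) (famH n k 3 l) := by
  obtain ⟨π, hπ, h1, h2, h3, -⟩ := exists_perm_standard hp hq hpq hL hpL hqL hl
    (empty_subset _) (notMem_empty _) (notMem_empty _) (disjoint_empty_right _) (f := id)
    (by simp) (by simp) hn
  exact ⟨π, hπ, by rw [image_hilFam hπ, h1, h2, h3, famH_eq]⟩

theorem Isomorphic.card_eq {n : ℕ} {𝓕 𝓖 : Finset (Finset ℕ)} (h : Isomorphic n 𝓕 𝓖) :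
    𝓕.card = 𝓖.card := by
  obtain ⟨π, -, rfl⟩ := h
  rw [card_image_of_injective]
  exact image_injective π.injective

/-! ### Cross-intersecting pairs of graphs without a common vertex -/

/-- The graph `A` consists of edges of `𝒜`, the edges of the graph `B` meet all edges of `𝒜`, and
each vertex in `M` is the only common vertex of some edge of `A` and some edge of `B`. -/
def Fits (A B : ℕ → ℕ → Prop) (M : Finset ℕ) (𝒜 : Finset (Finset ℕ)) : Prop :=
  (∀ x y, A x y → {x, y} ∈ 𝒜) ∧ (∀ x y, B x y → ∀ X ∈ 𝒜, x ∈ X ∨ y ∈ X) ∧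
    ∀ v ∈ M, ∃ x y, x ≠ y ∧ A v x ∧ B v y

/-- Up to isomorphism, the maximal graphs in a cross-intersecting pair without common vertex. -/
inductive IsConfig : Finset ℕ → Finset (Finset ℕ) → Prop
  | edge {a b : ℕ} (hab : a ≠ b) : IsConfig {a, b} {{a, b}}
  | cherry {a b c : ℕ} (hab : a ≠ b) (hac : a ≠ c) (hbc : b ≠ c) :
      IsConfig {a, b, c} {{a, b}, {a, c}}
  | triangle {a b c : ℕ} (hab : a ≠ b) (hac : a ≠ c) (hbc : b ≠ c) :
      IsConfig {a, b, c} {{a, b}, {b, c}, {a, c}}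
  | matching {a b c d : ℕ} (hab : a ≠ b) (hac : a ≠ c) (had : a ≠ d) (hbc : b ≠ c) (hbd : b ≠ d)
      (hcd : c ≠ d) : IsConfig {a, b, c, d} {{a, c}, {b, d}}
  | path {a b c d : ℕ} (hab : a ≠ b) (hac : a ≠ c) (had : a ≠ d) (hbc : b ≠ c) (hbd : b ≠ d)
      (hcd : c ≠ d) : IsConfig {a, b, c, d} {{a, b}, {b, c}, {c, d}}

section Graph

variable {A B : ℕ → ℕ → Prop}

/-- Since no vertex lies on all edges, some `B`-edge avoids `a` and some `B`-edge avoids `b`; both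
meet `ab`, so each passes through the other end. -/
theorem exists_fits_of_single (hAs : ∀ x y, A x y → A y x) (hBs : ∀ x y, B x y → B y x)
    (hAi : ∀ x y, A x y → x ≠ y)
    (hc : ∀ x y u v, A x y → B u v → x = u ∨ x = v ∨ y = u ∨ y = v)
    (hv : ∀ v, (∃ x y, A x y ∧ v ≠ x ∧ v ≠ y) ∨ ∃ x y, B x y ∧ v ≠ x ∧ v ≠ y)
    {a b : ℕ} (hab : A a b) (h : ∀ x y, A x y → (x = a ∧ y = b) ∨ (x = b ∧ y = a)) :
    ∃ M 𝒜, IsConfig M 𝒜 ∧ Fits A B M 𝒜 := by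
  refine ⟨_, _, IsConfig.edge (hAi _ _ hab), ?_, ?_, ?_⟩
  · intro x y hxy
    rcases h x y hxy with ⟨rfl, rfl⟩ | ⟨rfl, rfl⟩
    · simp
    · simp [pair_comm]
  · intro x y hxy X hX
    have := hc _ _ _ _ hab hxy
    grind
  · intro v hv'
    rcases hv a with ⟨x, y, hxy⟩ | ⟨x, y, hxy⟩
    · grind
    rcases hv b with ⟨x', y', hxy'⟩ | ⟨x', y', hxy'⟩
    · grind
    have h1 := hc _ _ _ _ hab hxy.1
    have h2 := hc _ _ _ _ hab hxy'.1
    have h3 := hAs _ _ hab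
    have h4 := hBs _ _ hxy.1
    have h5 := hBs _ _ hxy'.1
    simp only [mem_insert, mem_singleton] at hv'
    grind

/-- Only the last clause of `Fits` needs input. At a leaf the `A`-edge is the one to the centre, so
a `B`-edge that does not go to the centre suffices. The lemmas for the matching and the path follow
the same pattern. -/
theorem fits_cherry (hAs : ∀ x y, A x y → A y x)
    (hc : ∀ x y u v, A x y → B u v → x = u ∨ x = v ∨ y = u ∨ y = v) {a b c : ℕ}
    (hab : A a b) (hac : A a c)
    (h : ∀ x y, A x y → (x = a ∧ y = b) ∨ (x = b ∧ y = a) ∨ (x = a ∧ y = c) ∨ (x = c ∧ y = a))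
    (ha : ∃ x y, x ≠ y ∧ A a x ∧ B a y) (hb : ∃ y, a ≠ y ∧ B b y) (hc' : ∃ y, a ≠ y ∧ B c y) :
    Fits A B {a, b, c} {{a, b}, {a, c}} := by
  refine ⟨?_, ?_, ?_⟩
  · intro x y hxy
    rcases h x y hxy with ⟨rfl, rfl⟩ | ⟨rfl, rfl⟩ | ⟨rfl, rfl⟩ | ⟨rfl, rfl⟩ <;> simp [pair_comm]
  · intro x y hxy X hX
    have h1 := hc _ _ _ _ hab hxy
    have h2 := hc _ _ _ _ hac hxy
    simp only [mem_insert, mem_singleton] at hX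
    rcases hX with rfl | rfl <;> grind
  · intro v hv
    simp only [mem_insert, mem_singleton] at hv
    rcases hv with rfl | rfl | rfl
    · exact ha
    · exact ⟨a, hb.choose, hb.choose_spec.1, hAs _ _ hab, hb.choose_spec.2⟩
    · exact ⟨a, hc'.choose, hc'.choose_spec.1, hAs _ _ hac, hc'.choose_spec.2⟩

theorem fits_matching (hAs : ∀ x y, A x y → A y x)
    (hc : ∀ x y u v, A x y → B u v → x = u ∨ x = v ∨ y = u ∨ y = v) {a b c d : ℕ}
    (hac : A a c) (hbd : A b d)
    (h : ∀ x y, A x y → (x = a ∧ y = c) ∨ (x = c ∧ y = a) ∨ (x = b ∧ y = d) ∨ (x = d ∧ y = b))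
    (h1 : ∃ y, c ≠ y ∧ B a y) (h2 : ∃ y, d ≠ y ∧ B b y) (h3 : ∃ y, a ≠ y ∧ B c y)
    (h4 : ∃ y, b ≠ y ∧ B d y) :
    Fits A B {a, b, c, d} {{a, c}, {b, d}} := by
  refine ⟨?_, ?_, ?_⟩
  · intro x y hxy
    rcases h x y hxy with ⟨rfl, rfl⟩ | ⟨rfl, rfl⟩ | ⟨rfl, rfl⟩ | ⟨rfl, rfl⟩ <;> simp [pair_comm]
  · intro x y hxy X hX
    have h1 := hc _ _ _ _ hac hxy
    have h2 := hc _ _ _ _ hbd hxy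
    simp only [mem_insert, mem_singleton] at hX
    rcases hX with rfl | rfl <;> grind
  · intro v hv
    simp only [mem_insert, mem_singleton] at hv
    rcases hv with rfl | rfl | rfl | rfl
    · exact ⟨c, h1.choose, h1.choose_spec.1, hac, h1.choose_spec.2⟩
    · exact ⟨d, h2.choose, h2.choose_spec.1, hbd, h2.choose_spec.2⟩
    · exact ⟨a, h3.choose, h3.choose_spec.1, hAs _ _ hac, h3.choose_spec.2⟩
    · exact ⟨b, h4.choose, h4.choose_spec.1, hAs _ _ hbd, h4.choose_spec.2⟩

theorem fits_path (hAs : ∀ x y, A x y → A y x)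
    (hc : ∀ x y u v, A x y → B u v → x = u ∨ x = v ∨ y = u ∨ y = v) {a b c d : ℕ}
    (hab : A a b) (hbc : A b c) (hcd : A c d)
    (h : ∀ x y, A x y → (x = a ∧ y = b) ∨ (x = b ∧ y = a) ∨ (x = b ∧ y = c) ∨ (x = c ∧ y = b) ∨
      (x = c ∧ y = d) ∨ (x = d ∧ y = c))
    (h1 : ∃ y, b ≠ y ∧ B a y) (h2 : ∃ x y, x ≠ y ∧ A b x ∧ B b y)
    (h3 : ∃ x y, x ≠ y ∧ A c x ∧ B c y) (h4 : ∃ y, c ≠ y ∧ B d y) :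
    Fits A B {a, b, c, d} {{a, b}, {b, c}, {c, d}} := by
  refine ⟨?_, ?_, ?_⟩
  · intro x y hxy
    rcases h x y hxy with ⟨rfl, rfl⟩ | ⟨rfl, rfl⟩ | ⟨rfl, rfl⟩ | ⟨rfl, rfl⟩ | ⟨rfl, rfl⟩ |
      ⟨rfl, rfl⟩ <;> simp [pair_comm]
  · intro x y hxy X hX
    have h1 := hc _ _ _ _ hab hxy
    have h2 := hc _ _ _ _ hbc hxy
    have h3 := hc _ _ _ _ hcd hxy
    simp only [mem_insert, mem_singleton] at hX
    rcases hX with rfl | rfl | rfl <;> grind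
  · intro v hv
    simp only [mem_insert, mem_singleton] at hv
    rcases hv with rfl | rfl | rfl | rfl
    · exact ⟨b, h1.choose, h1.choose_spec.1, hab, h1.choose_spec.2⟩
    · exact h2
    · exact h3
    · exact ⟨c, h4.choose, h4.choose_spec.1, hAs _ _ hcd, h4.choose_spec.2⟩

/-- For the path `w, x, y, z`, the middle edge requires `x` or `y`; without `y` the last edge
requires `z`, and without `x` the first requires `w`. These covers are the edges of the path `w, y,
x, z`, which is why the path is paired with a path. -/
theorem path_cover {w x y z u v : ℕ} (hxy : x ≠ y) (hxz : x ≠ z) (hwy : w ≠ y)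
    (h1 : u = w ∨ u = x ∨ v = w ∨ v = x) (h2 : u = x ∨ u = y ∨ v = x ∨ v = y)
    (h3 : u = y ∨ u = z ∨ v = y ∨ v = z) :
    (u = x ∧ v = y) ∨ (u = y ∧ v = x) ∨ (u = w ∧ v = y) ∨ (u = y ∧ v = w) ∨ (u = x ∧ v = z) ∨
      (u = z ∧ v = x) := by
  grind

/-- As `ab` and `cd` are disjoint, every `B`-edge is a side `ac`, `ad`, `bc` or `bd` of a
four-cycle. Three sides in `B` form a path and confine `A` to `ab`, `cd` and the middle edge of that
path, so `A` is a path or a matching. Exactly two sides make `B` a matching or a cherry, and the two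
graphs exchange roles. A single side is excluded by `hne`. -/
theorem exists_fits_of_disjoint (hAs : ∀ x y, A x y → A y x) (hBs : ∀ x y, B x y → B y x)
    (hAi : ∀ x y, A x y → x ≠ y) (hBi : ∀ x y, B x y → x ≠ y)
    (hc : ∀ x y u v, A x y → B u v → x = u ∨ x = v ∨ y = u ∨ y = v)
    {a b c d : ℕ} (hab : A a b) (hcd : A c d) (hac' : a ≠ c) (had' : a ≠ d) (hbc' : b ≠ c)
    (hbd' : b ≠ d) (hac : B a c)
    (hne : ∃ x y, B x y ∧ ¬ ((x = a ∧ y = c) ∨ (x = c ∧ y = a))) :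
    ∃ M 𝒜, IsConfig M 𝒜 ∧ (Fits A B M 𝒜 ∨ Fits B A M 𝒜) := by
  have hab' := hAi _ _ hab
  have hcd' := hAi _ _ hcd
  have hba := hAs _ _ hab
  have hdc := hAs _ _ hcd
  have hca := hBs _ _ hac
  have eB : ∀ x y, B x y → (x = a ∧ y = c) ∨ (x = c ∧ y = a) ∨ (x = a ∧ y = d) ∨
      (x = d ∧ y = a) ∨ (x = b ∧ y = c) ∨ (x = c ∧ y = b) ∨ (x = b ∧ y = d) ∨
      (x = d ∧ y = b) := by
    intro x y hxy
    have h1 := hc _ _ _ _ hab hxy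
    have h2 := hc _ _ _ _ hcd hxy
    have h3 := hBi _ _ hxy
    grind
  have hc' : ∀ x y u v, B x y → A u v → x = u ∨ x = v ∨ y = u ∨ y = v := fun x y u v h1 h2 => by
    have := hc _ _ _ _ h2 h1
    tauto
  have m1 : (∀ x y, A x y → (x = a ∧ y = b) ∨ (x = b ∧ y = a) ∨ (x = c ∧ y = d) ∨
      (x = d ∧ y = c)) → (∃ y, b ≠ y ∧ B a y) → (∃ y, d ≠ y ∧ B c y) → (∃ y, a ≠ y ∧ B b y) →
      (∃ y, c ≠ y ∧ B d y) → ∃ M 𝒜, IsConfig M 𝒜 ∧ (Fits A B M 𝒜 ∨ Fits B A M 𝒜) :=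
    fun h h1 h2 h3 h4 => ⟨_, _, IsConfig.matching hac' hab' had' hbc'.symm hcd' hbd',
      Or.inl (fits_matching hAs hc hab hcd h h1 h2 h3 h4)⟩
  by_cases bd : B b d
  · have db := hBs _ _ bd
    by_cases ad : B a d
    · have da := hBs _ _ ad
      have hl : ∀ x y, A x y → (x = b ∧ y = a) ∨ (x = a ∧ y = b) ∨ (x = a ∧ y = d) ∨
          (x = d ∧ y = a) ∨ (x = d ∧ y = c) ∨ (x = c ∧ y = d) := fun x y hxy => by
        rcases path_cover had' hab' hcd' (hc _ _ _ _ hxy hca) (hc _ _ _ _ hxy ad)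
          (hc _ _ _ _ hxy db) with h | h | h | h | h | h <;>
        simp [h.1, h.2]
      by_cases ad' : A a d
      · exact ⟨_, _, IsConfig.path hab'.symm hbd' hbc' had' hac' hcd'.symm,
          Or.inl (fits_path hAs hc hba ad' hdc hl ⟨d, had', bd⟩ ⟨b, c, hbc', hab, hac⟩
            ⟨c, b, hbc'.symm, hdc, db⟩ ⟨a, had'.symm, hca⟩)⟩
      · have da' : ¬ A d a := fun h => ad' (hAs _ _ h)
        exact m1 (fun x y h => by
              rcases hl x y h with ⟨rfl, rfl⟩ | ⟨rfl, rfl⟩ | ⟨rfl, rfl⟩ | ⟨rfl, rfl⟩ | ⟨rfl, rfl⟩ |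
                ⟨rfl, rfl⟩ <;> first | contradiction | simp)
            ⟨c, hbc', hac⟩ ⟨a, had'.symm, hca⟩ ⟨d, had', bd⟩ ⟨b, hbc'.symm, db⟩
    by_cases bc : B b c
    · have cb := hBs _ _ bc
      have hl : ∀ x y, A x y → (x = a ∧ y = b) ∨ (x = b ∧ y = a) ∨ (x = b ∧ y = c) ∨
          (x = c ∧ y = b) ∨ (x = c ∧ y = d) ∨ (x = d ∧ y = c) := fun x y hxy => by
        rcases path_cover hbc'.symm hcd' hab' (hc _ _ _ _ hxy hac) (hc _ _ _ _ hxy cb)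
          (hc _ _ _ _ hxy bd) with h | h | h | h | h | h <;>
        simp [h.1, h.2]
      by_cases bc' : A b c
      · exact ⟨_, _, IsConfig.path hab' hac' had' hbc' hbd' hcd',
          Or.inl (fits_path hAs hc hab bc' hcd hl ⟨c, hbc', hac⟩ ⟨a, d, had', hba, bd⟩
            ⟨d, a, had'.symm, hcd, hca⟩ ⟨b, hbc'.symm, db⟩)⟩
      · have cb' : ¬ A c b := fun h => bc' (hAs _ _ h)
        exact m1 (fun x y h => by
              rcases hl x y h with ⟨rfl, rfl⟩ | ⟨rfl, rfl⟩ | ⟨rfl, rfl⟩ | ⟨rfl, rfl⟩ | ⟨rfl, rfl⟩ |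
                ⟨rfl, rfl⟩ <;> first | contradiction | simp)
            ⟨c, hbc', hac⟩ ⟨a, had'.symm, hca⟩ ⟨d, had', bd⟩ ⟨b, hbc'.symm, db⟩
    · have da : ¬ B d a := fun h => ad (hBs _ _ h)
      have cb : ¬ B c b := fun h => bc (hBs _ _ h)
      exact ⟨_, _, IsConfig.matching hab' hac' had' hbc' hbd' hcd',
        Or.inr (fits_matching hBs hc' hac bd (fun x y h => by
            rcases eB x y h with ⟨rfl, rfl⟩ | ⟨rfl, rfl⟩ | ⟨rfl, rfl⟩ | ⟨rfl, rfl⟩ | ⟨rfl, rfl⟩ |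
              ⟨rfl, rfl⟩ | ⟨rfl, rfl⟩ | ⟨rfl, rfl⟩ <;> first | contradiction | simp) ⟨b, hbc'.symm, hab⟩ ⟨a, had'.symm, hba⟩
          ⟨d, had', hcd⟩ ⟨c, hbc', hdc⟩)⟩
  · have db : ¬ B d b := fun h => bd (hBs _ _ h)
    by_cases ad : B a d
    · have da := hBs _ _ ad
      by_cases bc : B b c
      · have cb := hBs _ _ bc
        have hl : ∀ x y, A x y → (x = b ∧ y = a) ∨ (x = a ∧ y = b) ∨ (x = a ∧ y = c) ∨
            (x = c ∧ y = a) ∨ (x = c ∧ y = d) ∨ (x = d ∧ y = c) := fun x y hxy => by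
          rcases path_cover hac' hab' hcd'.symm (hc _ _ _ _ hxy da) (hc _ _ _ _ hxy hac)
            (hc _ _ _ _ hxy cb) with h | h | h | h | h | h <;>
          simp [h.1, h.2]
        by_cases ac' : A a c
        · exact ⟨_, _, IsConfig.path hab'.symm hbc' hbd' hac' had' hcd',
            Or.inl (fits_path hAs hc hba ac' hcd hl ⟨c, hac', bc⟩ ⟨b, d, hbd', hab, ad⟩
              ⟨d, b, hbd'.symm, hcd, cb⟩ ⟨a, hac'.symm, da⟩)⟩
        · have ca' : ¬ A c a := fun h => ac' (hAs _ _ h)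
          exact m1 (fun x y h => by
                rcases hl x y h with ⟨rfl, rfl⟩ | ⟨rfl, rfl⟩ | ⟨rfl, rfl⟩ | ⟨rfl, rfl⟩ | ⟨rfl, rfl⟩ |
                  ⟨rfl, rfl⟩ <;> first | contradiction | simp)
              ⟨c, hbc', hac⟩ ⟨a, had'.symm, hca⟩ ⟨c, hac', bc⟩ ⟨a, hac'.symm, da⟩
      · have cb : ¬ B c b := fun h => bc (hBs _ _ h)
        exact ⟨_, _, IsConfig.cherry hac' had' hcd',
          Or.inr (fits_cherry hBs hc' hac ad (fun x y h => by
              rcases eB x y h with ⟨rfl, rfl⟩ | ⟨rfl, rfl⟩ | ⟨rfl, rfl⟩ | ⟨rfl, rfl⟩ | ⟨rfl, rfl⟩ |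
                ⟨rfl, rfl⟩ | ⟨rfl, rfl⟩ | ⟨rfl, rfl⟩ <;> first | contradiction | simp) ⟨c, b, hbc'.symm, hac, hab⟩
            ⟨d, had', hcd⟩ ⟨c, hac', hdc⟩)⟩
    · have da : ¬ B d a := fun h => ad (hBs _ _ h)
      have bc : B b c := by
        obtain ⟨x, y, hxy, hne⟩ := hne
        have h1 := eB x y hxy
        have h2 := hBs _ _ hxy
        grind
      have cb := hBs _ _ bc
      exact ⟨_, _, IsConfig.cherry hac'.symm hbc'.symm hab',
        Or.inr (fits_cherry hBs hc' hca cb (fun x y h => by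
            rcases eB x y h with ⟨rfl, rfl⟩ | ⟨rfl, rfl⟩ | ⟨rfl, rfl⟩ | ⟨rfl, rfl⟩ | ⟨rfl, rfl⟩ |
              ⟨rfl, rfl⟩ | ⟨rfl, rfl⟩ | ⟨rfl, rfl⟩ <;> first | contradiction | simp) ⟨a, d, had', hca, hcd⟩
          ⟨b, hbc'.symm, hab⟩ ⟨a, hac'.symm, hba⟩)⟩

/-- A `B`-edge meets both `ab` and `cd`, hence joins them; renaming the ends of these two edges
makes it `ac`. -/
theorem exists_fits_of_disjoint_edges (hAs : ∀ x y, A x y → A y x) (hBs : ∀ x y, B x y → B y x)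
    (hAi : ∀ x y, A x y → x ≠ y) (hBi : ∀ x y, B x y → x ≠ y)
    (hc : ∀ x y u v, A x y → B u v → x = u ∨ x = v ∨ y = u ∨ y = v)
    (hBne : ∃ x y, B x y)
    (hne : ∀ a b, B a b → ∃ x y, B x y ∧ ¬ ((x = a ∧ y = b) ∨ (x = b ∧ y = a)))
    {a b c d : ℕ} (hab : A a b) (hcd : A c d) (hac' : a ≠ c) (had' : a ≠ d) (hbc' : b ≠ c)
    (hbd' : b ≠ d) :
    ∃ M 𝒜, IsConfig M 𝒜 ∧ (Fits A B M 𝒜 ∨ Fits B A M 𝒜) := by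
  obtain ⟨x, y, hxy⟩ := hBne
  have h1 := hc _ _ _ _ hab hxy
  have h2 := hc _ _ _ _ hcd hxy
  have hyx := hBs _ _ hxy
  have h3 := hBi _ _ hxy
  have : B a c ∨ B a d ∨ B b c ∨ B b d := by grind
  rcases this with h | h | h | h
  · exact exists_fits_of_disjoint hAs hBs hAi hBi hc hab hcd hac' had' hbc' hbd' h (hne _ _ h)
  · exact exists_fits_of_disjoint hAs hBs hAi hBi hc hab (hAs _ _ hcd) had' hac' hbd' hbc' h
      (hne _ _ h)
  · exact exists_fits_of_disjoint hAs hBs hAi hBi hc (hAs _ _ hab) hcd hbc' hbd' hac' had' h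
      (hne _ _ h)
  · exact exists_fits_of_disjoint hAs hBs hAi hBi hc (hAs _ _ hab) (hAs _ _ hcd) hbd' hbc' had'
      hac' h (hne _ _ h)

/-- Classification of cross-intersecting pairs of graphs without common vertex. -/
theorem exists_fits (hAs : ∀ x y, A x y → A y x) (hBs : ∀ x y, B x y → B y x)
    (hAi : ∀ x y, A x y → x ≠ y) (hBi : ∀ x y, B x y → x ≠ y)
    (hAne : ∃ x y, A x y) (hBne : ∃ x y, B x y)
    (hc : ∀ x y u v, A x y → B u v → x = u ∨ x = v ∨ y = u ∨ y = v)
    (hv : ∀ v, (∃ x y, A x y ∧ v ≠ x ∧ v ≠ y) ∨ ∃ x y, B x y ∧ v ≠ x ∧ v ≠ y) :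
    ∃ M 𝒜, IsConfig M 𝒜 ∧ (Fits A B M 𝒜 ∨ Fits B A M 𝒜) := by
  have hc' : ∀ x y u v, B x y → A u v → x = u ∨ x = v ∨ y = u ∨ y = v := fun x y u v h1 h2 => by
    have := hc _ _ _ _ h2 h1
    tauto
  by_cases hA1 : ∃ a b, A a b ∧ ∀ x y, A x y → (x = a ∧ y = b) ∨ (x = b ∧ y = a)
  · obtain ⟨a, b, hab, h⟩ := hA1
    obtain ⟨M, 𝒜, h1, h2⟩ := exists_fits_of_single hAs hBs hAi hc hv hab h
    exact ⟨M, 𝒜, h1, Or.inl h2⟩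
  by_cases hB1 : ∃ a b, B a b ∧ ∀ x y, B x y → (x = a ∧ y = b) ∨ (x = b ∧ y = a)
  · obtain ⟨a, b, hab, h⟩ := hB1
    obtain ⟨M, 𝒜, h1, h2⟩ := exists_fits_of_single hBs hAs hBi hc' (fun v => (hv v).symm) hab h
    exact ⟨M, 𝒜, h1, Or.inr h2⟩
  have hA2 : ∀ a b, A a b → ∃ x y, A x y ∧ ¬ ((x = a ∧ y = b) ∨ (x = b ∧ y = a)) := by
    intro a b hab
    by_contra! hcon
    exact hA1 ⟨a, b, hab, fun x y hxy => by have := hcon x y hxy; tauto⟩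
  have hB2 : ∀ a b, B a b → ∃ x y, B x y ∧ ¬ ((x = a ∧ y = b) ∨ (x = b ∧ y = a)) := by
    intro a b hab
    by_contra! hcon
    exact hB1 ⟨a, b, hab, fun x y hxy => by have := hcon x y hxy; tauto⟩
  by_cases hA3 : ∃ a b c d, A a b ∧ A c d ∧ a ≠ c ∧ a ≠ d ∧ b ≠ c ∧ b ≠ d
  · obtain ⟨a, b, c, d, h1, h2, h3, h4, h5, h6⟩ := hA3
    exact exists_fits_of_disjoint_edges hAs hBs hAi hBi hc hBne hB2 h1 h2 h3 h4 h5 h6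
  by_cases hB3 : ∃ a b c d, B a b ∧ B c d ∧ a ≠ c ∧ a ≠ d ∧ b ≠ c ∧ b ≠ d
  · obtain ⟨a, b, c, d, h1, h2, h3, h4, h5, h6⟩ := hB3
    obtain ⟨M, 𝒜, h7, h8⟩ :=
      exists_fits_of_disjoint_edges hBs hAs hBi hAi hc' hAne hA2 h1 h2 h3 h4 h5 h6
    exact ⟨M, 𝒜, h7, h8.symm⟩
  -- Now neither graph has two disjoint edges, so all edges of both graphs meet pairwise. As no
  -- vertex lies on all of them, they are sides of one triangle.
  have iA : ∀ x y u v, A x y → A u v → x = u ∨ x = v ∨ y = u ∨ y = v := by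
    intro x y u v h1 h2
    by_contra! hcon
    exact hA3 ⟨x, y, u, v, h1, h2, hcon⟩
  have iB : ∀ x y u v, B x y → B u v → x = u ∨ x = v ∨ y = u ∨ y = v := by
    intro x y u v h1 h2
    by_contra! hcon
    exact hB3 ⟨x, y, u, v, h1, h2, hcon⟩
  obtain ⟨a, b, c, hab, hac, hbc⟩ : ∃ a b c, A a b ∧ A a c ∧ b ≠ c := by
    obtain ⟨x, y, hxy⟩ := hAne
    obtain ⟨u, v, huv, hne⟩ := hA2 x y hxy
    have h1 := iA _ _ _ _ hxy huv
    have h2 := hAs _ _ hxy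
    have h3 := hAs _ _ huv
    rcases h1 with rfl | rfl | rfl | rfl
    · exact ⟨x, y, v, hxy, huv, by rintro rfl; exact hne (Or.inl ⟨rfl, rfl⟩)⟩
    · exact ⟨x, y, u, hxy, h3, by rintro rfl; exact hne (Or.inr ⟨rfl, rfl⟩)⟩
    · exact ⟨y, x, v, h2, huv, by rintro rfl; exact hne (Or.inr ⟨rfl, rfl⟩)⟩
    · exact ⟨y, x, u, h2, h3, by rintro rfl; exact hne (Or.inl ⟨rfl, rfl⟩)⟩
  have nab := hAi _ _ hab
  have nac := hAi _ _ hac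
  have hba := hAs _ _ hab
  have hca := hAs _ _ hac
  have eA : ∀ x y, A x y → x ≠ a → y ≠ a → (x = b ∧ y = c) ∨ (x = c ∧ y = b) := by
    intro x y hxy h1 h2
    have h3 := iA _ _ _ _ hxy hab
    have h4 := iA _ _ _ _ hxy hac
    omega
  have eB : ∀ x y, B x y → x ≠ a → y ≠ a → (x = b ∧ y = c) ∨ (x = c ∧ y = b) := by
    intro x y hxy h1 h2
    have h3 := hc' _ _ _ _ hxy hab
    have h4 := hc' _ _ _ _ hxy hac
    omega
  have tri : ∀ C : ℕ → ℕ → Prop, (∀ x y, C x y → x ≠ y) →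
      (∀ x y, C x y → x ≠ a → y ≠ a → (x = b ∧ y = c) ∨ (x = c ∧ y = b)) →
      (∀ x y, C x y → x = b ∨ x = c ∨ y = b ∨ y = c) →
      ∀ x y, C x y → (x = a ∧ y = b) ∨ (x = b ∧ y = a) ∨ (x = a ∧ y = c) ∨ (x = c ∧ y = a) ∨
        (x = b ∧ y = c) ∨ (x = c ∧ y = b) := by
    intro C hC h1 h2 x y hxy
    have := hC _ _ hxy
    have := h1 _ _ hxy
    have := h2 _ _ hxy
    omega
  -- Some edge avoids `a`; it meets `ab` and `ac`, so it is `bc`.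
  have bc : A b c ∨ B b c := by
    rcases hv a with ⟨x, y, h, h1, h2⟩ | ⟨x, y, h, h1, h2⟩
    · rcases eA x y h h1.symm h2.symm with ⟨rfl, rfl⟩ | ⟨rfl, rfl⟩
      · exact Or.inl h
      · exact Or.inl (hAs _ _ h)
    · rcases eB x y h h1.symm h2.symm with ⟨rfl, rfl⟩ | ⟨rfl, rfl⟩
      · exact Or.inr h
      · exact Or.inr (hBs _ _ h)
  have tB : ∀ x y, B x y → (x = a ∧ y = b) ∨ (x = b ∧ y = a) ∨ (x = a ∧ y = c) ∨
      (x = c ∧ y = a) ∨ (x = b ∧ y = c) ∨ (x = c ∧ y = b) := by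
    refine tri B hBi eB fun x y hxy => ?_
    rcases bc with h | h
    · have := hc' _ _ _ _ hxy h
      tauto
    · have := iB _ _ _ _ hxy h
      tauto
  have two : (B a b ∧ B a c) ∨ (B a b ∧ B b c) ∨ (B a c ∧ B b c) := by
    obtain ⟨e, f, hef⟩ := hBne
    obtain ⟨u, v, huv, hne⟩ := hB2 e f hef
    rcases tB e f hef with ⟨rfl, rfl⟩ | ⟨rfl, rfl⟩ | ⟨rfl, rfl⟩ | ⟨rfl, rfl⟩ | ⟨rfl, rfl⟩ |
      ⟨rfl, rfl⟩ <;>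
    rcases tB u v huv with ⟨rfl, rfl⟩ | ⟨rfl, rfl⟩ | ⟨rfl, rfl⟩ | ⟨rfl, rfl⟩ | ⟨rfl, rfl⟩ |
      ⟨rfl, rfl⟩ <;>
    first
      | exact absurd (Or.inl ⟨rfl, rfl⟩) hne
      | exact absurd (Or.inr ⟨rfl, rfl⟩) hne
      | simp only [*, hBs _ _ hef, hBs _ _ huv, true_and, and_true, true_or, or_true]
  have tA : ∀ x y, A x y → (x = a ∧ y = b) ∨ (x = b ∧ y = a) ∨ (x = a ∧ y = c) ∨
      (x = c ∧ y = a) ∨ (x = b ∧ y = c) ∨ (x = c ∧ y = b) := by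
    refine tri A hAi eA fun x y hxy => ?_
    rcases bc with h | h
    · have := iA _ _ _ _ hxy h
      tauto
    · have := hc _ _ _ _ hxy h
      tauto
  -- `A` need not be the whole triangle: `Fits` only asks for containment, and equality of the
  -- families will come from maximality.
  refine ⟨_, _, IsConfig.triangle nab nac hbc, Or.inl ⟨?_, ?_, ?_⟩⟩
  · intro x y hxy
    rcases tA x y hxy with ⟨rfl, rfl⟩ | ⟨rfl, rfl⟩ | ⟨rfl, rfl⟩ | ⟨rfl, rfl⟩ | ⟨rfl, rfl⟩ |
      ⟨rfl, rfl⟩ <;> simp [pair_comm]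
  · intro x y hxy X hX
    simp only [mem_insert, mem_singleton] at hX
    rcases hX with rfl | rfl | rfl <;>
    rcases tB x y hxy with ⟨rfl, rfl⟩ | ⟨rfl, rfl⟩ | ⟨rfl, rfl⟩ | ⟨rfl, rfl⟩ | ⟨rfl, rfl⟩ |
      ⟨rfl, rfl⟩ <;> simp
  · intro v hv
    simp only [mem_insert, mem_singleton] at hv
    rcases hv with rfl | rfl | rfl
    · rcases two with ⟨h, -⟩ | ⟨h, -⟩ | ⟨h, -⟩
      · exact ⟨c, b, hbc.symm, hac, h⟩
      · exact ⟨c, b, hbc.symm, hac, h⟩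
      · exact ⟨b, c, hbc, hab, h⟩
    · by_cases h : B v c
      · exact ⟨a, c, nac, hba, h⟩
      · exact ⟨c, a, nac.symm, by tauto, hBs _ _ (by tauto)⟩
    · by_cases h : B b v
      · exact ⟨a, b, nab, hca, hBs _ _ h⟩
      · exact ⟨b, a, nab.symm, hAs _ _ (by tauto), hBs _ _ (by tauto)⟩

end Graph
-- Structure of a family whose transversals of size three form a star
/-- The transversals of size three of the maximal family `𝓕` that contain `p` and `q` are the sets
`{p, q, i}` with `i ∈ L`. -/
structure IsStarAt (n k : ℕ) (𝓕 : Finset (Finset ℕ)) (p q : ℕ) (L : Finset ℕ) : Prop where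
  max : IsMaximalNontrivial n k 3 𝓕
  hp : p ∈ Icc 1 n
  hq : q ∈ Icc 1 n
  hpq : p ≠ q
  subset : L ⊆ Icc 1 n
  hpL : p ∉ L
  hqL : q ∉ L
  mem_iff : ∀ i ∈ Icc 1 n, i ≠ p → i ≠ q → (i ∈ L ↔ IsTransversal 𝓕 {p, q, i})

namespace IsStarAt

variable {n k p q : ℕ} {𝓕 : Finset (Finset ℕ)} {L : Finset ℕ}

theorem symm (h : IsStarAt n k 𝓕 p q L) : IsStarAt n k 𝓕 q p L where
  max := h.max
  hp := h.hq
  hq := h.hp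
  hpq := h.hpq.symm
  subset := h.subset
  hpL := h.hqL
  hqL := h.hpL
  mem_iff i hi h1 h2 := by
    rw [h.mem_iff i hi h2 h1, insert_comm]

/-- Each transversal `{p, q, i}` shares two points with `F`, so if `F` misses `p` or `q` it contains
every petal `i`. -/
theorem trace (h : IsStarAt n k 𝓕 p q L) (hk : 3 ≤ k) (hn : 3 * k < n) (hL : L.Nonempty)
    {F : Finset ℕ} (hF : F ∈ 𝓕) :
    (p ∈ F ∧ q ∈ F) ∨ (p ∈ F ∧ q ∉ F ∧ L ⊆ F) ∨ (p ∉ F ∧ q ∈ F ∧ L ⊆ F) := by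
  have key : ∀ i ∈ L, (p ∈ F ∧ q ∈ F) ∨ (p ∈ F ∧ i ∈ F) ∨ (q ∈ F ∧ i ∈ F) := by
    intro i hi
    have hip : i ≠ p := fun h' => h.hpL (h' ▸ hi)
    have hiq : i ≠ q := fun h' => h.hqL (h' ▸ hi)
    have hT := (h.mem_iff i (h.subset hi) hip hiq).1 hi
    have hTn : ({p, q, i} : Finset ℕ) ⊆ Icc 1 n :=
      insert_subset h.hp (insert_subset h.hq (singleton_subset_iff.2 (h.subset hi)))
    have e := h.max.exists_ne_of_isTransversal hn hT hTn (card_le_three.trans hk) hF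
    obtain ⟨x, hx⟩ := e p
    obtain ⟨y, hy⟩ := e q
    obtain ⟨z, hz⟩ := e i
    simp only [mem_insert, mem_singleton] at hx hy hz
    grind
  by_cases h1 : p ∈ F
  · by_cases h2 : q ∈ F
    · exact Or.inl ⟨h1, h2⟩
    · exact Or.inr (Or.inl ⟨h1, h2, fun i hi => by have := key i hi; tauto⟩)
  · refine Or.inr (Or.inr ⟨h1, ?_, fun i hi => by have := key i hi; tauto⟩)
    obtain ⟨i, hi⟩ := hL
    have := key i hi
    tauto

theorem exists_left (h : IsStarAt n k 𝓕 p q L) (hk : 3 ≤ k) (hn : 3 * k < n) (hL : L.Nonempty) :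
    ∃ F ∈ 𝓕, p ∈ F ∧ q ∉ F ∧ L ⊆ F := by
  obtain ⟨F, hF, hqF⟩ := h.max.exists_notMem (by omega) q
  have := h.trace hk hn hL hF
  exact ⟨F, hF, by tauto⟩

theorem card_lt (h : IsStarAt n k 𝓕 p q L) (hk : 3 ≤ k) (hn : 3 * k < n) : L.card + 1 ≤ k := by
  rcases L.eq_empty_or_nonempty with rfl | hL
  · simp
    omega
  · obtain ⟨F, hF, h1, h2, h3⟩ := h.exists_left hk hn hL
    rw [← (mem_kSubsets.1 (h.max.uniform hF)).2, ← card_insert_of_notMem h.hpL]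
    exact card_le_card (insert_subset h1 h3)

/-- Otherwise every member missing `p` or `q` contains `v`; then `{p, q, v}` is a transversal and
`v` would be a petal. -/
theorem exists_avoiding (h : IsStarAt n k 𝓕 p q L) (hk : 3 ≤ k) (hn : 3 * k < n)
    (hL : L.Nonempty) {v : ℕ} (hv : v ∈ Icc 1 n) (hvp : v ≠ p) (hvq : v ≠ q) (hvL : v ∉ L) :
    ∃ F ∈ 𝓕, v ∉ F ∧ ((p ∈ F ∧ q ∉ F ∧ L ⊆ F) ∨ (p ∉ F ∧ q ∈ F ∧ L ⊆ F)) := by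
  by_contra! hcon
  refine hvL ((h.mem_iff v hv hvp hvq).2 fun F hF G hG => ?_)
  have aux : ∀ F ∈ 𝓕, (p ∈ F ∧ q ∈ F) ∨ (v ∈ F ∧ (p ∈ F ∨ q ∈ F)) := by
    intro F hF
    have h1 := h.trace hk hn hL hF
    by_cases hvF : v ∈ F
    · tauto
    · have := hcon F hF hvF
      tauto
  have h1 := aux F hF
  have h2 := aux G hG
  simp only [mem_insert, mem_singleton, exists_eq_or_imp, exists_eq_left]
  tauto

theorem eq_hilFam (h : IsStarAt n k 𝓕 p q L) (hk : 3 ≤ k) (hn : 3 * k < n) (hL : L.Nonempty)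
    (hC : ∀ F ∈ 𝓕, p ∈ F → q ∈ F → ∃ x ∈ L, x ∈ F) : 𝓕 = hilFam n k p q L := by
  refine h.max.eq_of_subset (fun F hF => ?_) hilFam_subset (hilFam_intersecting hL)
  rw [hilFam, mem_filter]
  refine ⟨h.max.uniform hF, ?_⟩
  have h1 := h.trace hk hn hL hF
  have h2 := hC F hF
  tauto

/-- Every member meets `F ∩ G`, and therefore contains a petal. -/
theorem eq_hilFam_of_inter_subset (h : IsStarAt n k 𝓕 p q L) (hk : 3 ≤ k) (hn : 3 * k < n)
    (hL : L.Nonempty) {F G : Finset ℕ} (hF : F ∈ 𝓕) (hG : G ∈ 𝓕)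
    (hFG : ∀ x ∈ F, x ∈ G → x ∈ L) : 𝓕 = hilFam n k p q L :=
  h.eq_hilFam hk hn hL fun H hH _ _ => by
    obtain ⟨x, h1, h2, h3⟩ := h.max.intersecting.exists_mem hF hG hH
    exact ⟨x, hFG x h1 h2, h3⟩

/-- A member missing `p` or `q` has at most one point besides `L` and its kernel point. If the
family is not `hilFam`, any two members meet outside `L`, so a member missing `q` and one missing
`p` share this extra point. It is then the same point `v` for all of them, contrary to
`exists_avoiding`. -/
theorem eq_hilFam_of_le_card (h : IsStarAt n k 𝓕 p q L) (hk : 4 ≤ k) (hn : 3 * k < n)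
    (hl : k ≤ L.card + 2) : 𝓕 = hilFam n k p q L := by
  have hL : L.Nonempty := card_pos.1 (by omega)
  have small : ∀ F ∈ 𝓕, ∀ r ∈ F, r ∉ L → L ⊆ F → ∀ x ∈ F, ∀ y ∈ F, x ∉ L → y ∉ L → x ≠ r →
      y ≠ r → x = y := by
    intro F hF r hr hrL hLF x hx y hy hxL hyL hxr hyr
    by_contra hxy
    have h1 : (insert x (insert y (insert r L))).card ≤ F.card :=
      card_le_card (insert_subset hx (insert_subset hy (insert_subset hr hLF)))
    rw [card_insert_of_notMem (by simp [hxy, hxr, hxL]), card_insert_of_notMem (by simp [hyr, hyL]),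
      card_insert_of_notMem hrL, (mem_kSubsets.1 (h.max.uniform hF)).2] at h1
    omega
  by_contra hne
  have hinter : ∀ F ∈ 𝓕, ∀ G ∈ 𝓕, ∃ x ∈ F, x ∈ G ∧ x ∉ L := by
    intro F hF G hG
    by_contra! hcon
    exact hne (h.eq_hilFam_of_inter_subset (by omega) hn hL hF hG hcon)
  obtain ⟨F, hF, f1, f2, f3⟩ := h.exists_left (by omega) hn hL
  obtain ⟨G, hG, g1, g2, g3⟩ := h.symm.exists_left (by omega) hn hL
  obtain ⟨v, hvF, hvG, hvL⟩ := hinter F hF G hG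
  have hvp : v ≠ p := by rintro rfl; contradiction
  have hvq : v ≠ q := by rintro rfl; contradiction
  obtain ⟨H, hH, hvH, ⟨h1, h2, h3⟩ | ⟨h1, h2, h3⟩⟩ := h.exists_avoiding (by omega) hn hL
    ((mem_kSubsets.1 (h.max.uniform hF)).1 hvF) hvp hvq hvL
  · obtain ⟨w, hwH, hwG, hwL⟩ := hinter H hH G hG
    have hwq : w ≠ q := by rintro rfl; contradiction
    have := small G hG q g1 h.hqL g3 v hvG w hwG hvL hwL hvq hwq
    exact hvH (this ▸ hwH)
  · obtain ⟨w, hwH, hwF, hwL⟩ := hinter H hH F hF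
    have hwp : w ≠ p := by rintro rfl; contradiction
    have := small F hF p f1 h.hpL f3 v hvF w hwF hvL hwL hvp hwp
    exact hvH (this ▸ hwH)

end IsStarAt

/-- The pairs that together with `p` and `L` form a member of the family avoiding `q`. -/
def starEdge (𝓕 : Finset (Finset ℕ)) (L : Finset ℕ) (p q u v : ℕ) : Prop :=
  u ≠ v ∧ (u ∉ L ∧ u ≠ p ∧ u ≠ q) ∧ (v ∉ L ∧ v ≠ p ∧ v ≠ q) ∧
    insert p (insert u (insert v L)) ∈ 𝓕

theorem IsConfig.subset {M : Finset ℕ} {𝒜 : Finset (Finset ℕ)} (h : IsConfig M 𝒜) :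
    ∀ X ∈ 𝒜, X ⊆ M := by
  cases h <;> simp [insert_subset_iff]

namespace IsStarAt

variable {n k p q : ℕ} {𝓕 : Finset (Finset ℕ)} {L : Finset ℕ}

theorem exists_starEdge (h : IsStarAt n k 𝓕 p q L) (hl : L.card + 3 = k) {F : Finset ℕ}
    (hF : F ∈ 𝓕) (h1 : p ∈ F) (h2 : q ∉ F) (h3 : L ⊆ F) :
    ∃ u v, starEdge 𝓕 L p q u v ∧ F = insert p (insert u (insert v L)) := by
  have hc : (F \ insert p L).card = 2 := by
    rw [card_sdiff_of_subset (insert_subset h1 h3), card_insert_of_notMem h.hpL,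
      (mem_kSubsets.1 (h.max.uniform hF)).2]
    omega
  obtain ⟨u, v, huv, he⟩ := card_eq_two.1 hc
  have hu : u ∈ F \ insert p L := by simp [he]
  have hv : v ∈ F \ insert p L := by simp [he]
  have hFe : F = insert p (insert u (insert v L)) := by
    rw [← sdiff_union_of_subset (insert_subset h1 h3), he]
    ext x
    simp only [mem_union, mem_insert, mem_singleton]
    tauto
  simp only [mem_sdiff, mem_insert, not_or] at hu hv
  refine ⟨u, v, ⟨huv, ⟨hu.2.2, hu.2.1, ?_⟩, ⟨hv.2.2, hv.2.1, ?_⟩, hFe ▸ hF⟩, hFe⟩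
  · rintro rfl; exact h2 hu.1
  · rintro rfl; exact h2 hv.1

/-- Because `x ≠ y`, the two members given by the edges meet exactly in `L` and `v`, and `Z`, which
contains no petal, meets this intersection. -/
theorem mem_of_forced (h : IsStarAt n k 𝓕 p q L) {v x y : ℕ} (hxy : x ≠ y)
    (hA : starEdge 𝓕 L p q v x) (hB : starEdge 𝓕 L q p v y) {Z : Finset ℕ} (hZ : Z ∈ 𝓕)
    (hZL : ¬ ∃ x ∈ L, x ∈ Z) : v ∈ Z := by
  obtain ⟨z, h1, h2, h3⟩ := h.max.intersecting.exists_mem hA.2.2.2 hB.2.2.2 hZ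
  have h4 : z ∉ L := fun h' => hZL ⟨z, h', h3⟩
  obtain ⟨-, ⟨-, a1, a2⟩, ⟨-, a3, a4⟩, -⟩ := hA
  obtain ⟨-, ⟨-, b1, b2⟩, ⟨-, b3, b4⟩, -⟩ := hB
  have := h.hpq
  simp only [mem_insert, h4, or_false] at h1 h2
  obtain rfl : z = v := by omega
  exact h3

/-- `Fits` gives the inclusion in `starFam`: the vertices of `M` are forced into every member that
contains `p` and `q` but no petal. Maximality turns the inclusion into equality. -/
theorem eq_starFam (h : IsStarAt n k 𝓕 p q L) (hk : 4 ≤ k) (hn : 3 * k < n)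
    (hl : L.card + 3 = k) {M : Finset ℕ} {𝒜 : Finset (Finset ℕ)} (hc : IsConfig M 𝒜)
    (hfit : Fits (starEdge 𝓕 L p q) (starEdge 𝓕 L q p) M 𝒜) :
    𝓕 = starFam n k p q L M 𝒜 := by
  have hL : L.Nonempty := card_pos.1 (by omega)
  refine h.max.eq_of_subset (fun F hF => ?_) starFam_subset (starFam_intersecting hL hc.subset)
  rw [starFam, mem_filter]
  refine ⟨h.max.uniform hF, ?_⟩
  rcases h.trace (by omega) hn hL hF with ⟨h1, h2⟩ | ⟨h1, h2, h3⟩ | ⟨h1, h2, h3⟩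
  · refine Or.inl ⟨h1, h2, ?_⟩
    by_cases hFL : ∃ x ∈ L, x ∈ F
    · exact Or.inl hFL
    · refine Or.inr fun v hv => ?_
      obtain ⟨x, y, hxy, hA, hB⟩ := hfit.2.2 v hv
      exact h.mem_of_forced hxy hA hB hF hFL
  · refine Or.inr (Or.inl ⟨h1, h2, h3, ?_⟩)
    obtain ⟨u, v, huv, rfl⟩ := h.exists_starEdge hl hF h1 h2 h3
    refine ⟨_, hfit.1 u v huv, ?_⟩
    simp [insert_subset_iff]
  · refine Or.inr (Or.inr ⟨h1, h2, h3, fun X hX => ?_⟩)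
    obtain ⟨u, v, huv, rfl⟩ := h.symm.exists_starEdge hl hF h2 h1 h3
    rcases hfit.2.1 u v huv X hX with h' | h'
    · exact ⟨u, h', by simp⟩
    · exact ⟨v, h', by simp⟩

/-- A member `Z` through `p` and `q` without petals makes the two graphs cross-intersecting: two
members given by edges can meet inside `Z` only at a common vertex. `exists_avoiding` says that no
vertex lies on all edges, so `exists_fits` applies. Finally `M ⊆ Z` bounds the size of `M`. -/
theorem eq_hilFam_or_eq_starFam (h : IsStarAt n k 𝓕 p q L) (hk : 4 ≤ k) (hn : 3 * k < n)
    (hl : L.card + 3 = k) :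
    𝓕 = hilFam n k p q L ∨ ∃ M 𝒜, IsConfig M 𝒜 ∧ M ⊆ Icc 1 n ∧ p ∉ M ∧ q ∉ M ∧ Disjoint L M ∧
      M.card + 2 ≤ k ∧ (𝓕 = starFam n k p q L M 𝒜 ∨ 𝓕 = starFam n k q p L M 𝒜) := by
  have hL : L.Nonempty := card_pos.1 (by omega)
  by_cases hC : ∀ F ∈ 𝓕, p ∈ F → q ∈ F → ∃ x ∈ L, x ∈ F
  · exact Or.inl (h.eq_hilFam (by omega) hn hL hC)
  right
  push Not at hC
  obtain ⟨Z, hZ, hpZ, hqZ, hLZ⟩ := hC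
  have hZL : ¬ ∃ x ∈ L, x ∈ Z := by
    rintro ⟨x, hx, hx'⟩
    exact hLZ x hx hx'
  have symmE : ∀ p q x y, starEdge 𝓕 L p q x y → starEdge 𝓕 L p q y x := by
    rintro p q x y ⟨h1, h2, h3, h4⟩
    exact ⟨h1.symm, h3, h2, by rwa [insert_comm y]⟩
  obtain ⟨F, hF, f1, f2, f3⟩ := h.exists_left (by omega) hn hL
  obtain ⟨G, hG, g1, g2, g3⟩ := h.symm.exists_left (by omega) hn hL
  obtain ⟨a, b, hab, -⟩ := h.exists_starEdge hl hF f1 f2 f3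
  obtain ⟨c, d, hcd, -⟩ := h.symm.exists_starEdge hl hG g1 g2 g3
  have hmem : ∀ p q x y, starEdge 𝓕 L p q x y → x ∈ Icc 1 n := fun p q x y hxy =>
    (mem_kSubsets.1 (h.max.uniform hxy.2.2.2)).1 (by simp)
  obtain ⟨M, 𝒜, hconf, hfit⟩ := exists_fits (A := starEdge 𝓕 L p q) (B := starEdge 𝓕 L q p)
    (symmE p q) (symmE q p) (fun x y hxy => hxy.1) (fun x y hxy => hxy.1) ⟨a, b, hab⟩ ⟨c, d, hcd⟩
    (by
      intro x y u v hA hB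
      obtain ⟨z, h1, h2, h3⟩ := h.max.intersecting.exists_mem hA.2.2.2 hB.2.2.2 hZ
      have h4 : z ∉ L := fun h' => hZL ⟨z, h', h3⟩
      obtain ⟨-, ⟨-, a1, a2⟩, ⟨-, a3, a4⟩, -⟩ := hA
      obtain ⟨-, ⟨-, b1, b2⟩, ⟨-, b3, b4⟩, -⟩ := hB
      have := h.hpq
      simp only [mem_insert, h4, or_false] at h1 h2
      omega)
    (by
      intro v
      by_cases hv : v ∈ Icc 1 n ∧ v ≠ p ∧ v ≠ q ∧ v ∉ L
      · obtain ⟨H, hH, hvH, ⟨h1, h2, h3⟩ | ⟨h1, h2, h3⟩⟩ :=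
          h.exists_avoiding (by omega) hn hL hv.1 hv.2.1 hv.2.2.1 hv.2.2.2
        · obtain ⟨x, y, hxy, rfl⟩ := h.exists_starEdge hl hH h1 h2 h3
          simp only [mem_insert, not_or] at hvH
          exact Or.inl ⟨x, y, hxy, hvH.2.1, hvH.2.2.1⟩
        · obtain ⟨x, y, hxy, rfl⟩ := h.symm.exists_starEdge hl hH h2 h1 h3
          simp only [mem_insert, not_or] at hvH
          exact Or.inr ⟨x, y, hxy, hvH.2.1, hvH.2.2.1⟩
      -- A point of the kernel, of `L` or outside `[n]` is not a vertex of the graphs, so any edge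
      -- avoids it.
      · refine Or.inl ⟨a, b, hab, ?_, ?_⟩
        · rintro rfl
          exact hv ⟨hmem _ _ _ _ hab, hab.2.1.2.1, hab.2.1.2.2, hab.2.1.1⟩
        · rintro rfl
          exact hv ⟨hmem _ _ _ _ (symmE _ _ _ _ hab), hab.2.2.1.2.1, hab.2.2.1.2.2, hab.2.2.1.1⟩)
  have hM : ∀ v ∈ M, v ∈ Z ∧ v ∈ Icc 1 n ∧ v ∉ L ∧ v ≠ p ∧ v ≠ q := by
    intro v hv
    rcases hfit with hfit | hfit
    · obtain ⟨x, y, hxy, hA, hB⟩ := hfit.2.2 v hv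
      exact ⟨h.mem_of_forced hxy hA hB hZ hZL, hmem _ _ _ _ hA, hA.2.1⟩
    · obtain ⟨x, y, hxy, hA, hB⟩ := hfit.2.2 v hv
      exact ⟨h.symm.mem_of_forced hxy hA hB hZ hZL, hmem _ _ _ _ hA, hB.2.1⟩
  have hpM : p ∉ M := fun h' => (hM p h').2.2.2.1 rfl
  have hqM : q ∉ M := fun h' => (hM q h').2.2.2.2 rfl
  refine ⟨M, 𝒜, hconf, fun v hv => (hM v hv).2.1, hpM, hqM,
    disjoint_right.2 fun v hv => (hM v hv).2.2.1, ?_, ?_⟩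
  · have h1 : (insert p (insert q M)).card ≤ Z.card :=
      card_le_card (insert_subset hpZ (insert_subset hqZ fun v hv => (hM v hv).1))
    rw [card_insert_of_notMem (by simp [h.hpq, hpM]), card_insert_of_notMem hqM,
      (mem_kSubsets.1 (h.max.uniform hZ)).2] at h1
    omega
  · rcases hfit with hfit | hfit
    · exact Or.inl (h.eq_starFam hk hn hl hconf hfit)
    · exact Or.inr (h.symm.eq_starFam hk hn hl hconf hfit)

theorem card_le (h : IsStarAt n k 𝓕 p q L) (hk : 4 ≤ k) (hn : 3 * k < n)
    (hT : ∀ T ⊆ Icc 1 n, T.card = 3 → IsTransversal 𝓕 T → p ∈ T ∧ q ∈ T) :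
    𝓕.card ≤ pairCount n k L.card + k ^ 4 * (n - 4).choose (k - 4) := by
  refine h.max.card_le_of_star (by omega) hk h.hp h.hq h.hpq h.subset h.hpL h.hqL
    fun T hTn hTc hTt => ?_
  obtain ⟨hp, hq⟩ := hT T hTn hTc hTt
  refine ⟨hp, hq, ?_⟩
  have : ((T.erase p).erase q).card = 1 := by
    rw [card_erase_of_mem (by simp [hq, h.hpq.symm]), card_erase_of_mem hp, hTc]
  obtain ⟨a, ha⟩ := card_eq_one.1 this
  have ha' : a ∈ (T.erase p).erase q := by simp [ha]
  simp only [mem_erase] at ha'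
  refine ⟨a, (h.mem_iff a (hTn ha'.2.2) ha'.2.1 ha'.1).2 ?_, ha'.2.2⟩
  rwa [← ha, insert_erase (mem_erase.2 ⟨h.hpq.symm, hq⟩), insert_erase hp]

end IsStarAt

/-- A maximal family is determined by a `4`-set, or its transversals of size three form a star. -/
theorem IsMaximalNontrivial.four_set_or_isStarAt {n k : ℕ} {𝓕 : Finset (Finset ℕ)}
    (h : IsMaximalNontrivial n k 3 𝓕) (hk : 4 ≤ k) (hn : 3 * k < n) :
    (∃ Q ⊆ Icc 1 n, Q.card = 4 ∧ ∀ F ∈ 𝓕, 3 ≤ (F ∩ Q).card) ∨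
    ∃ p q L, IsStarAt n k 𝓕 p q L ∧
      𝓕.card ≤ pairCount n k L.card + k ^ 4 * (n - 4).choose (k - 4) := by
  classical
  rcases h.four_set_or_star (by omega) hn with h1 | ⟨p, hp, q, hq, hpq, hT⟩
  · exact Or.inl h1
  right
  have hs : IsStarAt n k 𝓕 p q
      {i ∈ Icc 1 n | (i ≠ p ∧ i ≠ q) ∧ IsTransversal 𝓕 {p, q, i}} := by
    refine ⟨h, hp, hq, hpq, filter_subset _ _, by simp, by simp, fun i hi h1 h2 => ?_⟩
    simp only [mem_filter, hi, h1, h2, ne_eq, not_false_eq_true, and_self, true_and]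
  exact ⟨p, q, _, hs, hs.card_le hk hn hT⟩

/-! ### Maximality and size of the Hilton–Milner type families -/

/-- This is `IsStarAt.trace` without maximality: extensions of `{p, q, i}` are members by `hP`
instead. It serves for an explicit family enlarged by one set `A`, in proofs that the family is
maximal. -/
theorem trace_of_pairs_mem {n k p q : ℕ} {L : Finset ℕ} {𝓖 : Finset (Finset ℕ)}
    (hu : 𝓖 ⊆ kSubsets n k) (hi : IsDWiseIntersecting 3 𝓖) (hnt : ¬ IsTrivialFamily n 𝓖)
    (hk : 3 ≤ k) (hn : 3 * k < n) (hp : p ∈ Icc 1 n) (hq : q ∈ Icc 1 n) (hL : L ⊆ Icc 1 n)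
    (hne : L.Nonempty)
    (hP : ∀ F ∈ kSubsets n k, p ∈ F → q ∈ F → (∃ x ∈ L, x ∈ F) → F ∈ 𝓖)
    {F : Finset ℕ} (hF : F ∈ 𝓖) :
    (p ∈ F ∧ q ∈ F) ∨ (p ∈ F ∧ q ∉ F ∧ L ⊆ F) ∨ (p ∉ F ∧ q ∈ F ∧ L ⊆ F) := by
  have key : ∀ i ∈ L, (p ∈ F ∧ q ∈ F) ∨ (p ∈ F ∧ i ∈ F) ∨ (q ∈ F ∧ i ∈ F) := by
    intro i hi'
    have hTn : ({p, q, i} : Finset ℕ) ⊆ Icc 1 n :=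
      insert_subset hp (insert_subset hq (singleton_subset_iff.2 (hL hi')))
    have hc : ({p, q, i} : Finset ℕ).card ≤ 3 := card_le_three
    have hFc := (mem_kSubsets.1 (hu hF)).2
    obtain ⟨A, hA, hTA, hAF⟩ := exists_kSubset_extending hTn (hc.trans hk) F (by omega)
    have hA' : A ∈ 𝓖 := hP A hA (hTA (by simp)) (hTA (by simp)) ⟨i, hi', hTA (by simp)⟩
    have e := exists_ne_mem_inter hu hi hnt hA' hF
    obtain ⟨x, hx1, hx2, hx3⟩ := e p
    obtain ⟨y, hy1, hy2, hy3⟩ := e q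
    obtain ⟨z, hz1, hz2, hz3⟩ := e i
    have h1 := hAF x hx1 hx2
    have h2 := hAF y hy1 hy2
    have h3 := hAF z hz1 hz2
    simp only [mem_insert, mem_singleton] at h1 h2 h3
    grind
  by_cases h1 : p ∈ F
  · by_cases h2 : q ∈ F
    · exact Or.inl ⟨h1, h2⟩
    · exact Or.inr (Or.inl ⟨h1, h2, fun i hi => by have := key i hi; tauto⟩)
  · refine Or.inr (Or.inr ⟨h1, ?_, fun i hi => by have := key i hi; tauto⟩)
    obtain ⟨i, hi⟩ := hne
    have := key i hi
    tauto

/-- A common point `x` other than `p` and `q` is avoided by an extension of `{p, q, y}` with a petal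
`y ≠ x`; this needs two petals. -/
theorem not_isTrivialFamily_of_pairs_mem {n k p q : ℕ} {L : Finset ℕ} {𝓖 : Finset (Finset ℕ)}
    (hk : 3 ≤ k) (hn : 3 * k < n) (hp : p ∈ Icc 1 n) (hq : q ∈ Icc 1 n) (hL : L ⊆ Icc 1 n)
    (hl : 2 ≤ L.card)
    (hP : ∀ F ∈ kSubsets n k, p ∈ F → q ∈ F → (∃ x ∈ L, x ∈ F) → F ∈ 𝓖)
    (h1 : ∃ F ∈ 𝓖, p ∉ F) (h2 : ∃ F ∈ 𝓖, q ∉ F) : ¬ IsTrivialFamily n 𝓖 := by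
  rintro ⟨x, hx, hall⟩
  have hxp : x ≠ p := by
    rintro rfl
    obtain ⟨F, hF, h⟩ := h1
    exact h (hall F hF)
  have hxq : x ≠ q := by
    rintro rfl
    obtain ⟨F, hF, h⟩ := h2
    exact h (hall F hF)
  obtain ⟨y, hy, hyx⟩ := exists_mem_ne (by omega : 1 < L.card) x
  have hTn : ({p, q, y} : Finset ℕ) ⊆ Icc 1 n :=
    insert_subset hp (insert_subset hq (singleton_subset_iff.2 (hL hy)))
  have hc : ({p, q, y} : Finset ℕ).card ≤ 3 := card_le_three
  obtain ⟨A, hA, hTA, hAF⟩ := exists_kSubset_extending hTn (hc.trans hk) {x}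
    (by rw [card_singleton]; omega)
  have := hAF x (hall A (hP A hA (hTA (by simp)) (hTA (by simp)) ⟨y, hy, hTA (by simp)⟩))
    (by simp)
  simp only [mem_insert, mem_singleton] at this
  omega

/-- `F₁` misses `q`, `F₂` misses `p`, and they meet exactly in `L`; so an added set through `p` and
`q` contains a petal. `trace_of_pairs_mem` settles the other added sets. -/
theorem hilFam_isMaximalNontrivial {n k p q : ℕ} {L : Finset ℕ} (hk : 3 ≤ k) (hn : 3 * k < n)
    (hp : p ∈ Icc 1 n) (hq : q ∈ Icc 1 n) (hpq : p ≠ q) (hL : L ⊆ Icc 1 n) (hpL : p ∉ L)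
    (hqL : q ∉ L) (hl : 2 ≤ L.card) (hlk : L.card + 1 ≤ k) :
    IsMaximalNontrivial n k 3 (hilFam n k p q L) := by
  have hne : L.Nonempty := card_pos.1 (by omega)
  obtain ⟨F₁, hF₁, hD₁, hS₁⟩ := exists_kSubset_extending (k := k) (insert_subset hp hL)
    (by rw [card_insert_of_notMem hpL]; exact hlk) {q}
    (by rw [card_insert_of_notMem hpL, card_singleton]; omega)
  obtain ⟨F₂, hF₂, hD₂, hS₂⟩ := exists_kSubset_extending (k := k) (insert_subset hq hL)
    (by rw [card_insert_of_notMem hqL]; exact hlk) F₁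
    (by rw [card_insert_of_notMem hqL, (mem_kSubsets.1 hF₁).2]; omega)
  rw [insert_subset_iff] at hD₁ hD₂
  have hqF₁ : q ∉ F₁ := fun h => by
    have := hS₁ q h (by simp)
    simp [hpq.symm, hqL] at this
  have hpF₂ : p ∉ F₂ := fun h => by
    have := hS₂ p h hD₁.1
    simp [hpq, hpL] at this
  have m₁ : F₁ ∈ hilFam n k p q L := by
    rw [hilFam, mem_filter]
    exact ⟨hF₁, Or.inr (Or.inl ⟨hD₁.1, hqF₁, hD₁.2⟩)⟩
  have m₂ : F₂ ∈ hilFam n k p q L := by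
    rw [hilFam, mem_filter]
    exact ⟨hF₂, Or.inr (Or.inr ⟨hpF₂, hD₂.1, hD₂.2⟩)⟩
  have hP : ∀ F ∈ kSubsets n k, p ∈ F → q ∈ F → (∃ x ∈ L, x ∈ F) → F ∈ hilFam n k p q L :=
    fun F hF h1 h2 h3 => by
      rw [hilFam, mem_filter]
      exact ⟨hF, Or.inl ⟨h1, h2, h3⟩⟩
  refine ⟨hilFam_subset, hilFam_intersecting hne, ?_, ?_⟩
  · exact not_isTrivialFamily_of_pairs_mem hk hn hp hq hL hl hP ⟨F₂, m₂, hpF₂⟩ ⟨F₁, m₁, hqF₁⟩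
  · intro A hA hi
    rw [mem_sdiff] at hA
    refine hA.2 ?_
    have hP' : ∀ F ∈ kSubsets n k, p ∈ F → q ∈ F → (∃ x ∈ L, x ∈ F) →
        F ∈ insert A (hilFam n k p q L) := fun F hF h1 h2 h3 => mem_insert_of_mem (hP F hF h1 h2 h3)
    have hnt := not_isTrivialFamily_of_pairs_mem hk hn hp hq hL hl hP'
      ⟨F₂, mem_insert_of_mem m₂, hpF₂⟩ ⟨F₁, mem_insert_of_mem m₁, hqF₁⟩
    have htr := trace_of_pairs_mem (insert_subset hA.1 hilFam_subset) hi hnt hk hn hp hq hL hne hP'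
      (mem_insert_self _ _)
    rw [hilFam, mem_filter]
    refine ⟨hA.1, ?_⟩
    rcases htr with ⟨h1, h2⟩ | h | h
    · obtain ⟨x, hx, hx1, hx2⟩ := hi.exists_mem (mem_insert_self _ _) (mem_insert_of_mem m₁)
        (mem_insert_of_mem m₂)
      have := hS₂ x hx2 hx1
      rw [mem_insert] at this
      rcases this with rfl | h3
      · exact absurd hx1 hqF₁
      · exact Or.inl ⟨h1, h2, x, h3, hx⟩
    · exact Or.inr (Or.inl h)
    · exact Or.inr (Or.inr h)

theorem card_hilFam {n k p q : ℕ} {L : Finset ℕ} (hk : 3 ≤ k) (hp : p ∈ Icc 1 n)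
    (hq : q ∈ Icc 1 n) (hpq : p ≠ q) (hL : L ⊆ Icc 1 n) (hpL : p ∉ L) (hqL : q ∉ L)
    (hlk : L.card + 1 ≤ k) :
    (hilFam n k p q L).card =
      pairCount n k L.card + 2 * (n - 2 - L.card).choose (k - 1 - L.card) := by
  have aux : ∀ r s, r ∈ Icc 1 n → s ∈ Icc 1 n → r ≠ s → r ∉ L → s ∉ L →
      #{F ∈ kSubsets n k | r ∈ F ∧ s ∉ F ∧ L ⊆ F} =
        (n - 2 - L.card).choose (k - 1 - L.card) := by
    intro r s hr hs hrs hrL hsL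
    have := card_filter_subset_disjoint (k := k) (insert_subset hr hL)
      (singleton_subset_iff.2 hs) (by simp [hrs.symm, hsL])
      (by rw [card_insert_of_notMem hrL]; exact hlk)
    rw [card_insert_of_notMem hrL, card_singleton] at this
    rw [show n - 2 - L.card = n - (L.card + 1) - 1 by omega,
      show k - 1 - L.card = k - (L.card + 1) by omega, ← this]
    congr 1
    ext F
    simp only [mem_filter, insert_subset_iff, disjoint_singleton_right]
    tauto
  have e3 : {F ∈ kSubsets n k | p ∉ F ∧ q ∈ F ∧ L ⊆ F} =
      {F ∈ kSubsets n k | q ∈ F ∧ p ∉ F ∧ L ⊆ F} := by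
    ext F
    simp only [mem_filter]
    tauto
  rw [hilFam, filter_or, filter_or, card_union_of_disjoint, card_union_of_disjoint,
    card_filter_pair (by omega) hp hq hpq hL hpL hqL, aux p q hp hq hpq hpL hqL, e3,
    aux q p hq hp hpq.symm hqL hpL, two_mul]
  · rw [disjoint_filter]
    tauto
  · rw [disjoint_union_right, disjoint_filter, disjoint_filter]
    constructor <;> tauto

/-- A member misses at most one of the four points. Any two of them may serve as kernel, the other
two being the petals. -/
theorem IsMaximalNontrivial.eq_hilFam_of_four_set {n k : ℕ} {𝓕 : Finset (Finset ℕ)}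
    (h : IsMaximalNontrivial n k 3 𝓕) {Q : Finset ℕ} (hQn : Q ⊆ Icc 1 n) (hQ : Q.card = 4)
    (hQF : ∀ F ∈ 𝓕, 3 ≤ (F ∩ Q).card) :
    ∃ p ∈ Icc 1 n, ∃ q ∈ Icc 1 n, ∃ L ⊆ Icc 1 n, p ≠ q ∧ p ∉ L ∧ q ∉ L ∧ L.card = 2 ∧
      𝓕 = hilFam n k p q L := by
  obtain ⟨p, Q', hp, rfl, hQ'⟩ := card_eq_succ.1 hQ
  obtain ⟨q, a, b, hqa, hqb, hab, rfl⟩ := card_eq_three.1 hQ'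
  simp only [mem_insert, mem_singleton, not_or] at hp
  simp only [insert_subset_iff, singleton_subset_iff] at hQn
  refine ⟨p, hQn.1, q, hQn.2.1, {a, b}, insert_subset hQn.2.2.1 (singleton_subset_iff.2 hQn.2.2.2),
    hp.1, by simp [hp], by simp [hqa, hqb], card_pair hab, ?_⟩
  refine h.eq_of_subset (fun F hF => ?_) hilFam_subset (hilFam_intersecting (by simp))
  rw [hilFam, mem_filter]
  refine ⟨h.uniform hF, ?_⟩
  have two : ∀ x y, x ∈ ({p, q, a, b} : Finset ℕ) → y ∈ ({p, q, a, b} : Finset ℕ) → x ≠ y →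
      x ∈ F ∨ y ∈ F := by
    intro x y hx hy hxy
    by_contra! hcon
    have : (F ∩ {p, q, a, b}).card ≤ ((({p, q, a, b} : Finset ℕ).erase x).erase y).card := by
      apply card_le_card
      intro z hz
      rw [mem_inter] at hz
      simp only [mem_erase]
      exact ⟨fun h' => hcon.2 (h' ▸ hz.1), fun h' => hcon.1 (h' ▸ hz.1), hz.2⟩
    rw [card_erase_of_mem (mem_erase.2 ⟨hxy.symm, hy⟩), card_erase_of_mem hx, hQ] at this
    have := hQF F hF
    omega
  have h1 := two p q (by simp) (by simp) hp.1
  have h2 := two p a (by simp) (by simp) hp.2.1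
  have h3 := two p b (by simp) (by simp) hp.2.2
  have h4 := two q a (by simp) (by simp) hqa
  have h5 := two q b (by simp) (by simp) hqb
  have h6 := two a b (by simp) (by simp) hab
  simp only [mem_insert, mem_singleton, exists_eq_or_imp, exists_eq_left, insert_subset_iff,
    singleton_subset_iff]
  by_cases hpF : p ∈ F
  · by_cases hqF : q ∈ F
    · exact Or.inl ⟨hpF, hqF, h6⟩
    · exact Or.inr (Or.inl ⟨hpF, hqF, h4.resolve_left hqF, h5.resolve_left hqF⟩)
  · exact Or.inr (Or.inr ⟨hpF, h1.resolve_left hpF, h2.resolve_left hpF, h3.resolve_left hpF⟩)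

/-! ### Families with `k - 3` petals attached to a graph, in standard position -/

/-- The `k`-set consisting of `r`, the interval `[3, k - 1]` and the pair `{u, v}`. -/
def edgeSet (k r u v : ℕ) : Finset ℕ := insert r (insert u (insert v (Icc 3 (k - 1))))

theorem mem_edgeSet {k r u v x : ℕ} :
    x ∈ edgeSet k r u v ↔ x = r ∨ x = u ∨ x = v ∨ (3 ≤ x ∧ x ≤ k - 1) := by
  simp [edgeSet]

theorem edgeSet_comm (k r u v : ℕ) : edgeSet k r u v = edgeSet k r v u := by
  rw [edgeSet, edgeSet, insert_comm u]

theorem card_edgeSet {k r u v : ℕ} (hk : 3 ≤ k) (hr : r = 1 ∨ r = 2) (hu : k ≤ u) (hv : k ≤ v)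
    (huv : u ≠ v) : (edgeSet k r u v).card = k := by
  rw [edgeSet, card_insert_of_notMem, card_insert_of_notMem, card_insert_of_notMem, Nat.card_Icc]
  · omega
  all_goals simp only [mem_insert, mem_Icc]; omega

theorem edgeSet_mem_kSubsets {n k r u v : ℕ} (hk : 3 ≤ k) (hr : r = 1 ∨ r = 2)
    (hu : k ≤ u) (hv : k ≤ v) (huv : u ≠ v) (hun : u ≤ n) (hvn : v ≤ n) :
    edgeSet k r u v ∈ kSubsets n k := by
  refine mem_kSubsets.2 ⟨fun x hx => ?_, card_edgeSet hk hr hu hv huv⟩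
  rw [mem_edgeSet] at hx
  rw [mem_Icc]
  omega

theorem eq_edgeSet {n k r u v : ℕ} (hk : 3 ≤ k) (hr : r = 1 ∨ r = 2) (hu : k ≤ u) (hv : k ≤ v)
    (huv : u ≠ v) {F : Finset ℕ} (hF : F ∈ kSubsets n k) (hrF : r ∈ F) (huF : u ∈ F) (hvF : v ∈ F)
    (hL : Icc 3 (k - 1) ⊆ F) : F = edgeSet k r u v := by
  refine (eq_of_subset_of_card_le ?_ ?_).symm
  · exact insert_subset hrF (insert_subset huF (insert_subset hvF hL))
  · rw [card_edgeSet hk hr hu hv huv, (mem_kSubsets.1 hF).2]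

theorem exists_eq_edgeSet {n k r s : ℕ} (hk : 3 ≤ k) (hrs : (r = 1 ∧ s = 2) ∨ (r = 2 ∧ s = 1))
    {F : Finset ℕ} (hF : F ∈ kSubsets n k) (hrF : r ∈ F) (hsF : s ∉ F)
    (hL : Icc 3 (k - 1) ⊆ F) : ∃ u ∈ Icc k n, ∃ v ∈ Icc k n, u ≠ v ∧ F = edgeSet k r u v := by
  have hrL : r ∉ Icc 3 (k - 1) := by rw [mem_Icc]; omega
  obtain ⟨hFn, hFk⟩ := mem_kSubsets.1 hF
  have hc : (F \ insert r (Icc 3 (k - 1))).card = 2 := by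
    rw [card_sdiff_of_subset (insert_subset hrF hL), card_insert_of_notMem hrL, hFk, Nat.card_Icc]
    omega
  obtain ⟨u, v, huv, he⟩ := card_eq_two.1 hc
  have hu : u ∈ F \ insert r (Icc 3 (k - 1)) := by simp [he]
  have hv : v ∈ F \ insert r (Icc 3 (k - 1)) := by simp [he]
  have big : ∀ x ∈ F \ insert r (Icc 3 (k - 1)), x ∈ F ∧ x ∈ Icc k n := by
    intro x hx
    simp only [mem_sdiff, mem_insert, mem_Icc, not_or] at hx
    have hxs : x ≠ s := by rintro rfl; exact hsF hx.1
    have := mem_Icc.1 (hFn hx.1)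
    refine ⟨hx.1, ?_⟩
    rw [mem_Icc]
    omega
  refine ⟨u, (big u hu).2, v, (big v hv).2, huv, ?_⟩
  exact eq_edgeSet hk (by omega) (mem_Icc.1 (big u hu).2).1 (mem_Icc.1 (big v hv).2).1 huv hF hrF
    (big u hu).1 (big v hv).1 hL

/-- The standard representatives of the families `starFam` with `k - 3` petals. -/
def stdFam (n k : ℕ) (M : Finset ℕ) (𝒜 : Finset (Finset ℕ)) : Finset (Finset ℕ) :=
  starFam n k 1 2 (Icc 3 (k - 1)) M 𝒜

theorem edgeSet_one_mem_stdFam {n k v x : ℕ} {M : Finset ℕ} {𝒜 : Finset (Finset ℕ)} (hk : 3 ≤ k)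
    (hv : v ∈ Icc k n) (hx : x ∈ Icc k n) (hvx : v ≠ x) (hX : {v, x} ∈ 𝒜) :
    edgeSet k 1 v x ∈ stdFam n k M 𝒜 := by
  rw [mem_Icc] at hv hx
  rw [stdFam, starFam, mem_filter]
  refine ⟨edgeSet_mem_kSubsets hk (Or.inl rfl) hv.1 hx.1 hvx hv.2 hx.2,
    Or.inr (Or.inl ⟨?_, ?_, ?_, _, hX, ?_⟩)⟩
  · rw [mem_edgeSet]; omega
  · rw [mem_edgeSet]; omega
  · intro t ht
    rw [mem_Icc] at ht
    rw [mem_edgeSet]; omega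
  · simp [insert_subset_iff, mem_edgeSet]

theorem edgeSet_two_mem_stdFam {n k y z : ℕ} {M : Finset ℕ} {𝒜 : Finset (Finset ℕ)} (hk : 3 ≤ k)
    (hy : y ∈ Icc k n) (hz : z ∈ Icc k n) (hyz : y ≠ z) (hX : ∀ X ∈ 𝒜, y ∈ X ∨ z ∈ X) :
    edgeSet k 2 y z ∈ stdFam n k M 𝒜 := by
  rw [mem_Icc] at hy hz
  rw [stdFam, starFam, mem_filter]
  refine ⟨edgeSet_mem_kSubsets hk (Or.inr rfl) hy.1 hz.1 hyz hy.2 hz.2,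
    Or.inr (Or.inr ⟨?_, ?_, ?_, fun X hX' => ?_⟩)⟩
  · rw [mem_edgeSet]; omega
  · rw [mem_edgeSet]; omega
  · intro t ht
    rw [mem_Icc] at ht
    rw [mem_edgeSet]; omega
  · rcases hX X hX' with h | h
    · exact ⟨y, h, by simp [mem_edgeSet]⟩
    · exact ⟨z, h, by simp [mem_edgeSet]⟩

/-- `c1` supplies two members whose only common point outside the petals is `v`, so an added set
through `1` and `2` without petals contains `M`. `c2` says that a pair `{u, w}` outside `𝒜` is
disjoint within `M` from some cover `{y, z}` of `𝒜`; then the added set for `{u, w}`, the member for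
`{y, z}` and the set `Z` have no common point. -/
theorem stdFam_isMaximalNontrivial {n k : ℕ} {M : Finset ℕ} {𝒜 : Finset (Finset ℕ)} (hk : 5 ≤ k)
    (hn : 3 * k < n) (hM : M ⊆ Icc k n) (hMk : M.card + 2 ≤ k) (hMne : M.Nonempty)
    (h𝒜 : ∀ X ∈ 𝒜, ∃ v ∈ M, ∃ x ∈ M, v ≠ x ∧ X = {v, x})
    (c1 : ∀ v ∈ M, ∃ x ∈ Icc k n, ∃ y ∈ Icc k n, x ≠ y ∧ v ≠ x ∧ v ≠ y ∧ {v, x} ∈ 𝒜 ∧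
      ∀ X ∈ 𝒜, v ∈ X ∨ y ∈ X)
    (c2 : ∀ u ∈ Icc k n, ∀ w ∈ Icc k n, u ≠ w → {u, w} ∉ 𝒜 → ∃ y ∈ Icc k n, ∃ z ∈ Icc k n,
      y ≠ z ∧ (∀ X ∈ 𝒜, y ∈ X ∨ z ∈ X) ∧ ∀ x ∈ M, (x = u ∨ x = w) → x ≠ y ∧ x ≠ z) :
    IsMaximalNontrivial n k 3 (stdFam n k M 𝒜) := by
  have hL : (Icc 3 (k - 1)).Nonempty := nonempty_Icc.2 (by omega)
  have hLn : Icc 3 (k - 1) ⊆ Icc 1 n := Icc_subset_Icc (by omega) (by omega)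
  have h1n : 1 ∈ Icc 1 n := by rw [mem_Icc]; omega
  have h2n : 2 ∈ Icc 1 n := by rw [mem_Icc]; omega
  have hi : IsDWiseIntersecting 3 (stdFam n k M 𝒜) := starFam_intersecting hL fun X hX => by
    obtain ⟨v, hv, x, hx, -, rfl⟩ := h𝒜 X hX
    exact insert_subset hv (singleton_subset_iff.2 hx)
  have mA : ∀ v ∈ Icc k n, ∀ x ∈ Icc k n, v ≠ x → {v, x} ∈ 𝒜 →
      edgeSet k 1 v x ∈ stdFam n k M 𝒜 := fun v hv x hx hvx hX =>
    edgeSet_one_mem_stdFam (by omega) hv hx hvx hX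
  have mB : ∀ y ∈ Icc k n, ∀ z ∈ Icc k n, y ≠ z → (∀ X ∈ 𝒜, y ∈ X ∨ z ∈ X) →
      edgeSet k 2 y z ∈ stdFam n k M 𝒜 := fun y hy z hz hyz hX =>
    edgeSet_two_mem_stdFam (by omega) hy hz hyz hX
  have hP : ∀ F ∈ kSubsets n k, 1 ∈ F → 2 ∈ F → (∃ x ∈ Icc 3 (k - 1), x ∈ F) →
      F ∈ stdFam n k M 𝒜 := fun F hF h1 h2 h3 => by
    rw [stdFam, starFam, mem_filter]
    exact ⟨hF, Or.inl ⟨h1, h2, Or.inl h3⟩⟩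
  have hlc : 2 ≤ (Icc 3 (k - 1)).card := by rw [Nat.card_Icc]; omega
  obtain ⟨v₀, hv₀⟩ := hMne
  obtain ⟨x₀, hx₀, y₀, hy₀, hxy₀, hvx₀, hvy₀, hX₀, hY₀⟩ := c1 v₀ hv₀
  have m₁ := mA v₀ (hM hv₀) x₀ hx₀ hvx₀ hX₀
  have m₂ := mB v₀ (hM hv₀) y₀ hy₀ hvy₀ hY₀
  have bV := mem_Icc.1 (hM hv₀)
  have bx := mem_Icc.1 hx₀
  have bY := mem_Icc.1 hy₀
  have n₁ : 2 ∉ edgeSet k 1 v₀ x₀ := by rw [mem_edgeSet]; omega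
  have n₂ : 1 ∉ edgeSet k 2 v₀ y₀ := by rw [mem_edgeSet]; omega
  refine ⟨starFam_subset, hi, not_isTrivialFamily_of_pairs_mem (by omega) hn h1n h2n hLn hlc hP
    ⟨_, m₂, n₂⟩ ⟨_, m₁, n₁⟩, ?_⟩
  intro A hA hi'
  rw [mem_sdiff] at hA
  refine hA.2 ?_
  have hP' : ∀ F ∈ kSubsets n k, 1 ∈ F → 2 ∈ F → (∃ x ∈ Icc 3 (k - 1), x ∈ F) →
      F ∈ insert A (stdFam n k M 𝒜) := fun F hF h1 h2 h3 => mem_insert_of_mem (hP F hF h1 h2 h3)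
  have hnt := not_isTrivialFamily_of_pairs_mem (by omega) hn h1n h2n hLn hlc hP'
    ⟨_, mem_insert_of_mem m₂, n₂⟩ ⟨_, mem_insert_of_mem m₁, n₁⟩
  have htr := trace_of_pairs_mem (insert_subset hA.1 starFam_subset) hi' hnt (by omega) hn h1n h2n
    hLn hL hP' (mem_insert_self _ _)
  -- `Z` meets the added set only in `1`, `2` and `M`, so the points that fill it up to size `k` are
  -- irrelevant.
  obtain ⟨Z, hZ, hDZ, hZA⟩ : ∃ Z ∈ stdFam n k M 𝒜, M ⊆ Z ∧
      ∀ x ∈ Z, x ∈ A → x = 1 ∨ x = 2 ∨ x ∈ M := by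
    have hD : insert 1 (insert 2 M) ⊆ Icc 1 n :=
      insert_subset h1n (insert_subset h2n (hM.trans (Icc_subset_Icc (by omega) le_rfl)))
    have hDc : (insert 1 (insert 2 M)).card ≤ M.card + 2 :=
      (card_insert_le _ _).trans (Nat.succ_le_succ (card_insert_le _ _))
    obtain ⟨Z, hZ, hDZ, hZA⟩ := exists_kSubset_extending (k := k) hD (by omega) A
      (by have := (mem_kSubsets.1 hA.1).2; omega)
    simp only [insert_subset_iff] at hDZ
    refine ⟨Z, ?_, hDZ.2.2, fun x hx hxA => by simpa using hZA x hx hxA⟩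
    rw [stdFam, starFam, mem_filter]
    exact ⟨hZ, Or.inl ⟨hDZ.1, hDZ.2.1, Or.inr hDZ.2.2⟩⟩
  have three : ∀ F ∈ stdFam n k M 𝒜, ∀ G ∈ stdFam n k M 𝒜, ∃ x ∈ A, x ∈ F ∧ x ∈ G :=
    fun F hF G hG =>
      hi'.exists_mem (mem_insert_self _ _) (mem_insert_of_mem hF) (mem_insert_of_mem hG)
  rw [stdFam, starFam, mem_filter]
  refine ⟨hA.1, ?_⟩
  rcases htr with ⟨h1, h2⟩ | ⟨h1, h2, h3⟩ | ⟨h1, h2, h3⟩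
  · refine Or.inl ⟨h1, h2, ?_⟩
    by_cases hAL : ∃ x ∈ Icc 3 (k - 1), x ∈ A
    · exact Or.inl hAL
    refine Or.inr fun v hv => ?_
    obtain ⟨x, hx, y, hy, hxy, hvx, hvy, hX, hY⟩ := c1 v hv
    obtain ⟨t, htA, ht1, ht2⟩ := three _ (mA v (hM hv) x hx hvx hX) _ (mB v (hM hv) y hy hvy hY)
    have htL : ¬ (3 ≤ t ∧ t ≤ k - 1) := fun h => hAL ⟨t, mem_Icc.2 h, htA⟩
    have := mem_Icc.1 (hM hv)
    rw [mem_Icc] at hx hy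
    rw [mem_edgeSet] at ht1 ht2
    obtain rfl : t = v := by omega
    exact htA
  · refine Or.inr (Or.inl ⟨h1, h2, h3, ?_⟩)
    obtain ⟨u, hu, w, hw, huw, rfl⟩ :=
      exists_eq_edgeSet (by omega) (Or.inl ⟨rfl, rfl⟩) hA.1 h1 h2 h3
    refine ⟨{u, w}, ?_, by simp [insert_subset_iff, mem_edgeSet]⟩
    by_contra hX
    obtain ⟨y, hy, z, hz, hyz, hY, hdis⟩ := c2 u hu w hw huw hX
    obtain ⟨t, htA, ht1, ht2⟩ := three _ (mB y hy z hz hyz hY) Z hZ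
    have ht3 := hZA t ht2 htA
    rw [mem_edgeSet] at htA ht1
    rw [mem_Icc] at hu hw hy hz
    rcases ht3 with h | h | h
    · omega
    · omega
    · have h5 := hdis t h
      have h6 := mem_Icc.1 (hM h)
      omega
  · refine Or.inr (Or.inr ⟨h1, h2, h3, fun X hX => ?_⟩)
    obtain ⟨v, hv, x, hx, hvx, rfl⟩ := h𝒜 X hX
    obtain ⟨t, htA, ht1, ht2⟩ := three _ (mA v (hM hv) x (hM hx) hvx hX) Z hZ
    have ht3 := hZA t ht2 htA
    rw [mem_edgeSet] at ht1
    have bv := mem_Icc.1 (hM hv)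
    have bx := mem_Icc.1 (hM hx)
    refine ⟨t, ?_, htA⟩
    rcases ht3 with rfl | rfl | h
    · contradiction
    · omega
    · have h6 := mem_Icc.1 (hM h)
      rw [mem_insert, mem_singleton]
      omega

/-- `F ↦ F ∩ [k, n]` is a bijection onto pairs, so counting the members missing a kernel point
becomes counting edges. -/
theorem card_filter_edgeSet {n k r s : ℕ} (hk : 3 ≤ k)
    (hrs : (r = 1 ∧ s = 2) ∨ (r = 2 ∧ s = 1))
    {R R' : Finset ℕ → Prop} [DecidablePred R] [DecidablePred R']
    (hR : ∀ u ∈ Icc k n, ∀ v ∈ Icc k n, u ≠ v → (R (edgeSet k r u v) ↔ R' {u, v})) :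
    #{F ∈ kSubsets n k | r ∈ F ∧ s ∉ F ∧ Icc 3 (k - 1) ⊆ F ∧ R F} =
      #{Y ∈ (Icc k n).powersetCard 2 | R' Y} := by
  refine card_bij' (fun F _ => F ∩ Icc k n) (fun Y _ => insert r (Y ∪ Icc 3 (k - 1))) ?_ ?_ ?_ ?_
  all_goals
    intro F hF
    simp only [mem_filter] at hF
  · obtain ⟨hF, h1, h2, h3, h4⟩ := hF
    obtain ⟨u, hu, v, hv, huv, rfl⟩ := exists_eq_edgeSet hk hrs hF h1 h2 h3
    have e : edgeSet k r u v ∩ Icc k n = {u, v} := by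
      ext x
      rw [mem_Icc] at hu hv
      rw [mem_inter, mem_edgeSet, mem_Icc, mem_insert, mem_singleton]
      omega
    rw [e, mem_filter, mem_powersetCard]
    exact ⟨⟨insert_subset hu (singleton_subset_iff.2 hv), card_pair huv⟩, (hR u hu v hv huv).1 h4⟩
  · rw [mem_powersetCard] at hF
    obtain ⟨⟨hF, hc⟩, h⟩ := hF
    obtain ⟨u, v, huv, rfl⟩ := card_eq_two.1 hc
    rw [insert_subset_iff, singleton_subset_iff] at hF
    have e : insert r ({u, v} ∪ Icc 3 (k - 1)) = edgeSet k r u v := by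
      rw [edgeSet, insert_union, singleton_union]
    rw [e, mem_filter, hR u hF.1 v hF.2 huv]
    have hu := mem_Icc.1 hF.1
    have hv := mem_Icc.1 hF.2
    refine ⟨edgeSet_mem_kSubsets hk (by omega) hu.1 hv.1 huv hu.2 hv.2, ?_, ?_, ?_, h⟩
    · rw [mem_edgeSet]; omega
    · rw [mem_edgeSet]; omega
    · intro t ht
      rw [mem_Icc] at ht
      rw [mem_edgeSet]; omega
  · obtain ⟨hF, h1, h2, h3, h4⟩ := hF
    obtain ⟨u, hu, v, hv, huv, rfl⟩ := exists_eq_edgeSet hk hrs hF h1 h2 h3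
    ext x
    rw [mem_Icc] at hu hv
    rw [mem_insert, mem_union, mem_inter, mem_edgeSet, mem_Icc, mem_Icc]
    omega
  · rw [mem_powersetCard] at hF
    ext x
    have h := fun h : x ∈ F => mem_Icc.1 (hF.1.1 h)
    rw [mem_inter, mem_insert, mem_union, mem_Icc, mem_Icc]
    by_cases hx : x ∈ F
    · have := h hx
      simp only [hx, true_or, or_true, true_and, iff_true]
      omega
    · simp only [hx, false_or, iff_false]
      omega

/-- The four terms count the sets through `1` and `2` with a petal, those without petals, the
members missing `2` (edges of `𝒜`), and the members missing `1` (covers of `𝒜`). -/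
theorem card_stdFam {n k : ℕ} {M : Finset ℕ} {𝒜 : Finset (Finset ℕ)} (hk : 5 ≤ k)
    (hn : 3 * k < n) (hM : M ⊆ Icc k n) (hMk : M.card + 2 ≤ k)
    (h𝒜 : ∀ X ∈ 𝒜, ∃ v ∈ M, ∃ x ∈ M, v ≠ x ∧ X = {v, x}) :
    (stdFam n k M 𝒜).card = pairCount n k (k - 3) +
      ((n - k + 1 - M.card).choose (k - 2 - M.card) + (𝒜.card +
        #{Y ∈ (Icc k n).powersetCard 2 | ∀ X ∈ 𝒜, ∃ x ∈ X, x ∈ Y})) := by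
  have hLn : Icc 3 (k - 1) ⊆ Icc 1 n := Icc_subset_Icc (by omega) (by omega)
  have h1n : 1 ∈ Icc 1 n := by rw [mem_Icc]; omega
  have h2n : 2 ∈ Icc 1 n := by rw [mem_Icc]; omega
  have hA := card_filter_edgeSet (n := n) (k := k) (r := 1) (s := 2) (by omega)
    (Or.inl ⟨rfl, rfl⟩) (R := fun F => ∃ X ∈ 𝒜, X ⊆ F) (R' := fun Y => Y ∈ 𝒜) (by
      intro u hu v hv huv
      constructor
      · rintro ⟨X, hX, hXF⟩
        obtain ⟨a, ha, b, hb, hab, rfl⟩ := h𝒜 X hX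
        simp only [insert_subset_iff, singleton_subset_iff, mem_edgeSet] at hXF
        have := mem_Icc.1 (hM ha)
        have := mem_Icc.1 (hM hb)
        have : (a = u ∧ b = v) ∨ (a = v ∧ b = u) := by omega
        rcases this with ⟨rfl, rfl⟩ | ⟨rfl, rfl⟩
        · exact hX
        · rwa [pair_comm]
      · intro h
        exact ⟨_, h, by simp [insert_subset_iff, mem_edgeSet]⟩)
  have hB := card_filter_edgeSet (n := n) (k := k) (r := 2) (s := 1) (by omega)
    (Or.inr ⟨rfl, rfl⟩) (R := fun F => ∀ X ∈ 𝒜, ∃ x ∈ X, x ∈ F)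
    (R' := fun Y => ∀ X ∈ 𝒜, ∃ x ∈ X, x ∈ Y) (by
      intro u hu v hv huv
      refine forall₂_congr fun X hX => exists_congr fun x => and_congr_right fun hx => ?_
      obtain ⟨a, ha, b, hb, hab, rfl⟩ := h𝒜 X hX
      have := mem_Icc.1 (hM ha)
      have := mem_Icc.1 (hM hb)
      rw [mem_insert, mem_singleton] at hx
      rw [mem_edgeSet, mem_insert, mem_singleton]
      omega)
  have hA' : {Y ∈ (Icc k n).powersetCard 2 | Y ∈ 𝒜} = 𝒜 := by
    ext Y
    rw [mem_filter, mem_powersetCard]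
    refine ⟨fun h => h.2, fun h => ⟨?_, h⟩⟩
    obtain ⟨a, ha, b, hb, hab, rfl⟩ := h𝒜 Y h
    exact ⟨insert_subset (hM ha) (singleton_subset_iff.2 (hM hb)), card_pair hab⟩
  have hZ : #{F ∈ kSubsets n k | insert 1 (insert 2 M) ⊆ F ∧ Disjoint F (Icc 3 (k - 1))} =
      (n - k + 1 - M.card).choose (k - 2 - M.card) := by
    have h2M : 2 ∉ M := fun h => by have := mem_Icc.1 (hM h); omega
    have h1M : 1 ∉ insert 2 M := fun h => by
      rcases mem_insert.1 h with h | h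
      · omega
      · have := mem_Icc.1 (hM h); omega
    have hc : (insert 1 (insert 2 M)).card = M.card + 2 := by
      rw [card_insert_of_notMem h1M, card_insert_of_notMem h2M]
    rw [card_filter_subset_disjoint
      (insert_subset h1n (insert_subset h2n (hM.trans (Icc_subset_Icc (by omega) le_rfl)))) hLn
      ?_ (by omega), hc, Nat.card_Icc]
    · congr 1
      all_goals omega
    · rw [disjoint_left]
      intro x hx hx'
      rw [mem_Icc] at hx'
      rcases mem_insert.1 hx with h | h
      · omega
      rcases mem_insert.1 h with h | h
      · omega
      · have := mem_Icc.1 (hM h); omega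
  have hC := card_filter_pair (n := n) (k := k) (by omega) h1n h2n (by omega) hLn
    (by simp) (by simp)
  rw [Nat.card_Icc, show k - 1 + 1 - 3 = k - 3 by omega] at hC
  rw [← hC, ← hZ, ← hB]
  rw [hA'] at hA
  rw [← hA, ← card_union_of_disjoint, ← card_union_of_disjoint, ← card_union_of_disjoint,
    ← filter_or, ← filter_or, ← filter_or, stdFam, starFam]
  · congr 1
    refine filter_congr fun F _ => ?_
    have : Disjoint F (Icc 3 (k - 1)) ↔ ¬ ∃ x ∈ Icc 3 (k - 1), x ∈ F := by
      rw [disjoint_right]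
      push Not
      rfl
    rw [this, insert_subset_iff, insert_subset_iff]
    generalize (∃ x ∈ Icc 3 (k - 1), x ∈ F) = E
    by_cases h1 : 1 ∈ F <;> by_cases h2 : 2 ∈ F <;> by_cases hE : E <;> simp [h1, h2, hE]
  all_goals
    rw [disjoint_left]
    intro F h h'
    simp only [mem_union, mem_filter, insert_subset_iff, disjoint_right] at h h'
  · obtain ⟨-, h1, h2, x, h3, h4⟩ := h
    rcases h' with ⟨-, -, h⟩ | ⟨-, -, h, -⟩ | ⟨-, -, h, -⟩
    · exact h h3 h4
    · exact h h2
    · exact h h1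
  · obtain ⟨-, ⟨h1, h2, -⟩, -⟩ := h
    rcases h' with ⟨-, -, h, -⟩ | ⟨-, -, h, -⟩
    · exact h h2
    · exact h h1
  · exact h.2.2.1 h'.2.1

theorem starFam_isomorphic_stdFam {n k p q : ℕ} {L M : Finset ℕ} {𝒜 : Finset (Finset ℕ)}
    (hp : p ∈ Icc 1 n) (hq : q ∈ Icc 1 n) (hpq : p ≠ q) (hL : L ⊆ Icc 1 n) (hpL : p ∉ L)
    (hqL : q ∉ L) (hl : L.card + 3 = k) (hM : M ⊆ Icc 1 n) (hpM : p ∉ M) (hqM : q ∉ M)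
    (hLM : Disjoint L M) (h𝒜 : ∀ X ∈ 𝒜, X ⊆ M) {f : ℕ → ℕ} (hf : Set.InjOn f M)
    (hfM : ∀ x ∈ M, f x ∈ Icc k n) (hn : k ≤ n) :
    Isomorphic n (starFam n k p q L M 𝒜)
      (stdFam n k (M.image f) (𝒜.image fun X => X.image f)) := by
  obtain ⟨π, hπ, h1, h2, h3, h4⟩ := exists_perm_standard hp hq hpq hL hpL hqL rfl hM hpM hqM hLM hf
    (by rwa [hl]) (by omega)
  refine ⟨π, hπ, ?_⟩
  have e1 : ∀ X ⊆ M, X.image π = X.image f := fun X hX => image_congr fun x hx => h4 x (hX hx)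
  rw [image_starFam hπ, h1, h2, h3, stdFam, e1 M subset_rfl,
    image_congr fun X hX => e1 X (h𝒜 X hX), show L.card + 2 = k - 1 by omega]

/-! ### The explicit families as graph families -/

theorem kernel_iff {k : ℕ} {F M : Finset ℕ} :
    ((Icc 1 2 ⊆ F ∧ (F ∩ Icc 3 (k - 1)).Nonempty) ∨ Icc 1 2 ∪ M ⊆ F) ↔
      1 ∈ F ∧ 2 ∈ F ∧ ((∃ x ∈ Icc 3 (k - 1), x ∈ F) ∨ M ⊆ F) := by
  have h12 : Icc 1 2 = ({1, 2} : Finset ℕ) := rfl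
  have h3 : (F ∩ Icc 3 (k - 1)).Nonempty ↔ ∃ x ∈ Icc 3 (k - 1), x ∈ F := by
    simp only [Finset.Nonempty, mem_inter, and_comm]
  rw [h12, h3, union_subset_iff, insert_subset_iff, singleton_subset_iff, ← and_or_left, and_assoc]

theorem Icc_add_two (k : ℕ) : Icc k (k + 2) = {k, k + 1, k + 2} := by
  ext x
  simp only [mem_Icc, mem_insert, mem_singleton]
  omega

theorem Icc_add_three (k : ℕ) : Icc k (k + 3) = {k, k + 1, k + 2, k + 3} := by
  ext x
  simp only [mem_Icc, mem_insert, mem_singleton]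
  omega

theorem mem_stdFam_iff {n k : ℕ} {F M : Finset ℕ} {𝒜 : Finset (Finset ℕ)} :
    F ∈ stdFam n k M 𝒜 ↔ F ∈ kSubsets n k ∧
      ((1 ∈ F ∧ 2 ∈ F ∧ ((∃ x ∈ Icc 3 (k - 1), x ∈ F) ∨ M ⊆ F)) ∨
      (1 ∈ F ∧ 2 ∉ F ∧ Icc 3 (k - 1) ⊆ F ∧ ∃ X ∈ 𝒜, X ⊆ F) ∨
      (1 ∉ F ∧ 2 ∈ F ∧ Icc 3 (k - 1) ⊆ F ∧ ∀ X ∈ 𝒜, ∃ x ∈ X, x ∈ F)) := by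
  rw [stdFam, starFam, mem_filter]

theorem card_inter_Icc_eq_two_iff {n k r s : ℕ} (hk : 3 ≤ k)
    (hrs : (r = 1 ∧ s = 2) ∨ (r = 2 ∧ s = 1)) {F : Finset ℕ} (hF : F ∈ kSubsets n k) :
    ({r} ∪ Icc 3 (k - 1) ⊆ F ∧ (Icc k (k + 2) ∩ F).card = 2) ↔
      r ∈ F ∧ s ∉ F ∧ Icc 3 (k - 1) ⊆ F ∧
        ((k ∈ F ∧ k + 1 ∈ F) ∨ (k + 1 ∈ F ∧ k + 2 ∈ F) ∨ (k ∈ F ∧ k + 2 ∈ F)) := by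
  rw [union_subset_iff, singleton_subset_iff]
  constructor
  · rintro ⟨⟨h1, h2⟩, h3⟩
    obtain ⟨u, v, huv, he⟩ := card_eq_two.1 h3
    have hu : u ∈ Icc k (k + 2) ∩ F := by simp [he]
    have hv : v ∈ Icc k (k + 2) ∩ F := by simp [he]
    rw [mem_inter, mem_Icc] at hu hv
    obtain rfl := eq_edgeSet hk (by omega) hu.1.1 hv.1.1 huv hF h1 hu.2 hv.2 h2
    refine ⟨h1, ?_, h2, ?_⟩
    · rw [mem_edgeSet]; omega
    · simp only [mem_edgeSet]; omega
  · rintro ⟨h1, h2, h3, h4⟩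
    refine ⟨⟨h1, h3⟩, ?_⟩
    obtain ⟨u, v, hu, hv, huv, huF, hvF⟩ : ∃ u v, (k ≤ u ∧ u ≤ k + 2) ∧ (k ≤ v ∧ v ≤ k + 2) ∧
        u ≠ v ∧ u ∈ F ∧ v ∈ F := by
      rcases h4 with h | h | h
      · exact ⟨k, k + 1, by omega, by omega, by omega, h⟩
      · exact ⟨k + 1, k + 2, by omega, by omega, by omega, h⟩
      · exact ⟨k, k + 2, by omega, by omega, by omega, h⟩
    obtain rfl := eq_edgeSet hk (by omega) hu.1 hv.1 huv hF h1 huF hvF h3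
    have : Icc k (k + 2) ∩ edgeSet k r u v = {u, v} := by
      ext x
      rw [mem_inter, mem_Icc, mem_edgeSet, mem_insert, mem_singleton]
      omega
    rw [this, card_pair huv]

/-- In a triangle, containing an edge and meeting all edges both mean containing two of the three
vertices, hence the symmetric description. -/
theorem famS_eq {n k : ℕ} (hk : 3 ≤ k) :
    famS n k = stdFam n k {k, k + 1, k + 2} {{k, k + 1}, {k + 1, k + 2}, {k, k + 2}} := by
  ext F
  simp only [famS, mem_union, mem_filter, mem_biUnion, mem_stdFam_iff, ← Icc_add_two]
  by_cases hF : F ∈ kSubsets n k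
  · simp only [hF, true_and]
    rw [kernel_iff]
    refine or_congr Iff.rfl ?_
    have h12 : Icc 1 2 = ({1, 2} : Finset ℕ) := rfl
    rw [h12, exists_mem_insert]
    simp only [mem_singleton, exists_eq_left]
    rw [card_inter_Icc_eq_two_iff hk (Or.inl ⟨rfl, rfl⟩) hF,
      card_inter_Icc_eq_two_iff hk (Or.inr ⟨rfl, rfl⟩) hF]
    simp only [mem_insert, mem_singleton, exists_eq_or_imp, exists_eq_left, forall_eq_or_imp,
      forall_eq, insert_subset_iff, singleton_subset_iff]
    refine or_congr Iff.rfl ?_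
    tauto
  · simp [hF]

/-- The covers of the cherry with centre `k` are the pairs through `k`, which give the sets `[2, k]
∪ {i}`, and the pair of leaves. -/
theorem famS₁_eq {n k : ℕ} (hk : 3 ≤ k) (hn : k + 2 ≤ n) :
    famS₁ n k = stdFam n k {k, k + 1, k + 2} {{k, k + 1}, {k, k + 2}} := by
  have e0 : ∀ i, Icc 2 k ∪ {i} = edgeSet k 2 k i := fun i => by
    ext x
    simp only [mem_edgeSet, mem_union, mem_singleton, mem_Icc]
    omega
  have e1 : Icc 2 (k + 2) \ {k} = edgeSet k 2 (k + 1) (k + 2) := by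
    ext x
    simp only [mem_edgeSet, mem_sdiff, mem_singleton, mem_Icc]
    omega
  have e2 : Icc 1 (k + 1) \ {2} = edgeSet k 1 k (k + 1) := by
    ext x
    simp only [mem_edgeSet, mem_sdiff, mem_singleton, mem_Icc]
    omega
  have e3 : Icc 1 (k + 2) \ {2, k + 1} = edgeSet k 1 k (k + 2) := by
    ext x
    simp only [mem_edgeSet, mem_sdiff, mem_insert, mem_singleton, mem_Icc]
    omega
  have hkn : k ∈ Icc k n := by rw [mem_Icc]; omega
  have h1n : k + 1 ∈ Icc k n := by rw [mem_Icc]; omega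
  have h2n : k + 2 ∈ Icc k n := by rw [mem_Icc]; omega
  ext F
  rw [famS₁, Icc_add_two]
  simp only [e0, e1, e2, e3, mem_union, mem_filter, mem_image, mem_insert, mem_singleton]
  constructor
  · rintro (((⟨hF, h⟩ | ⟨hF, h⟩) | ⟨i, hi, rfl⟩) | rfl | rfl | rfl)
    · exact mem_stdFam_iff.2 ⟨hF, Or.inl (kernel_iff.1 (Or.inl h))⟩
    · exact mem_stdFam_iff.2 ⟨hF, Or.inl (kernel_iff.1 (Or.inr h))⟩
    · rw [mem_Icc] at hi
      exact edgeSet_two_mem_stdFam hk hkn (by rw [mem_Icc]; omega) (by omega) (by simp)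
    · exact edgeSet_two_mem_stdFam hk h1n h2n (by omega) (by simp)
    · exact edgeSet_one_mem_stdFam hk hkn h1n (by omega) (by simp)
    · exact edgeSet_one_mem_stdFam hk hkn h2n (by omega) (by simp)
  · rw [mem_stdFam_iff]
    rintro ⟨hF, h | ⟨h1, h2, h3, h4⟩ | ⟨h1, h2, h3, h4⟩⟩
    · rw [← kernel_iff] at h
      tauto
    · simp only [mem_insert, mem_singleton, exists_eq_or_imp, exists_eq_left, insert_subset_iff,
        singleton_subset_iff] at h4
      rcases h4 with ⟨h4, h5⟩ | ⟨h4, h5⟩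
      · simp [eq_edgeSet hk (Or.inl rfl) le_rfl (by omega) (by omega) hF h1 h4 h5 h3]
      · simp [eq_edgeSet hk (Or.inl rfl) le_rfl (by omega) (by omega) hF h1 h4 h5 h3]
    · simp only [mem_insert, mem_singleton, exists_eq_or_imp, exists_eq_left, forall_eq_or_imp,
        forall_eq] at h4
      by_cases hkF : k ∈ F
      · obtain ⟨u, hu, v, hv, huv, rfl⟩ := exists_eq_edgeSet hk (Or.inr ⟨rfl, rfl⟩) hF h2 h1 h3
        refine Or.inl (Or.inr ?_)
        rw [mem_edgeSet] at hkF
        rw [mem_Icc] at hu hv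
        obtain rfl | rfl : k = u ∨ k = v := by omega
        · exact ⟨v, by rw [mem_Icc]; omega, rfl⟩
        · exact ⟨u, by rw [mem_Icc]; omega, edgeSet_comm _ _ _ _⟩
      · simp [eq_edgeSet hk (Or.inr rfl) (by omega) (by omega) (by omega) hF h2
          (h4.1.resolve_left hkF) (h4.2.resolve_left hkF) h3]

/-- A cover of the matching takes one end of each edge, so the covers form a four-cycle. -/
theorem famS₂_eq {n k : ℕ} (hk : 3 ≤ k) (hn : k + 3 ≤ n) :
    famS₂ n k = stdFam n k {k, k + 1, k + 2, k + 3} {{k, k + 2}, {k + 1, k + 3}} := by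
  have e1 : Icc 2 (k + 1) = edgeSet k 2 k (k + 1) := by
    ext x
    simp only [mem_edgeSet, mem_Icc]
    omega
  have e2 : Icc 2 (k - 1) ∪ {k + 2, k + 3} = edgeSet k 2 (k + 2) (k + 3) := by
    ext x
    simp only [mem_edgeSet, mem_union, mem_insert, mem_singleton, mem_Icc]
    omega
  have e3 : Icc 2 k ∪ {k + 3} = edgeSet k 2 k (k + 3) := by
    ext x
    simp only [mem_edgeSet, mem_union, mem_singleton, mem_Icc]
    omega
  have e4 : Icc 2 (k + 2) \ {k} = edgeSet k 2 (k + 1) (k + 2) := by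
    ext x
    simp only [mem_edgeSet, mem_sdiff, mem_singleton, mem_Icc]
    omega
  have e5 : Icc 3 k ∪ {1, k + 2} = edgeSet k 1 k (k + 2) := by
    ext x
    simp only [mem_edgeSet, mem_union, mem_insert, mem_singleton, mem_Icc]
    omega
  have e6 : Icc 3 (k - 1) ∪ {1, k + 1, k + 3} = edgeSet k 1 (k + 1) (k + 3) := by
    ext x
    simp only [mem_edgeSet, mem_union, mem_insert, mem_singleton, mem_Icc]
    omega
  have hkn : k ∈ Icc k n := by rw [mem_Icc]; omega
  have h1n : k + 1 ∈ Icc k n := by rw [mem_Icc]; omega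
  have h2n : k + 2 ∈ Icc k n := by rw [mem_Icc]; omega
  have h3n : k + 3 ∈ Icc k n := by rw [mem_Icc]; omega
  ext F
  rw [famS₂, Icc_add_three]
  simp only [e1, e2, e3, e4, e5, e6, mem_union, mem_filter, mem_insert, mem_singleton]
  constructor
  · rintro (((⟨hF, h⟩ | ⟨hF, h⟩) | rfl | rfl | rfl | rfl) | rfl | rfl)
    · exact mem_stdFam_iff.2 ⟨hF, Or.inl (kernel_iff.1 (Or.inl h))⟩
    · exact mem_stdFam_iff.2 ⟨hF, Or.inl (kernel_iff.1 (Or.inr h))⟩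
    · exact edgeSet_two_mem_stdFam hk hkn h1n (by omega) (by simp)
    · exact edgeSet_two_mem_stdFam hk h2n h3n (by omega) (by simp)
    · exact edgeSet_two_mem_stdFam hk hkn h3n (by omega) (by simp)
    · exact edgeSet_two_mem_stdFam hk h1n h2n (by omega) (by simp)
    · exact edgeSet_one_mem_stdFam hk hkn h2n (by omega) (by simp)
    · exact edgeSet_one_mem_stdFam hk h1n h3n (by omega) (by simp)
  · rw [mem_stdFam_iff]
    rintro ⟨hF, h | ⟨h1, h2, h3, h4⟩ | ⟨h1, h2, h3, h4⟩⟩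
    · rw [← kernel_iff] at h
      tauto
    · simp only [mem_insert, mem_singleton, exists_eq_or_imp, exists_eq_left, insert_subset_iff,
        singleton_subset_iff] at h4
      rcases h4 with ⟨h4, h5⟩ | ⟨h4, h5⟩ <;>
      simp [eq_edgeSet hk (Or.inl rfl) (by omega) (by omega) (by omega) hF h1 h4 h5 h3]
    · simp only [mem_insert, mem_singleton, exists_eq_or_imp, exists_eq_left, forall_eq_or_imp,
        forall_eq] at h4
      obtain ⟨h4 | h4, h5 | h5⟩ := h4
      · simp [eq_edgeSet hk (Or.inr rfl) (by omega) (by omega) (by omega) hF h2 h4 h5 h3]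
      · simp [eq_edgeSet hk (Or.inr rfl) (by omega) (by omega) (by omega) hF h2 h4 h5 h3]
      · simp [eq_edgeSet hk (Or.inr rfl) (by omega) (by omega) (by omega) hF h2 h5 h4 h3]
      · simp [eq_edgeSet hk (Or.inr rfl) (by omega) (by omega) (by omega) hF h2 h4 h5 h3]

/-- The covers of the path `k, k + 1, k + 2, k + 3` form the path `k, k + 2, k + 1, k + 3`. -/
theorem famS₃_eq {n k : ℕ} (hk : 3 ≤ k) (hn : k + 3 ≤ n) :
    famS₃ n k =
      stdFam n k {k, k + 1, k + 2, k + 3} {{k, k + 1}, {k + 1, k + 2}, {k + 2, k + 3}} := by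
  have e1 : Icc 2 k ∪ {k + 2} = edgeSet k 2 k (k + 2) := by
    ext x
    simp only [mem_edgeSet, mem_union, mem_singleton, mem_Icc]
    omega
  have e2 : Icc 2 (k + 2) \ {k} = edgeSet k 2 (k + 1) (k + 2) := by
    ext x
    simp only [mem_edgeSet, mem_sdiff, mem_singleton, mem_Icc]
    omega
  have e3 : Icc 2 (k - 1) ∪ {k + 1, k + 3} = edgeSet k 2 (k + 1) (k + 3) := by
    ext x
    simp only [mem_edgeSet, mem_union, mem_insert, mem_singleton, mem_Icc]
    omega
  have e4 : Icc 3 (k + 1) ∪ {1} = edgeSet k 1 k (k + 1) := by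
    ext x
    simp only [mem_edgeSet, mem_union, mem_singleton, mem_Icc]
    omega
  have e5 : Icc 3 (k - 1) ∪ {1, k + 1, k + 2} = edgeSet k 1 (k + 1) (k + 2) := by
    ext x
    simp only [mem_edgeSet, mem_union, mem_insert, mem_singleton, mem_Icc]
    omega
  have e6 : Icc 3 (k - 1) ∪ {1, k + 2, k + 3} = edgeSet k 1 (k + 2) (k + 3) := by
    ext x
    simp only [mem_edgeSet, mem_union, mem_insert, mem_singleton, mem_Icc]
    omega
  have hkn : k ∈ Icc k n := by rw [mem_Icc]; omega
  have h1n : k + 1 ∈ Icc k n := by rw [mem_Icc]; omega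
  have h2n : k + 2 ∈ Icc k n := by rw [mem_Icc]; omega
  have h3n : k + 3 ∈ Icc k n := by rw [mem_Icc]; omega
  ext F
  rw [famS₃, Icc_add_three]
  simp only [e1, e2, e3, e4, e5, e6, mem_union, mem_filter, mem_insert, mem_singleton]
  constructor
  · rintro (((⟨hF, h⟩ | ⟨hF, h⟩) | rfl | rfl | rfl) | rfl | rfl | rfl)
    · exact mem_stdFam_iff.2 ⟨hF, Or.inl (kernel_iff.1 (Or.inl h))⟩
    · exact mem_stdFam_iff.2 ⟨hF, Or.inl (kernel_iff.1 (Or.inr h))⟩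
    · exact edgeSet_two_mem_stdFam hk hkn h2n (by omega) (by simp)
    · exact edgeSet_two_mem_stdFam hk h1n h2n (by omega) (by simp)
    · exact edgeSet_two_mem_stdFam hk h1n h3n (by omega) (by simp)
    · exact edgeSet_one_mem_stdFam hk hkn h1n (by omega) (by simp)
    · exact edgeSet_one_mem_stdFam hk h1n h2n (by omega) (by simp)
    · exact edgeSet_one_mem_stdFam hk h2n h3n (by omega) (by simp)
  · rw [mem_stdFam_iff]
    rintro ⟨hF, h | ⟨h1, h2, h3, h4⟩ | ⟨h1, h2, h3, h4⟩⟩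
    · rw [← kernel_iff] at h
      tauto
    · simp only [mem_insert, mem_singleton, exists_eq_or_imp, exists_eq_left, insert_subset_iff,
        singleton_subset_iff] at h4
      rcases h4 with ⟨h4, h5⟩ | ⟨h4, h5⟩ | ⟨h4, h5⟩ <;>
      simp [eq_edgeSet hk (Or.inl rfl) (by omega) (by omega) (by omega) hF h1 h4 h5 h3]
    · simp only [mem_insert, mem_singleton, exists_eq_or_imp, exists_eq_left, forall_eq_or_imp,
        forall_eq] at h4
      have h5 : (k ∈ F ∧ k + 2 ∈ F) ∨ (k + 1 ∈ F ∧ k + 2 ∈ F) ∨ (k + 1 ∈ F ∧ k + 3 ∈ F) := by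
        tauto
      rcases h5 with ⟨h4, h5⟩ | ⟨h4, h5⟩ | ⟨h4, h5⟩ <;>
      simp [eq_edgeSet hk (Or.inr rfl) (by omega) (by omega) (by omega) hF h2 h4 h5 h3]

/-- The standard family with `k - 3` petals whose graph is a single edge. -/
def famG (n k : ℕ) : Finset (Finset ℕ) := stdFam n k {k, k + 1} {{k, k + 1}}

theorem pair_eq_pair_iff {a b c d : ℕ} :
    ({a, b} : Finset ℕ) = {c, d} ↔ (a = c ∧ b = d) ∨ (a = d ∧ b = c) := by
  rw [← coe_inj, coe_pair, coe_pair, Set.pair_eq_pair_iff]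

/-- The vertices are sent to `k, k + 1, …` in the order in which `IsConfig` lists them. Four
vertices require `4 + 2 ≤ k`, whence `6 ≤ k` in the last two cases. -/
theorem IsConfig.isomorphic {n k p q : ℕ} {L M : Finset ℕ} {𝒜 : Finset (Finset ℕ)}
    (hc : IsConfig M 𝒜) (hk : 3 ≤ k) (hn : k + 3 ≤ n)
    (hp : p ∈ Icc 1 n) (hq : q ∈ Icc 1 n) (hpq : p ≠ q) (hL : L ⊆ Icc 1 n) (hpL : p ∉ L)
    (hqL : q ∉ L) (hl : L.card + 3 = k) (hM : M ⊆ Icc 1 n) (hpM : p ∉ M) (hqM : q ∉ M)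
    (hLM : Disjoint L M) (hMk : M.card + 2 ≤ k) :
    Isomorphic n (starFam n k p q L M 𝒜) (famG n k) ∨
    Isomorphic n (starFam n k p q L M 𝒜) (famS₁ n k) ∨
    Isomorphic n (starFam n k p q L M 𝒜) (famS n k) ∨
    6 ≤ k ∧ (Isomorphic n (starFam n k p q L M 𝒜) (famS₂ n k) ∨
      Isomorphic n (starFam n k p q L M 𝒜) (famS₃ n k)) := by
  have key := fun f hf hfM => starFam_isomorphic_stdFam (f := f) hp hq hpq hL hpL hqL hl hM hpM hqM
    hLM hc.subset hf hfM (by omega)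
  cases hc with
  | @edge a b hab =>
    have h := key (fun x => if x = a then k else k + 1)
      (by
        intro x hx y hy hxy
        simp only [coe_insert, coe_singleton, Set.mem_insert_iff, Set.mem_singleton_iff] at hx hy
        simp only at hxy
        split_ifs at hxy <;> omega)
      (by
        intro x hx
        rw [mem_Icc]
        split_ifs <;> omega)
    simp only [image_insert, image_singleton, if_true, hab.symm, if_false] at h
    exact Or.inl h
  | @cherry a b c hab hac hbc =>
    have h := key (fun x => if x = a then k else if x = b then k + 1 else k + 2)
      (by
        intro x hx y hy hxy
        simp only [coe_insert, coe_singleton, Set.mem_insert_iff, Set.mem_singleton_iff] at hx hy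
        simp only at hxy
        split_ifs at hxy <;> omega)
      (by
        intro x hx
        rw [mem_Icc]
        split_ifs <;> omega)
    simp only [image_insert, image_singleton, if_true, hab.symm, hac.symm, hbc.symm, if_false] at h
    rw [← famS₁_eq hk (by omega)] at h
    exact Or.inr (Or.inl h)
  | @triangle a b c hab hac hbc =>
    have h := key (fun x => if x = a then k else if x = b then k + 1 else k + 2)
      (by
        intro x hx y hy hxy
        simp only [coe_insert, coe_singleton, Set.mem_insert_iff, Set.mem_singleton_iff] at hx hy
        simp only at hxy
        split_ifs at hxy <;> omega)
      (by
        intro x hx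
        rw [mem_Icc]
        split_ifs <;> omega)
    simp only [image_insert, image_singleton, if_true, hab.symm, hac.symm, hbc.symm, if_false] at h
    rw [← famS_eq hk] at h
    exact Or.inr (Or.inr (Or.inl h))
  | @matching a b c d hab hac had hbc hbd hcd =>
    have h4 : ({a, b, c, d} : Finset ℕ).card = 4 := by
      rw [card_insert_of_notMem, card_insert_of_notMem, card_pair hcd] <;> simp [*]
    have h := key
      (fun x => if x = a then k else if x = b then k + 1 else if x = c then k + 2 else k + 3)
      (by
        intro x hx y hy hxy
        simp only [coe_insert, coe_singleton, Set.mem_insert_iff, Set.mem_singleton_iff] at hx hy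
        simp only at hxy
        split_ifs at hxy <;> omega)
      (by
        intro x hx
        rw [mem_Icc]
        split_ifs <;> omega)
    simp only [image_insert, image_singleton, if_true, hab.symm, hac.symm, hbc.symm, had.symm,
      hbd.symm, hcd.symm, if_false] at h
    rw [← famS₂_eq hk hn] at h
    exact Or.inr (Or.inr (Or.inr ⟨by omega, Or.inl h⟩))
  | @path a b c d hab hac had hbc hbd hcd =>
    have h4 : ({a, b, c, d} : Finset ℕ).card = 4 := by
      rw [card_insert_of_notMem, card_insert_of_notMem, card_pair hcd] <;> simp [*]
    have h := key
      (fun x => if x = a then k else if x = b then k + 1 else if x = c then k + 2 else k + 3)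
      (by
        intro x hx y hy hxy
        simp only [coe_insert, coe_singleton, Set.mem_insert_iff, Set.mem_singleton_iff] at hx hy
        simp only at hxy
        split_ifs at hxy <;> omega)
      (by
        intro x hx
        rw [mem_Icc]
        split_ifs <;> omega)
    simp only [image_insert, image_singleton, if_true, hab.symm, hac.symm, hbc.symm, had.symm,
      hbd.symm, hcd.symm, if_false] at h
    rw [← famS₃_eq hk hn] at h
    exact Or.inr (Or.inr (Or.inr ⟨by omega, Or.inr h⟩))

/-! ### Maximality and sizes of the explicit families -/

theorem subset_Icc_add {n k : ℕ} {M : Finset ℕ} (hM : M ⊆ Icc k (k + 3)) (hn : k + 3 ≤ n) :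
    M ⊆ Icc k n := hM.trans (Icc_subset_Icc le_rfl hn)

theorem famG_isMaximalNontrivial {n k : ℕ} (hk : 5 ≤ k) (hn : 3 * k < n) :
    IsMaximalNontrivial n k 3 (famG n k) := by
  refine stdFam_isMaximalNontrivial hk hn (subset_Icc_add ?_ (by omega)) ?_ (by simp) ?_ ?_ ?_
  · simp [insert_subset_iff]
  · rw [card_pair (by omega)]; omega
  · intro X hX
    rw [mem_singleton] at hX
    exact ⟨k, by simp, k + 1, by simp, by omega, hX⟩
  · intro v hv
    simp only [mem_insert, mem_singleton] at hv
    rcases hv with rfl | rfl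
    -- The second point of the cover only has to lie outside the graph; `k + 5 ≤ n` follows from `5
    -- ≤ k` and `3 * k < n`.
    · exact ⟨v + 1, by rw [mem_Icc]; omega, v + 5, by rw [mem_Icc]; omega, by omega, by omega,
        by omega, by simp, by simp⟩
    · exact ⟨k, by rw [mem_Icc]; omega, k + 5, by rw [mem_Icc]; omega, by omega, by omega,
        by omega, by simp [pair_comm], by simp⟩
  · intro u hu w hw huw h
    simp only [mem_singleton, pair_eq_pair_iff] at h
    have : (k ≠ u ∧ k ≠ w) ∨ (k + 1 ≠ u ∧ k + 1 ≠ w) := by omega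
    rcases this with h' | h'
    · refine ⟨k, by rw [mem_Icc]; omega, k + 5, by rw [mem_Icc]; omega, by omega, by simp, ?_⟩
      intro x hx
      simp only [mem_insert, mem_singleton] at hx
      omega
    · refine ⟨k + 1, by rw [mem_Icc]; omega, k + 5, by rw [mem_Icc]; omega, by omega, by simp, ?_⟩
      intro x hx
      simp only [mem_insert, mem_singleton] at hx
      omega

theorem card_three (k : ℕ) : ({k, k + 1, k + 2} : Finset ℕ).card = 3 := by
  rw [← Icc_add_two, Nat.card_Icc]
  omega

theorem card_four (k : ℕ) : ({k, k + 1, k + 2, k + 3} : Finset ℕ).card = 4 := by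
  rw [← Icc_add_three, Nat.card_Icc]
  omega

theorem famS₁_isMaximalNontrivial {n k : ℕ} (hk : 5 ≤ k) (hn : 3 * k < n) :
    IsMaximalNontrivial n k 3 (famS₁ n k) := by
  rw [famS₁_eq (by omega) (by omega)]
  refine stdFam_isMaximalNontrivial hk hn (subset_Icc_add ?_ (by omega)) ?_ (by simp) ?_ ?_ ?_
  · simp [insert_subset_iff]
  · rw [card_three]; omega
  · intro X hX
    rw [mem_insert, mem_singleton] at hX
    rcases hX with hX | hX
    · exact ⟨k, by simp, k + 1, by simp, by omega, hX⟩
    · exact ⟨k, by simp, k + 2, by simp, by omega, hX⟩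
  · intro v hv
    simp only [mem_insert, mem_singleton] at hv
    rcases hv with rfl | rfl | rfl
    · exact ⟨v + 1, by rw [mem_Icc]; omega, v + 5, by rw [mem_Icc]; omega, by omega, by omega,
        by omega, by simp, by simp⟩
    · exact ⟨k, by rw [mem_Icc]; omega, k + 2, by rw [mem_Icc]; omega, by omega, by omega,
        by omega, by simp [pair_comm], by simp⟩
    · exact ⟨k, by rw [mem_Icc]; omega, k + 1, by rw [mem_Icc]; omega, by omega, by omega,
        by omega, by simp [pair_comm], by simp⟩
  · intro u hu w hw huw h
    simp only [mem_insert, mem_singleton, pair_eq_pair_iff] at h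
    have : (k ≠ u ∧ k ≠ w) ∨ (k + 1 ≠ u ∧ k + 1 ≠ w ∧ k + 2 ≠ u ∧ k + 2 ≠ w) := by omega
    rcases this with h' | h'
    · refine ⟨k, by rw [mem_Icc]; omega, k + 5, by rw [mem_Icc]; omega, by omega, by simp, ?_⟩
      intro x hx
      simp only [mem_insert, mem_singleton] at hx
      omega
    · refine ⟨k + 1, by rw [mem_Icc]; omega, k + 2, by rw [mem_Icc]; omega, by omega, by simp, ?_⟩
      intro x hx
      simp only [mem_insert, mem_singleton] at hx
      omega

theorem famS_isMaximalNontrivial {n k : ℕ} (hk : 5 ≤ k) (hn : 3 * k < n) :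
    IsMaximalNontrivial n k 3 (famS n k) := by
  rw [famS_eq (by omega)]
  refine stdFam_isMaximalNontrivial hk hn (subset_Icc_add ?_ (by omega)) ?_ (by simp) ?_ ?_ ?_
  · simp [insert_subset_iff]
  · rw [card_three]; omega
  · intro X hX
    rw [mem_insert, mem_insert, mem_singleton] at hX
    rcases hX with hX | hX | hX
    · exact ⟨k, by simp, k + 1, by simp, by omega, hX⟩
    · exact ⟨k + 1, by simp, k + 2, by simp, by omega, hX⟩
    · exact ⟨k, by simp, k + 2, by simp, by omega, hX⟩
  · intro v hv
    simp only [mem_insert, mem_singleton] at hv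
    rcases hv with rfl | rfl | rfl
    · exact ⟨v + 1, by rw [mem_Icc]; omega, v + 2, by rw [mem_Icc]; omega, by omega, by omega,
        by omega, by simp, by simp⟩
    · exact ⟨k, by rw [mem_Icc]; omega, k + 2, by rw [mem_Icc]; omega, by omega, by omega,
        by omega, by simp [pair_comm], by simp⟩
    · exact ⟨k, by rw [mem_Icc]; omega, k + 1, by rw [mem_Icc]; omega, by omega, by omega,
        by omega, by simp [pair_comm], by simp⟩
  · intro u hu w hw huw h
    simp only [mem_insert, mem_singleton, pair_eq_pair_iff] at h
    have : (k ≠ u ∧ k ≠ w ∧ k + 1 ≠ u ∧ k + 1 ≠ w) ∨ (k ≠ u ∧ k ≠ w ∧ k + 2 ≠ u ∧ k + 2 ≠ w) ∨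
      (k + 1 ≠ u ∧ k + 1 ≠ w ∧ k + 2 ≠ u ∧ k + 2 ≠ w) := by omega
    rcases this with h' | h' | h'
    · refine ⟨k, by rw [mem_Icc]; omega, k + 1, by rw [mem_Icc]; omega, by omega, by simp, ?_⟩
      intro x hx
      simp only [mem_insert, mem_singleton] at hx
      omega
    · refine ⟨k, by rw [mem_Icc]; omega, k + 2, by rw [mem_Icc]; omega, by omega, by simp, ?_⟩
      intro x hx
      simp only [mem_insert, mem_singleton] at hx
      omega
    · refine ⟨k + 1, by rw [mem_Icc]; omega, k + 2, by rw [mem_Icc]; omega, by omega, by simp, ?_⟩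
      intro x hx
      simp only [mem_insert, mem_singleton] at hx
      omega

theorem famS₂_isMaximalNontrivial {n k : ℕ} (hk : 6 ≤ k) (hn : 3 * k < n) :
    IsMaximalNontrivial n k 3 (famS₂ n k) := by
  rw [famS₂_eq (by omega) (by omega)]
  refine stdFam_isMaximalNontrivial (by omega) hn (subset_Icc_add ?_ (by omega)) ?_ (by simp)
    ?_ ?_ ?_
  · simp [insert_subset_iff]
  · rw [card_four]; omega
  · intro X hX
    rw [mem_insert, mem_singleton] at hX
    rcases hX with hX | hX
    · exact ⟨k, by simp, k + 2, by simp, by omega, hX⟩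
    · exact ⟨k + 1, by simp, k + 3, by simp, by omega, hX⟩
  · intro v hv
    simp only [mem_insert, mem_singleton] at hv
    rcases hv with rfl | rfl | rfl | rfl
    · exact ⟨v + 2, by rw [mem_Icc]; omega, v + 1, by rw [mem_Icc]; omega, by omega, by omega,
        by omega, by simp, by simp⟩
    · exact ⟨k + 3, by rw [mem_Icc]; omega, k, by rw [mem_Icc]; omega, by omega, by omega,
        by omega, by simp, by simp⟩
    · exact ⟨k, by rw [mem_Icc]; omega, k + 1, by rw [mem_Icc]; omega, by omega, by omega,
        by omega, by simp [pair_comm], by simp⟩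
    · exact ⟨k + 1, by rw [mem_Icc]; omega, k, by rw [mem_Icc]; omega, by omega, by omega,
        by omega, by simp [pair_comm], by simp⟩
  · intro u hu w hw huw h
    simp only [mem_insert, mem_singleton, pair_eq_pair_iff] at h
    have : (k ≠ u ∧ k ≠ w) ∨ (k + 2 ≠ u ∧ k + 2 ≠ w) := by omega
    have : (k + 1 ≠ u ∧ k + 1 ≠ w) ∨ (k + 3 ≠ u ∧ k + 3 ≠ w) := by omega
    obtain ⟨y, hy, hyu⟩ : ∃ y, (y = k ∨ y = k + 2) ∧ (y ≠ u ∧ y ≠ w) := by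
      rcases ‹(k ≠ u ∧ k ≠ w) ∨ (k + 2 ≠ u ∧ k + 2 ≠ w)› with h | h
      · exact ⟨k, by simp, h⟩
      · exact ⟨k + 2, by simp, h⟩
    obtain ⟨z, hz, hzu⟩ : ∃ z, (z = k + 1 ∨ z = k + 3) ∧ (z ≠ u ∧ z ≠ w) := by
      rcases ‹(k + 1 ≠ u ∧ k + 1 ≠ w) ∨ (k + 3 ≠ u ∧ k + 3 ≠ w)› with h | h
      · exact ⟨k + 1, by simp, h⟩
      · exact ⟨k + 3, by simp, h⟩
    refine ⟨y, by rw [mem_Icc]; omega, z, by rw [mem_Icc]; omega, by omega, ?_, ?_⟩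
    · simp only [mem_insert, mem_singleton, forall_eq_or_imp, forall_eq]
      omega
    · intro x hx
      omega

theorem filter_powersetCard_two_eq {V : Finset ℕ} {R : Finset ℕ → Prop} [DecidablePred R]
    {ℬ : Finset (Finset ℕ)} (h1 : ∀ u ∈ V, ∀ v ∈ V, u ≠ v → (R {u, v} ↔ {u, v} ∈ ℬ))
    (h2 : ℬ ⊆ V.powersetCard 2) : {Y ∈ V.powersetCard 2 | R Y} = ℬ := by
  ext Y
  rw [mem_filter]
  constructor
  · rintro ⟨hY, hR⟩
    obtain ⟨hYV, hYc⟩ := mem_powersetCard.1 hY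
    obtain ⟨u, v, huv, rfl⟩ := card_eq_two.1 hYc
    rw [insert_subset_iff, singleton_subset_iff] at hYV
    exact (h1 u hYV.1 v hYV.2 huv).1 hR
  · intro hY
    refine ⟨h2 hY, ?_⟩
    obtain ⟨hYV, hYc⟩ := mem_powersetCard.1 (h2 hY)
    obtain ⟨u, v, huv, rfl⟩ := card_eq_two.1 hYc
    rw [insert_subset_iff, singleton_subset_iff] at hYV
    exact (h1 u hYV.1 v hYV.2 huv).2 hY

theorem pair_mem_powersetCard {n k u v : ℕ} (hu : k ≤ u ∧ u ≤ n) (hv : k ≤ v ∧ v ≤ n)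
    (huv : u ≠ v) : {u, v} ∈ (Icc k n).powersetCard 2 := by
  rw [mem_powersetCard, insert_subset_iff, singleton_subset_iff, mem_Icc, mem_Icc]
  exact ⟨⟨hu, hv⟩, card_pair huv⟩

theorem card_image_pair (a m n : ℕ) (h : a < m) :
    ((Icc m n).image fun i => ({a, i} : Finset ℕ)).card = n + 1 - m := by
  rw [card_image_of_injOn, Nat.card_Icc]
  intro x hx y hy hxy
  rw [mem_coe, mem_Icc] at hx hy
  simp only [pair_eq_pair_iff] at hxy
  omega

theorem mem_image_pair {a m n u v : ℕ} :
    ({u, v} : Finset ℕ) ∈ (Icc m n).image (fun i => ({a, i} : Finset ℕ)) ↔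
      (u = a ∧ m ≤ v ∧ v ≤ n) ∨ (v = a ∧ m ≤ u ∧ u ≤ n) := by
  simp only [mem_image, mem_Icc, pair_eq_pair_iff]
  constructor
  · rintro ⟨i, hi, ⟨rfl, rfl⟩ | ⟨rfl, rfl⟩⟩
    · exact Or.inl ⟨rfl, hi⟩
    · exact Or.inr ⟨rfl, hi⟩
  · rintro (⟨rfl, h⟩ | ⟨rfl, h⟩)
    · exact ⟨v, h, by simp⟩
    · exact ⟨u, h, by simp⟩

/-- The covers of the edge are the pairs through `k` or `k + 1`; the second list starts at `k + 2`
so that the edge itself is counted once. -/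
theorem card_famG {n k : ℕ} (hk : 5 ≤ k) (hn : 3 * k < n) :
    (famG n k).card = pairCount n k (k - 3) + ((n - k - 1).choose (k - 4) + 2 * (n - k)) := by
  rw [famG, card_stdFam hk hn (subset_Icc_add (by simp [insert_subset_iff]) (by omega))
    (by rw [card_pair (by omega)]; omega)]
  · rw [filter_powersetCard_two_eq (ℬ := ((Icc (k + 1) n).image fun i => ({k, i} : Finset ℕ)) ∪
      (Icc (k + 2) n).image fun i => ({k + 1, i} : Finset ℕ)), card_union_of_disjoint,
      card_image_pair _ _ _ (by omega), card_image_pair _ _ _ (by omega), card_pair (by omega),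
      card_singleton, show n - k + 1 - 2 = n - k - 1 by omega, show k - 2 - 2 = k - 4 by omega]
    · omega
    · rw [disjoint_left]
      intro Y hY
      rw [mem_image] at hY
      obtain ⟨i, hi, rfl⟩ := hY
      rw [mem_Icc] at hi
      rw [mem_image_pair]
      omega
    · intro u hu v hv huv
      rw [mem_Icc] at hu hv
      rw [mem_union, mem_image_pair, mem_image_pair]
      simp only [mem_insert, mem_singleton, exists_eq_or_imp, exists_eq_left, forall_eq]
      omega
    · intro Y hY
      simp only [mem_union, mem_image, mem_Icc] at hY
      rcases hY with ⟨i, hi, rfl⟩ | ⟨i, hi, rfl⟩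
      · exact pair_mem_powersetCard (by omega) (by omega) (by omega)
      · exact pair_mem_powersetCard (by omega) (by omega) (by omega)
  · intro X hX
    rw [mem_singleton] at hX
    exact ⟨k, by simp, k + 1, by simp, by omega, hX⟩

theorem card_famS₁ {n k : ℕ} (hk : 5 ≤ k) (hn : 3 * k < n) :
    (famS₁ n k).card =
      pairCount n k (k - 3) + ((n - k - 2).choose (k - 5) + (n - k + 3)) := by
  have h2 : ({{k, k + 1}, {k, k + 2}} : Finset (Finset ℕ)).card = 2 := by
    rw [card_pair]
    simp [pair_eq_pair_iff]
  have hℬ : (insert {k + 1, k + 2} ((Icc (k + 1) n).image fun i => ({k, i} : Finset ℕ))).card =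
      n - k + 1 := by
    rw [card_insert_of_notMem, card_image_pair _ _ _ (by omega)]
    · omega
    · rw [mem_image_pair]
      omega
  rw [famS₁_eq (by omega) (by omega),
    card_stdFam hk hn (subset_Icc_add (by simp [insert_subset_iff]) (by omega))
    (by rw [card_three]; omega)]
  · rw [filter_powersetCard_two_eq (ℬ := insert {k + 1, k + 2}
      ((Icc (k + 1) n).image fun i => ({k, i} : Finset ℕ))), hℬ, h2, card_three, show n - k + 1 - 3 = n - k - 2 by omega, show k - 2 - 3 = k - 5 by omega]
    · omega
    · intro u hu v hv huv
      rw [mem_Icc] at hu hv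
      rw [mem_insert, mem_image_pair, pair_eq_pair_iff]
      simp only [mem_insert, mem_singleton, exists_eq_or_imp, exists_eq_left, forall_eq,
        forall_eq_or_imp]
      omega
    · intro Y hY
      simp only [mem_insert, mem_image, mem_Icc] at hY
      rcases hY with rfl | ⟨i, hi, rfl⟩
      · exact pair_mem_powersetCard (by omega) (by omega) (by omega)
      · exact pair_mem_powersetCard (by omega) (by omega) (by omega)
  · intro X hX
    rw [mem_insert, mem_singleton] at hX
    rcases hX with hX | hX
    · exact ⟨k, by simp, k + 1, by simp, by omega, hX⟩
    · exact ⟨k, by simp, k + 2, by simp, by omega, hX⟩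

theorem card_famS {n k : ℕ} (hk : 5 ≤ k) (hn : 3 * k < n) :
    (famS n k).card = pairCount n k (k - 3) + ((n - k - 2).choose (k - 5) + 6) := by
  have h3 : ({{k, k + 1}, {k + 1, k + 2}, {k, k + 2}} : Finset (Finset ℕ)).card = 3 := by
    rw [card_insert_of_notMem, card_pair] <;> simp [pair_eq_pair_iff]
  rw [famS_eq (by omega),
    card_stdFam hk hn (subset_Icc_add (by simp [insert_subset_iff]) (by omega))
    (by rw [card_three]; omega)]
  · rw [filter_powersetCard_two_eq (ℬ := {{k, k + 1}, {k + 1, k + 2}, {k, k + 2}}), h3,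
      card_three, show n - k + 1 - 3 = n - k - 2 by omega, show k - 2 - 3 = k - 5 by omega]
    · intro u hu v hv huv
      rw [mem_Icc] at hu hv
      simp only [mem_insert, mem_singleton, exists_eq_or_imp, exists_eq_left, forall_eq,
        forall_eq_or_imp, pair_eq_pair_iff]
      omega
    · intro Y hY
      simp only [mem_insert, mem_singleton] at hY
      rcases hY with rfl | rfl | rfl <;>
      exact pair_mem_powersetCard (by omega) (by omega) (by omega)
  · intro X hX
    rw [mem_insert, mem_insert, mem_singleton] at hX
    rcases hX with hX | hX | hX
    · exact ⟨k, by simp, k + 1, by simp, by omega, hX⟩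
    · exact ⟨k + 1, by simp, k + 2, by simp, by omega, hX⟩
    · exact ⟨k, by simp, k + 2, by simp, by omega, hX⟩

theorem card_famS₂ {n k : ℕ} (hk : 6 ≤ k) (hn : 3 * k < n) :
    (famS₂ n k).card = pairCount n k (k - 3) + ((n - k - 3).choose (k - 6) + 6) := by
  have h2 : ({{k, k + 2}, {k + 1, k + 3}} : Finset (Finset ℕ)).card = 2 := by
    rw [card_pair]
    simp [pair_eq_pair_iff]
  have h4 : ({{k, k + 1}, {k, k + 3}, {k + 1, k + 2}, {k + 2, k + 3}} :
      Finset (Finset ℕ)).card = 4 := by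
    rw [card_insert_of_notMem, card_insert_of_notMem, card_pair] <;> simp [pair_eq_pair_iff]
  rw [famS₂_eq (by omega) (by omega),
    card_stdFam (by omega) hn (subset_Icc_add (by simp [insert_subset_iff]) (by omega))
    (by rw [card_four]; omega)]
  · rw [filter_powersetCard_two_eq
      (ℬ := {{k, k + 1}, {k, k + 3}, {k + 1, k + 2}, {k + 2, k + 3}}), h2, h4,
      card_four, show n - k + 1 - 4 = n - k - 3 by omega, show k - 2 - 4 = k - 6 by omega]
    · intro u hu v hv huv
      rw [mem_Icc] at hu hv
      simp only [mem_insert, mem_singleton, exists_eq_or_imp, exists_eq_left, forall_eq,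
        forall_eq_or_imp, pair_eq_pair_iff]
      omega
    · intro Y hY
      simp only [mem_insert, mem_singleton] at hY
      rcases hY with rfl | rfl | rfl | rfl <;>
      exact pair_mem_powersetCard (by omega) (by omega) (by omega)
  · intro X hX
    rw [mem_insert, mem_singleton] at hX
    rcases hX with hX | hX
    · exact ⟨k, by simp, k + 2, by simp, by omega, hX⟩
    · exact ⟨k + 1, by simp, k + 3, by simp, by omega, hX⟩

theorem card_famS₃ {n k : ℕ} (hk : 6 ≤ k) (hn : 3 * k < n) :
    (famS₃ n k).card = pairCount n k (k - 3) + ((n - k - 3).choose (k - 6) + 6) := by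
  have h3 : ({{k, k + 1}, {k + 1, k + 2}, {k + 2, k + 3}} : Finset (Finset ℕ)).card = 3 := by
    rw [card_insert_of_notMem, card_pair] <;> simp [pair_eq_pair_iff]
  have h3' : ({{k, k + 2}, {k + 1, k + 2}, {k + 1, k + 3}} : Finset (Finset ℕ)).card = 3 := by
    rw [card_insert_of_notMem, card_pair] <;> simp [pair_eq_pair_iff]
  rw [famS₃_eq (by omega) (by omega),
    card_stdFam (by omega) hn (subset_Icc_add (by simp [insert_subset_iff]) (by omega))
    (by rw [card_four]; omega)]
  · rw [filter_powersetCard_two_eq (ℬ := {{k, k + 2}, {k + 1, k + 2}, {k + 1, k + 3}}), h3, h3',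
      card_four, show n - k + 1 - 4 = n - k - 3 by omega, show k - 2 - 4 = k - 6 by omega]
    · intro u hu v hv huv
      rw [mem_Icc] at hu hv
      simp only [mem_insert, mem_singleton, exists_eq_or_imp, exists_eq_left, forall_eq,
        forall_eq_or_imp, pair_eq_pair_iff]
      omega
    · intro Y hY
      simp only [mem_insert, mem_singleton] at hY
      rcases hY with rfl | rfl | rfl <;>
      exact pair_mem_powersetCard (by omega) (by omega) (by omega)
  · intro X hX
    rw [mem_insert, mem_insert, mem_singleton] at hX
    rcases hX with hX | hX | hX
    · exact ⟨k, by simp, k + 1, by simp, by omega, hX⟩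
    · exact ⟨k + 1, by simp, k + 2, by simp, by omega, hX⟩
    · exact ⟨k + 2, by simp, k + 3, by simp, by omega, hX⟩

theorem famH_isMaximalNontrivial {n k l : ℕ} (hk : 3 ≤ k) (hn : 3 * k < n) (hl : 2 ≤ l)
    (hlk : l + 1 ≤ k) : IsMaximalNontrivial n k 3 (famH n k 3 l) := by
  rw [famH_eq]
  refine hilFam_isMaximalNontrivial hk hn ?_ ?_ (by omega) ?_ ?_ ?_ ?_ ?_
  · rw [mem_Icc]; omega
  · rw [mem_Icc]; omega
  · exact Icc_subset_Icc (by omega) (by omega)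
  · simp
  · simp
  · rw [Nat.card_Icc]; omega
  · rw [Nat.card_Icc]; omega

theorem card_famH {n k l : ℕ} (hk : 3 ≤ k) (hn : 3 * k < n) (hlk : l + 1 ≤ k) :
    (famH n k 3 l).card = pairCount n k l + 2 * (n - 2 - l).choose (k - 1 - l) := by
  have hc : (Icc 3 (l + 2)).card = l := by rw [Nat.card_Icc]; omega
  rw [famH_eq, card_hilFam hk ?_ ?_ (by omega) ?_ ?_ ?_ ?_, hc]
  · rw [mem_Icc]; omega
  · rw [mem_Icc]; omega
  · exact Icc_subset_Icc (by omega) (by omega)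
  · simp
  · simp
  · rwa [hc]

/-! ### Estimates for binomial coefficients -/

/-- The quotient of the two coefficients is `(m - r) / (r + 1)`. -/
theorem mul_choose_le_choose_succ {A m r : ℕ} (h : A * (r + 1) + r ≤ m) :
    A * m.choose r ≤ m.choose (r + 1) := by
  have e := Nat.choose_succ_right_eq m r
  have h1 : A * (r + 1) ≤ m - r := by omega
  have h2 : (A * m.choose r) * (r + 1) ≤ m.choose (r + 1) * (r + 1) := by
    rw [e]
    calc A * m.choose r * (r + 1) = m.choose r * (A * (r + 1)) := by ring
      _ ≤ _ := Nat.mul_le_mul_left _ h1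
  exact Nat.le_of_mul_le_mul_right h2 (Nat.succ_pos r)

theorem choose_le_choose_of_two_mul_le {m r s : ℕ} (hrs : r ≤ s) (hs : 2 * s ≤ m) :
    m.choose r ≤ m.choose s := by
  induction s, hrs using Nat.le_induction with
  | base => exact le_rfl
  | succ s hrs ih =>
    have h := mul_choose_le_choose_succ (A := 1) (m := m) (r := s) (by omega)
    rw [one_mul] at h
    exact (ih (by omega)).trans h

/-- By Pascal's rule each unit added to the upper index at most doubles the coefficient, since its
lower neighbour is no larger. -/
theorem choose_add_le_two_pow_mul {m r : ℕ} (j : ℕ) (h : 2 * r ≤ m) :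
    (m + j).choose r ≤ 2 ^ j * m.choose r := by
  induction j with
  | zero => simp
  | succ j ih =>
    have h1 : (m + j + 1).choose r ≤ 2 * (m + j).choose r := by
      cases r with
      | zero => simp
      | succ r =>
        have h2 := choose_le_choose_of_two_mul_le (m := m + j) (r := r) (s := r + 1)
          (by omega) (by omega)
        rw [Nat.choose_succ_succ]
        simp only [Nat.succ_eq_add_one]
        omega
    calc (m + (j + 1)).choose r ≤ 2 * (m + j).choose r := h1
      _ ≤ 2 * (2 ^ j * m.choose r) := Nat.mul_le_mul_left _ ih
      _ = 2 ^ (j + 1) * m.choose r := by ring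

/-- All later estimates use the threshold `n₁ k 3` only through this bound. -/
theorem two_pow_mul_pow_le_n₁ {k : ℕ} (hk : 5 ≤ k) : 8 * 2 ^ k * k ^ 5 ≤ n₁ k 3 := by
  have h1 : 2 * k ≤ k ^ (k - 3) - 1 := by
    have : k ^ 2 ≤ k ^ (k - 3) := Nat.pow_le_pow_right (by omega) (by omega)
    have h2 : 5 * k ≤ k ^ 2 := by rw [sq]; exact Nat.mul_le_mul_right _ hk
    omega
  have h2 : 2 ^ k * k ^ 5 ≤ (k ^ (k - 3) - 1) ^ k :=
    calc 2 ^ k * k ^ 5 ≤ 2 ^ k * k ^ k :=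
          Nat.mul_le_mul_left _ (Nat.pow_le_pow_right (by omega) hk)
      _ = (2 * k) ^ k := (mul_pow _ _ _).symm
      _ ≤ _ := Nat.pow_le_pow_left h1 k
  have h3 : 2 ^ 2 ≤ (k - 3) ^ 2 := Nat.pow_le_pow_left (by omega) 2
  have h4 : 1 ≤ k.factorial := Nat.factorial_pos k
  calc 8 * 2 ^ k * k ^ 5 = 2 * 2 ^ 2 * (2 ^ k * k ^ 5) * 1 := by ring
    _ ≤ 2 * (k - 3) ^ 2 * (k ^ (k - 3) - 1) ^ k * k.factorial := by gcongr
    _ ≤ n₁ k 3 := by rw [n₁]; omega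

theorem lt_of_n₁_lt {n k : ℕ} (hk : 5 ≤ k) (hn : n₁ k 3 < n) : 100000 + 100 * k < n := by
  have h := two_pow_mul_pow_le_n₁ hk
  have h1 : 2 ^ 5 ≤ 2 ^ k := Nat.pow_le_pow_right (by omega) hk
  have h2 : 5 ^ 4 ≤ k ^ 4 := Nat.pow_le_pow_left hk 4
  have h3 : 8 * 2 ^ 5 * (5 ^ 4 * k) ≤ 8 * 2 ^ k * k ^ 5 := by
    rw [pow_succ k 4]
    gcongr
  omega

/-- Lowering `n - 4` to `n - k - 1` costs a factor of at most `2 ^ k`. Raising the lower index by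
one gains `2 * 2 ^ k * k ^ 4`, and the spare `2` makes the inequality strict. -/
theorem mul_choose_lt_choose {n k : ℕ} (hk : 5 ≤ k) (hn : n₁ k 3 < n) :
    k ^ 4 * (n - 4).choose (k - 4) < (n - k - 1).choose (k - 3) := by
  have h100 := lt_of_n₁_lt hk hn
  have h0 := two_pow_mul_pow_le_n₁ hk
  have h1 : (n - 4).choose (k - 4) ≤ 2 ^ k * (n - k - 1).choose (k - 4) := by
    have := choose_add_le_two_pow_mul (m := n - k - 1) (r := k - 4) (k - 3) (by omega)
    rw [show n - k - 1 + (k - 3) = n - 4 by omega] at this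
    exact this.trans (Nat.mul_le_mul_right _ (Nat.pow_le_pow_right (by omega) (by omega)))
  have h2 : 2 * 2 ^ k * k ^ 4 * (n - k - 1).choose (k - 4) ≤ (n - k - 1).choose (k - 3) := by
    have h3 := mul_choose_le_choose_succ (A := 2 * 2 ^ k * k ^ 4) (m := n - k - 1) (r := k - 4) (by
      have : 2 * 2 ^ k * k ^ 4 * (k - 4 + 1) ≤ 2 * 2 ^ k * k ^ 4 * k :=
        Nat.mul_le_mul_left _ (by omega)
      have e : 8 * 2 ^ k * k ^ 5 = 4 * (2 * 2 ^ k * k ^ 4 * k) := by ring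
      omega)
    rwa [show k - 4 + 1 = k - 3 by omega] at h3
  have h4 : 0 < (n - k - 1).choose (k - 4) := Nat.choose_pos (by omega)
  have h5 : 0 < 2 ^ k * k ^ 4 * (n - k - 1).choose (k - 4) := by positivity
  calc k ^ 4 * (n - 4).choose (k - 4) ≤ k ^ 4 * (2 ^ k * (n - k - 1).choose (k - 4)) :=
        Nat.mul_le_mul_left _ h1
    _ = 2 ^ k * k ^ 4 * (n - k - 1).choose (k - 4) := by ring
    _ < 2 * (2 ^ k * k ^ 4 * (n - k - 1).choose (k - 4)) := by omega
    _ ≤ _ := by rw [← mul_assoc, ← mul_assoc]; exact h2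

/-! ### The numbers `pairCount n k l` -/

theorem pairCount_succ {n k l : ℕ} (hk : 3 ≤ k) (hl : l + 3 ≤ n) :
    pairCount n k (l + 1) = pairCount n k l + (n - 3 - l).choose (k - 3) := by
  have e : (n - 2 - l).choose (k - 2) =
      (n - 3 - l).choose (k - 3) + (n - 3 - l).choose (k - 2) := by
    rw [show n - 2 - l = n - 3 - l + 1 by omega, show k - 2 = k - 3 + 1 by omega,
      Nat.choose_succ_succ]
  have h : (n - 2 - l).choose (k - 2) ≤ (n - 2).choose (k - 2) :=
    Nat.choose_le_choose _ (by omega)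
  rw [pairCount, pairCount, show n - 2 - (l + 1) = n - 3 - l by omega]
  omega

theorem pairCount_mono {n k l l' : ℕ} (h : l ≤ l') : pairCount n k l ≤ pairCount n k l' :=
  Nat.sub_le_sub_left (Nat.choose_le_choose _ (by omega)) _

/-- One further petal outweighs the whole error term; this discards the families with few petals. -/
theorem pairCount_add_lt {n k l : ℕ} (hk : 5 ≤ k) (hn : n₁ k 3 < n) (hl : l + 2 ≤ k) :
    pairCount n k l + k ^ 4 * (n - 4).choose (k - 4) < pairCount n k (l + 1) := by
  have h100 := lt_of_n₁_lt hk hn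
  have h := mul_choose_lt_choose hk hn
  have h1 : (n - k - 1).choose (k - 3) ≤ (n - 3 - l).choose (k - 3) :=
    Nat.choose_le_choose _ (by omega)
  rw [pairCount_succ (by omega) (by omega)]
  omega

/-! ### Comparison of the sizes -/

theorem choose_two_gt {m : ℕ} (h : 1000 ≤ m) : 100 * m ≤ m.choose 2 := by
  have := mul_choose_le_choose_succ (A := 100) (m := m) (r := 1) (by omega)
  rwa [Nat.choose_one_right] at this

/-- Writing sizes as an excess over `pairCount n k (k - 3)` reduces the comparisons to small
binomial coefficients. -/
theorem card_famH_sub_one {n k : ℕ} (hk : 5 ≤ k) (hn : 3 * k < n) :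
    (famH n k 3 (k - 1)).card = pairCount n k (k - 3) +
      ((n - k).choose (k - 3) + (n - k - 1).choose (k - 3) + 2) := by
  rw [card_famH (by omega) hn (by omega), Nat.sub_self, show k - 1 = k - 3 + 1 + 1 by omega,
    pairCount_succ (by omega) (by omega), pairCount_succ (by omega) (by omega),
    show n - 3 - (k - 3) = n - k by omega, show n - 3 - (k - 3 + 1) = n - k - 1 by omega,
    Nat.choose_zero_right]
  omega

theorem card_famH_sub_two {n k : ℕ} (hk : 5 ≤ k) (hn : 3 * k < n) :
    (famH n k 3 (k - 2)).card = pairCount n k (k - 3) +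
      ((n - k).choose (k - 3) + 2 * (n - k)) := by
  rw [card_famH (by omega) hn (by omega), show k - 1 - (k - 2) = 1 by omega,
    Nat.choose_one_right, show n - 2 - (k - 2) = n - k by omega,
    show k - 2 = k - 3 + 1 by omega,
    pairCount_succ (by omega) (by omega), show n - 3 - (k - 3) = n - k by omega]
  omega

theorem card_famH_sub_three {n k : ℕ} (hk : 5 ≤ k) (hn : 3 * k < n) :
    (famH n k 3 (k - 3)).card = pairCount n k (k - 3) + 2 * (n - k + 1).choose 2 := by
  rw [card_famH (by omega) hn (by omega), show k - 1 - (k - 3) = 2 by omega,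
    show n - 2 - (k - 3) = n - k + 1 by omega]

theorem card_famH_sub_two_lt {n k : ℕ} (hk : 5 ≤ k) (hn : n₁ k 3 < n) :
    (famH n k 3 (k - 2)).card < (famH n k 3 (k - 1)).card := by
  have h100 := lt_of_n₁_lt hk hn
  rw [card_famH_sub_two hk (by omega), card_famH_sub_one hk (by omega)]
  have h1 := choose_two_gt (m := n - k - 1) (by omega)
  have h2 := choose_le_choose_of_two_mul_le (m := n - k - 1) (r := 2) (s := k - 3)
    (by omega) (by omega)
  omega

theorem card_famG_lt {n k : ℕ} (hk : 5 ≤ k) (hn : 3 * k < n) :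
    (famG n k).card < (famH n k 3 (k - 2)).card := by
  rw [card_famG hk (by omega), card_famH_sub_two hk (by omega)]
  have e : (n - k).choose (k - 3) =
      (n - k - 1).choose (k - 4) + (n - k - 1).choose (k - 3) := by
    rw [show n - k = n - k - 1 + 1 by omega, show k - 3 = k - 4 + 1 by omega,
      Nat.choose_succ_succ]
    simp
  have h : 0 < (n - k - 1).choose (k - 3) := Nat.choose_pos (by omega)
  omega

theorem card_famS₁_lt {n k : ℕ} (hk : 5 ≤ k) (hn : 3 * k < n) :
    (famS₁ n k).card < (famG n k).card := by
  rw [card_famG hk (by omega), card_famS₁ hk (by omega)]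
  have e : (n - k - 1).choose (k - 4) =
      (n - k - 2).choose (k - 5) + (n - k - 2).choose (k - 4) := by
    rw [show n - k - 1 = n - k - 2 + 1 by omega, show k - 4 = k - 5 + 1 by omega,
      Nat.choose_succ_succ]
  omega

theorem card_famS_lt {n k : ℕ} (hk : 5 ≤ k) (hn : 3 * k < n) :
    (famS n k).card < (famS₁ n k).card := by
  rw [card_famS hk (by omega), card_famS₁ hk (by omega)]
  omega

theorem card_famS₂_lt {n k : ℕ} (hk : 6 ≤ k) (hn : 3 * k < n) :
    (famS₂ n k).card < (famS n k).card := by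
  rw [card_famS (by omega) (by omega), card_famS₂ hk (by omega)]
  have e : (n - k - 2).choose (k - 5) =
      (n - k - 3).choose (k - 6) + (n - k - 3).choose (k - 5) := by
    rw [show n - k - 2 = n - k - 3 + 1 by omega, show k - 5 = k - 6 + 1 by omega,
      Nat.choose_succ_succ]
  have h : 0 < (n - k - 3).choose (k - 5) := Nat.choose_pos (by omega)
  omega

theorem choose_three_gt {m : ℕ} (h : 1000 ≤ m) : 100 * m.choose 2 ≤ m.choose 3 :=
  mul_choose_le_choose_succ (A := 100) (m := m) (r := 2) (by omega)

theorem choose_four_gt {m : ℕ} (h : 1000 ≤ m) : 100 * m.choose 3 ≤ m.choose 4 :=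
  mul_choose_le_choose_succ (A := 100) (m := m) (r := 3) (by omega)

/-- The quadratic terms agree and the linear ones decide. Expanding all coefficients around one `m`
leaves an inequality linear in `m.choose 2` and `m`; the same device serves the other small `k`. -/
theorem card_famH_four_lt_of_five {n : ℕ} (hn : 2000 < n) :
    (famH n 5 3 4).card < (famH n 5 3 2).card := by
  obtain ⟨m, rfl⟩ : ∃ m, n = m + 6 := ⟨n - 6, by omega⟩
  rw [card_famH_sub_one (k := 5) (by omega) (by omega),
    card_famH_sub_three (k := 5) (by omega) (by omega)]
  have h1 := choose_two_gt (m := m) (by omega)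
  simp only [Nat.reduceSub, Nat.reduceAdd, show m + 6 - 5 = m + 1 by omega,
    show m + 1 - 1 = m by omega,
    Nat.choose_succ_succ', Nat.choose_zero_right, zero_add, Nat.choose_one_right]
  omega

theorem card_famH_three_of_six {n : ℕ} (hn : 2000 < n) :
    (famG n 6).card < (famH n 6 3 3).card ∧ (famH n 6 3 3).card < (famH n 6 3 4).card := by
  obtain ⟨m, rfl⟩ : ∃ m, n = m + 7 := ⟨n - 7, by omega⟩
  rw [card_famG (k := 6) (by omega) (by omega), card_famH_sub_two (k := 6) (by omega) (by omega),
    card_famH_sub_three (k := 6) (by omega) (by omega)]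
  have h1 := choose_two_gt (m := m) (by omega)
  have h2 := choose_three_gt (m := m) (by omega)
  simp only [Nat.reduceSub, Nat.reduceAdd, show m + 7 - 6 = m + 1 by omega,
    show m + 1 - 1 = m by omega,
    Nat.choose_succ_succ', Nat.choose_zero_right, zero_add, Nat.choose_one_right]
  omega

/-- Over `pairCount n 6 3`, both `H(6, 3, 2)` and `H(6, 3, 4)` have excess about `n ^ 3 / 6`, and
the quadratic terms decide; that of `H(6, 3, 5)` is about `n ^ 3 / 3`. -/
theorem card_famH_two_of_six {n : ℕ} (hn : 2000 < n) :
    (famH n 6 3 4).card < (famH n 6 3 2).card ∧ (famH n 6 3 2).card < (famH n 6 3 5).card := by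
  obtain ⟨m, rfl⟩ : ∃ m, n = m + 7 := ⟨n - 7, by omega⟩
  rw [card_famH_sub_two (k := 6) (by omega) (by omega),
    card_famH_sub_one (k := 6) (by omega) (by omega), card_famH (by omega) (by omega) (by omega)]
  have e := pairCount_succ (n := m + 7) (k := 6) (l := 2) (by omega) (by omega)
  have h1 := choose_two_gt (m := m) (by omega)
  have h2 := choose_three_gt (m := m) (by omega)
  simp only [Nat.reduceSub, Nat.reduceAdd, show m + 7 - 6 = m + 1 by omega,
    show m + 1 - 1 = m by omega, show m + 7 - 2 - 2 = m + 3 by omega,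
    show m + 7 - 3 - 2 = m + 2 by omega,
    Nat.choose_succ_succ', Nat.choose_zero_right, zero_add, Nat.choose_one_right] at e ⊢
  omega

theorem card_famH_four_of_seven {n : ℕ} (hn : 2000 < n) :
    (famS₁ n 7).card < (famH n 7 3 4).card ∧ (famH n 7 3 4).card < (famG n 7).card := by
  obtain ⟨m, rfl⟩ : ∃ m, n = m + 9 := ⟨n - 9, by omega⟩
  rw [card_famG (k := 7) (by omega) (by omega), card_famS₁ (k := 7) (by omega) (by omega),
    card_famH_sub_three (k := 7) (by omega) (by omega)]
  have h1 := choose_two_gt (m := m) (by omega)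
  have h2 := choose_three_gt (m := m) (by omega)
  simp only [Nat.reduceSub, Nat.reduceAdd, show m + 9 - 7 = m + 2 by omega,
    show m + 2 - 1 = m + 1 by omega, show m + 2 - 2 = m by omega,
    Nat.choose_succ_succ', Nat.choose_zero_right, zero_add, Nat.choose_one_right]
  omega

/-- Over `pairCount n 7 4` the quartic terms of `H(7, 3, 2)` cancel, leaving about `n ^ 3 / 2`
against about `n ^ 3 / 6` for `famG`; `H(7, 3, 5)` has a quartic excess. -/
theorem card_famH_two_of_seven {n : ℕ} (hn : 2000 < n) :
    (famG n 7).card < (famH n 7 3 2).card ∧ (famH n 7 3 2).card < (famH n 7 3 5).card := by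
  obtain ⟨m, rfl⟩ : ∃ m, n = m + 8 := ⟨n - 8, by omega⟩
  rw [card_famG (k := 7) (by omega) (by omega), card_famH_sub_two (k := 7) (by omega) (by omega),
    card_famH (by omega) (by omega) (by omega)]
  have e := pairCount_succ (n := m + 8) (k := 7) (l := 2) (by omega) (by omega)
  have e' := pairCount_succ (n := m + 8) (k := 7) (l := 3) (by omega) (by omega)
  have h1 := choose_two_gt (m := m) (by omega)
  have h2 := choose_three_gt (m := m) (by omega)
  have h3 := choose_four_gt (m := m) (by omega)
  simp only [Nat.reduceSub, Nat.reduceAdd, show m + 8 - 7 = m + 1 by omega,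
    show m + 1 - 1 = m by omega, show m + 8 - 2 - 2 = m + 4 by omega,
    show m + 8 - 3 - 2 = m + 3 by omega, show m + 8 - 3 - 3 = m + 2 by omega,
    Nat.choose_succ_succ', Nat.choose_zero_right, zero_add, Nat.choose_one_right] at e e' ⊢
  omega

/-- For `k ≥ 8` the family attached to a four-element set is small. -/
theorem card_famH_two_lt {n k : ℕ} (hk : 8 ≤ k) (hn : n₁ k 3 < n) :
    (famH n k 3 2).card < pairCount n k (k - 3) := by
  have h100 := lt_of_n₁_lt (by omega) hn
  have h := mul_choose_lt_choose (by omega) hn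
  have hk4 : 8 ^ 4 ≤ k ^ 4 := Nat.pow_le_pow_left hk 4
  have h8 : 8 ^ 4 * (n - 4).choose (k - 4) ≤ k ^ 4 * (n - 4).choose (k - 4) :=
    Nat.mul_le_mul_right _ hk4
  have e1 := pairCount_succ (n := n) (k := k) (l := 2) (by omega) (by omega)
  have e2 := pairCount_succ (n := n) (k := k) (l := 3) (by omega) (by omega)
  have e3 := pairCount_succ (n := n) (k := k) (l := 4) (by omega) (by omega)
  have h5 : pairCount n k 5 ≤ pairCount n k (k - 3) := pairCount_mono (by omega)
  -- Going from two petals to five adds three coefficients with lower index `k - 3`, against the two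
  -- that count the sets missing a kernel point. Pascal's rule brings all of them to upper index `n
  -- - 7`, at the cost of a few terms bounded by `(n - 4).choose (k - 4)`.
  have f : ∀ i, 4 ≤ i → i ≤ n - 1 → (n - i).choose (k - 3) =
      (n - (i + 1)).choose (k - 4) + (n - (i + 1)).choose (k - 3) ∧
      (n - (i + 1)).choose (k - 4) ≤ (n - 4).choose (k - 4) := by
    intro i h4 hi
    constructor
    · rw [show n - i = n - (i + 1) + 1 by omega, show k - 3 = k - 4 + 1 by omega,
        Nat.choose_succ_succ']
    · exact Nat.choose_le_choose _ (by omega)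
  have f4 := f 4 (by omega) (by omega)
  have f5 := f 5 (by omega) (by omega)
  have f6 := f 6 (by omega) (by omega)
  have h9 : (n - k - 1).choose (k - 3) ≤ (n - 7).choose (k - 3) :=
    Nat.choose_le_choose _ (by omega)
  rw [card_famH (by omega) (by omega) (by omega), show n - 2 - 2 = n - 4 by omega,
    show k - 1 - 2 = k - 3 by omega]
  simp only [Nat.reduceAdd, Nat.sub_sub] at *
  omega

/-- The excess of `H(8, 3, 5)`, about `n ^ 2`, lies between about `n ^ 2 / 2` for `famS₂` and the
cubic excess of `famS`. -/
theorem card_famH_five_of_eight {n : ℕ} (hn : 2000 < n) :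
    (famS₂ n 8).card < (famH n 8 3 5).card ∧ (famH n 8 3 5).card < (famS n 8).card := by
  obtain ⟨m, rfl⟩ : ∃ m, n = m + 11 := ⟨n - 11, by omega⟩
  rw [card_famS₂ (k := 8) (by omega) (by omega), card_famS (k := 8) (by omega) (by omega),
    card_famH_sub_three (k := 8) (by omega) (by omega)]
  have h1 := choose_two_gt (m := m) (by omega)
  have h2 := choose_three_gt (m := m) (by omega)
  simp only [Nat.reduceSub, Nat.reduceAdd, show m + 11 - 8 = m + 3 by omega,
    show m + 3 - 2 = m + 1 by omega, show m + 3 - 3 = m by omega,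
    Nat.choose_succ_succ', Nat.choose_zero_right, zero_add, Nat.choose_one_right]
  omega

/-- From `k = 9` on the excess of `famS₂` is at least cubic. -/
theorem card_famH_sub_three_lt {n k : ℕ} (hk : 9 ≤ k) (hn : n₁ k 3 < n) :
    (famH n k 3 (k - 3)).card < (famS₂ n k).card := by
  have h100 := lt_of_n₁_lt (by omega) hn
  rw [card_famS₂ (by omega) (by omega), card_famH_sub_three (by omega) (by omega)]
  obtain ⟨m, hm⟩ : ∃ m, n - k = m + 3 := ⟨n - k - 3, by omega⟩
  have h1 := choose_two_gt (m := m) (by omega)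
  have h2 := choose_three_gt (m := m) (by omega)
  have h3 := choose_le_choose_of_two_mul_le (m := m) (r := 3) (s := k - 6)
    (by omega) (by omega)
  rw [hm, show m + 3 - 3 = m by omega]
  have e : (m + 3 + 1).choose 2 = m.choose 2 + 4 * m + 6 := by
    simp only [Nat.choose_succ_succ', Nat.choose_zero_right, zero_add, Nat.choose_one_right,
      Nat.reduceAdd]
    omega
  omega

/-! ### The large maximal families and their ranks -/

/-- Every maximal family that is not too small is isomorphic to one of the explicit ones. -/
theorem IsMaximalNontrivial.classification {n k : ℕ} {𝓕 : Finset (Finset ℕ)}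
    (h : IsMaximalNontrivial n k 3 𝓕) (hk : 5 ≤ k) (hn : n₁ k 3 < n) :
    𝓕.card < pairCount n k (k - 3) ∨ Isomorphic n 𝓕 (famH n k 3 (k - 1)) ∨
    Isomorphic n 𝓕 (famH n k 3 (k - 2)) ∨ Isomorphic n 𝓕 (famH n k 3 (k - 3)) ∨
    Isomorphic n 𝓕 (famH n k 3 2) ∨ Isomorphic n 𝓕 (famG n k) ∨ Isomorphic n 𝓕 (famS₁ n k) ∨
    Isomorphic n 𝓕 (famS n k) ∨
    6 ≤ k ∧ (Isomorphic n 𝓕 (famS₂ n k) ∨ Isomorphic n 𝓕 (famS₃ n k)) := by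
  have h100 := lt_of_n₁_lt hk hn
  rcases h.four_set_or_isStarAt (by omega) (by omega) with ⟨Q, hQn, hQ, hQF⟩ | ⟨p, q, L, hs, hc⟩
  · obtain ⟨p, hp, q, hq, L, hL, hpq, hpL, hqL, hl, rfl⟩ := h.eq_hilFam_of_four_set hQn hQ hQF
    have := hilFam_isomorphic (k := k) hp hq hpq hL hpL hqL hl (by omega)
    simp only [this, true_or, or_true]
  have hlt := hs.card_lt (by omega) (by omega)
  have hH : 𝓕 = hilFam n k p q L → Isomorphic n 𝓕 (famH n k 3 L.card) := by
    rintro rfl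
    exact hilFam_isomorphic hs.hp hs.hq hs.hpq hs.subset hs.hpL hs.hqL rfl (by omega)
  rcases (by omega : L.card + 4 ≤ k ∨ L.card + 3 = k ∨ L.card = k - 2 ∨ L.card = k - 1)
    with hl | hl | hl | hl
  · left
    calc 𝓕.card ≤ _ := hc
      _ < pairCount n k (L.card + 1) := pairCount_add_lt hk hn (by omega)
      _ ≤ _ := pairCount_mono (by omega)
  · rcases hs.eq_hilFam_or_eq_starFam (by omega) (by omega) hl with
      h1 | ⟨M, 𝒜, hA, hM, hpM, hqM, hLM, hMk, h1 | h1⟩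
    · have := hH h1
      rw [show L.card = k - 3 by omega] at this
      simp only [this, true_or, or_true]
    · have := hA.isomorphic (by omega) (by omega) hs.hp hs.hq hs.hpq hs.subset hs.hpL hs.hqL hl
        hM hpM hqM hLM hMk
      rw [← h1] at this
      simp only [this, or_true]
    -- The edges of `𝒜` may belong to the members missing `p`; exchanging the kernel points leads to
    -- the same standard families.
    · have := hA.isomorphic (by omega) (by omega) hs.hq hs.hp hs.hpq.symm hs.subset hs.hqL hs.hpL
        hl hM hqM hpM hLM hMk
      rw [← h1] at this
      simp only [this, or_true]
  · have := hH (hs.eq_hilFam_of_le_card (by omega) (by omega) (by omega))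
    rw [hl] at this
    simp only [this, true_or, or_true]
  · have := hH (hs.eq_hilFam_of_le_card (by omega) (by omega) (by omega))
    rw [hl] at this
    simp only [this, true_or, or_true]

/-- If `T` is the set of the sizes above `s`, then the families of rank `#T + 1` are those of
size `s`. -/
theorem isNthLargest_iff_card_eq {n k d s r : ℕ} {T : Finset ℕ} (hT : T.card + 1 = r)
    (hT₁ : ∀ t ∈ T, s < t) (hT₂ : ∀ t ∈ T, ∃ 𝓖, IsMaximalNontrivial n k d 𝓖 ∧ 𝓖.card = t)
    (hT₃ : ∀ 𝓖, IsMaximalNontrivial n k d 𝓖 → s < 𝓖.card → 𝓖.card ∈ T)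
    (hs : ∃ 𝓖, IsMaximalNontrivial n k d 𝓖 ∧ 𝓖.card = s) (𝓕 : Finset (Finset ℕ)) :
    IsNthLargest n k d r 𝓕 ↔ IsMaximalNontrivial n k d 𝓕 ∧ 𝓕.card = s := by
  subst hT
  refine and_congr_right fun h𝓕 => ?_
  set A := {m : ℕ | 𝓕.card < m ∧ ∃ 𝓖, IsMaximalNontrivial n k d 𝓖 ∧ 𝓖.card = m} with hA
  have hcount : A.encard + 1 = ((T.card + 1 : ℕ) : ℕ∞) ↔ A.encard = T.card := by
    push_cast
    exact ENat.add_left_injective_of_ne_top (by simp) |>.eq_iff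
  rw [hcount]
  constructor
  · intro h
    -- A family smaller than `s` has the extra larger size `s` above it; for one larger than `s`,
    -- its own size drops out of `T`.
    rcases lt_trichotomy 𝓕.card s with hlt | heq | hgt
    · have hsub : ((insert s T : Finset ℕ) : Set ℕ) ⊆ A := by
        intro t ht
        rw [mem_coe, mem_insert] at ht
        rcases ht with rfl | ht
        · exact ⟨hlt, hs⟩
        · exact ⟨hlt.trans (hT₁ t ht), hT₂ t ht⟩
      have h1 := Set.encard_le_encard hsub
      rw [h, Set.encard_coe_eq_coe_finsetCard,
        card_insert_of_notMem fun hsT => (hT₁ s hsT).ne rfl] at h1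
      norm_cast at h1
      omega
    · exact heq
    · have hsub : A ⊆ ((T.erase 𝓕.card : Finset ℕ) : Set ℕ) := by
        rintro t ⟨ht, 𝓖, h𝓖, rfl⟩
        exact mem_coe.2 (mem_erase.2 ⟨ht.ne', hT₃ 𝓖 h𝓖 (hgt.trans ht)⟩)
      have h1 := Set.encard_le_encard hsub
      have h2 := hT₃ 𝓕 h𝓕 hgt
      rw [h, Set.encard_coe_eq_coe_finsetCard, card_erase_of_mem h2] at h1
      norm_cast at h1
      have := card_pos.2 ⟨_, h2⟩
      omega
  · intro h
    have hAT : A = (T : Set ℕ) := by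
      ext t
      rw [mem_coe]
      constructor
      · rintro ⟨ht, 𝓖, h𝓖, rfl⟩
        exact hT₃ 𝓖 h𝓖 (h ▸ ht)
      · exact fun ht => ⟨h ▸ hT₁ t ht, hT₂ t ht⟩
    rw [hAT, Set.encard_coe_eq_coe_finsetCard]

/-- The case of five maximal families of different sizes. -/
theorem isNthLargest_six_iff {n k d : ℕ} {𝓢 𝓖₁ 𝓖₂ 𝓖₃ 𝓖₄ 𝓖₅ : Finset (Finset ℕ)}
    (h : IsMaximalNontrivial n k d 𝓢) (h₁ : IsMaximalNontrivial n k d 𝓖₁)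
    (h₂ : IsMaximalNontrivial n k d 𝓖₂) (h₃ : IsMaximalNontrivial n k d 𝓖₃)
    (h₄ : IsMaximalNontrivial n k d 𝓖₄) (h₅ : IsMaximalNontrivial n k d 𝓖₅)
    (h₁₂ : 𝓖₂.card < 𝓖₁.card) (h₂₃ : 𝓖₃.card < 𝓖₂.card) (h₃₄ : 𝓖₄.card < 𝓖₃.card)
    (h₄₅ : 𝓖₅.card < 𝓖₄.card) (h₅₆ : 𝓢.card < 𝓖₅.card)
    (hc : ∀ 𝓖, IsMaximalNontrivial n k d 𝓖 → 𝓢.card < 𝓖.card → 𝓖.card = 𝓖₁.card ∨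
      𝓖.card = 𝓖₂.card ∨ 𝓖.card = 𝓖₃.card ∨ 𝓖.card = 𝓖₄.card ∨ 𝓖.card = 𝓖₅.card)
    (𝓕 : Finset (Finset ℕ)) :
    IsNthLargest n k d 6 𝓕 ↔ IsMaximalNontrivial n k d 𝓕 ∧ 𝓕.card = 𝓢.card := by
  refine isNthLargest_iff_card_eq (T := {𝓖₁.card, 𝓖₂.card, 𝓖₃.card, 𝓖₄.card, 𝓖₅.card})
    ?_ ?_ ?_ ?_ ⟨𝓢, h, rfl⟩ 𝓕
  · rw [card_insert_of_notMem, card_insert_of_notMem, card_insert_of_notMem, card_pair h₄₅.ne']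
    all_goals simp only [mem_insert, mem_singleton]; omega
  · intro t ht
    simp only [mem_insert, mem_singleton] at ht
    omega
  · intro t ht
    simp only [mem_insert, mem_singleton] at ht
    rcases ht with rfl | rfl | rfl | rfl | rfl
    exacts [⟨_, h₁, rfl⟩, ⟨_, h₂, rfl⟩, ⟨_, h₃, rfl⟩, ⟨_, h₄, rfl⟩, ⟨_, h₅, rfl⟩]
  · intro 𝓖 h𝓖 hlt
    simpa only [mem_insert, mem_singleton] using hc 𝓖 h𝓖 hlt

theorem pairCount_le_card_famS {n k : ℕ} (hk : 5 ≤ k) (hn : 3 * k < n) :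
    pairCount n k (k - 3) ≤ (famS n k).card := by
  rw [card_famS hk hn]
  omega

theorem pairCount_le_card_famS₂ {n k : ℕ} (hk : 6 ≤ k) (hn : 3 * k < n) :
    pairCount n k (k - 3) ≤ (famS₂ n k).card := by
  rw [card_famS₂ hk hn]
  omega

theorem card_famS₃_eq {n k : ℕ} (hk : 6 ≤ k) (hn : 3 * k < n) :
    (famS₃ n k).card = (famS₂ n k).card := by
  rw [card_famS₂ hk hn, card_famS₃ hk hn]

/-- The dichotomy behind each case of the ranking: a maximal family is isomorphic to one of the
explicit families, whose sizes are then compared. -/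
theorem IsMaximalNontrivial.card_cases {n k : ℕ} {𝓕 : Finset (Finset ℕ)}
    (h : IsMaximalNontrivial n k 3 𝓕) (hk : 5 ≤ k) (hn : n₁ k 3 < n) :
    𝓕.card < pairCount n k (k - 3) ∨ 𝓕.card = (famH n k 3 (k - 1)).card ∨
    𝓕.card = (famH n k 3 (k - 2)).card ∨
    (𝓕.card = (famH n k 3 (k - 3)).card ∧ Isomorphic n 𝓕 (famH n k 3 (k - 3))) ∨
    𝓕.card = (famH n k 3 2).card ∨ 𝓕.card = (famG n k).card ∨
    (𝓕.card = (famS₁ n k).card ∧ Isomorphic n 𝓕 (famS₁ n k)) ∨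
    (𝓕.card = (famS n k).card ∧ Isomorphic n 𝓕 (famS n k)) ∨
    6 ≤ k ∧ 𝓕.card = (famS₂ n k).card ∧
      (Isomorphic n 𝓕 (famS₂ n k) ∨ Isomorphic n 𝓕 (famS₃ n k)) := by
  have h100 := lt_of_n₁_lt hk hn
  rcases h.classification hk hn with h | h | h | h | h | h | h | h | ⟨hk6, h | h⟩
  · exact Or.inl h
  all_goals have e := h.card_eq
  -- The ninth goal belongs to `famS₃`, whose size is that of `famS₂`. Closing the eighth goal moves
  -- it into eighth place.
  on_goal 9 => rw [card_famS₃_eq hk6 (by omega)] at e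
  on_goal 8 => simp only [e, h, hk6, true_and, true_or, or_true]
  on_goal 8 => simp only [e, h, hk6, true_and, or_true]
  all_goals simp only [e, h, true_and, true_or, or_true]

/-- Here `2 = k - 3`, so two of the families in the classification coincide; the petal numbers `2,
4, 3` come first, then `famG` and `famS₁`. -/
theorem isNthLargest_six_of_five {n : ℕ} (hn : n₁ 5 3 < n) (𝓕 : Finset (Finset ℕ)) :
    IsNthLargest n 5 3 6 𝓕 ↔ IsMaximalNontrivial n 5 3 𝓕 ∧ 𝓕.card = (famS n 5).card := by
  have h100 := lt_of_n₁_lt (by omega) hn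
  have h1 := card_famH_sub_two_lt (by omega) hn
  have h2 := card_famH_four_lt_of_five (n := n) (by omega)
  have h3 := card_famG_lt (n := n) (k := 5) (by omega) (by omega)
  have h4 := card_famS₁_lt (n := n) (k := 5) (by omega) (by omega)
  have h5 := card_famS_lt (n := n) (k := 5) (by omega) (by omega)
  refine isNthLargest_six_iff (famS_isMaximalNontrivial (by omega) (by omega))
    (famH_isMaximalNontrivial (l := 2) (by omega) (by omega) (by omega) (by omega))
    (famH_isMaximalNontrivial (l := 4) (by omega) (by omega) (by omega) (by omega))
    (famH_isMaximalNontrivial (l := 3) (by omega) (by omega) (by omega) (by omega))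
    (famG_isMaximalNontrivial (by omega) (by omega))
    (famS₁_isMaximalNontrivial (by omega) (by omega))
    h2 h1 h3 h4 h5 (fun 𝓖 h𝓖 hlt => ?_) 𝓕
  have h6 := pairCount_le_card_famS (n := n) (k := 5) (by omega) (by omega)
  have := h𝓖.card_cases (by omega) hn
  simp only [Nat.reduceSub] at *
  omega

theorem isNthLargest_six_of_six {n : ℕ} (hn : n₁ 6 3 < n) (𝓕 : Finset (Finset ℕ)) :
    IsNthLargest n 6 3 6 𝓕 ↔ IsMaximalNontrivial n 6 3 𝓕 ∧ 𝓕.card = (famS₁ n 6).card := by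
  have h100 := lt_of_n₁_lt (by omega) hn
  have h2 := card_famH_two_of_six (n := n) (by omega)
  have h3 := card_famH_three_of_six (n := n) (by omega)
  have h5 := card_famS₁_lt (n := n) (k := 6) (by omega) (by omega)
  refine isNthLargest_six_iff (famS₁_isMaximalNontrivial (by omega) (by omega))
    (famH_isMaximalNontrivial (l := 5) (by omega) (by omega) (by omega) (by omega))
    (famH_isMaximalNontrivial (l := 2) (by omega) (by omega) (by omega) (by omega))
    (famH_isMaximalNontrivial (l := 4) (by omega) (by omega) (by omega) (by omega))
    (famH_isMaximalNontrivial (l := 3) (by omega) (by omega) (by omega) (by omega))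
    (famG_isMaximalNontrivial (by omega) (by omega))
    h2.2 h2.1 h3.2 h3.1 h5 (fun 𝓖 h𝓖 hlt => ?_) 𝓕
  have h6 := pairCount_le_card_famS (n := n) (k := 6) (by omega) (by omega)
  have h7 := card_famS_lt (n := n) (k := 6) (by omega) (by omega)
  have h8 := card_famS₂_lt (n := n) (k := 6) (by omega) (by omega)
  have := h𝓖.card_cases (by omega) hn
  simp only [Nat.reduceSub] at *
  omega

/-- The excess of `H(7, 3, 4)`, about `n ^ 2`, is now below the cubic one of `famG` but still above
about `n ^ 2 / 2` for `famS₁`. -/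
theorem isNthLargest_six_of_seven {n : ℕ} (hn : n₁ 7 3 < n) (𝓕 : Finset (Finset ℕ)) :
    IsNthLargest n 7 3 6 𝓕 ↔ IsMaximalNontrivial n 7 3 𝓕 ∧ 𝓕.card = (famS₁ n 7).card := by
  have h100 := lt_of_n₁_lt (by omega) hn
  have h1 := card_famH_sub_two_lt (by omega) hn
  have h2 := card_famH_two_of_seven (n := n) (by omega)
  have h3 := card_famH_four_of_seven (n := n) (by omega)
  refine isNthLargest_six_iff (famS₁_isMaximalNontrivial (by omega) (by omega))
    (famH_isMaximalNontrivial (l := 6) (by omega) (by omega) (by omega) (by omega))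
    (famH_isMaximalNontrivial (l := 5) (by omega) (by omega) (by omega) (by omega))
    (famH_isMaximalNontrivial (l := 2) (by omega) (by omega) (by omega) (by omega))
    (famG_isMaximalNontrivial (by omega) (by omega))
    (famH_isMaximalNontrivial (l := 4) (by omega) (by omega) (by omega) (by omega))
    h1 h2.2 h2.1 h3.2 h3.1 (fun 𝓖 h𝓖 hlt => ?_) 𝓕
  have h6 := pairCount_le_card_famS (n := n) (k := 7) (by omega) (by omega)
  have h7 := card_famS_lt (n := n) (k := 7) (by omega) (by omega)
  have h8 := card_famS₂_lt (n := n) (k := 7) (by omega) (by omega)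
  have := h𝓖.card_cases (by omega) hn
  simp only [Nat.reduceSub] at *
  omega

theorem isNthLargest_six_of_eight {n : ℕ} (hn : n₁ 8 3 < n) (𝓕 : Finset (Finset ℕ)) :
    IsNthLargest n 8 3 6 𝓕 ↔ IsMaximalNontrivial n 8 3 𝓕 ∧ 𝓕.card = (famH n 8 3 5).card := by
  have h100 := lt_of_n₁_lt (by omega) hn
  have h1 := card_famH_sub_two_lt (by omega) hn
  have h2 := card_famG_lt (n := n) (k := 8) (by omega) (by omega)
  have h3 := card_famS₁_lt (n := n) (k := 8) (by omega) (by omega)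
  have h4 := card_famS_lt (n := n) (k := 8) (by omega) (by omega)
  have h5 := card_famH_five_of_eight (n := n) (by omega)
  refine isNthLargest_six_iff
    (famH_isMaximalNontrivial (l := 5) (by omega) (by omega) (by omega) (by omega))
    (famH_isMaximalNontrivial (l := 7) (by omega) (by omega) (by omega) (by omega))
    (famH_isMaximalNontrivial (l := 6) (by omega) (by omega) (by omega) (by omega))
    (famG_isMaximalNontrivial (by omega) (by omega))
    (famS₁_isMaximalNontrivial (by omega) (by omega))
    (famS_isMaximalNontrivial (by omega) (by omega))
    h1 h2 h3 h4 h5.2 (fun 𝓖 h𝓖 hlt => ?_) 𝓕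
  have h6 := pairCount_le_card_famS₂ (n := n) (k := 8) (by omega) (by omega)
  have h7 := card_famH_two_lt (by omega) hn
  have := h𝓖.card_cases (by omega) hn
  simp only [Nat.reduceSub] at *
  omega

theorem isNthLargest_six_of_nine_le {n k : ℕ} (hk : 9 ≤ k) (hn : n₁ k 3 < n)
    (𝓕 : Finset (Finset ℕ)) :
    IsNthLargest n k 3 6 𝓕 ↔ IsMaximalNontrivial n k 3 𝓕 ∧ 𝓕.card = (famS₂ n k).card := by
  have h100 := lt_of_n₁_lt (by omega) hn
  have h1 := card_famH_sub_two_lt (by omega) hn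
  have h2 := card_famG_lt (n := n) (k := k) (by omega) (by omega)
  have h3 := card_famS₁_lt (n := n) (k := k) (by omega) (by omega)
  have h4 := card_famS_lt (n := n) (k := k) (by omega) (by omega)
  have h5 := card_famS₂_lt (n := n) (k := k) (by omega) (by omega)
  refine isNthLargest_six_iff (famS₂_isMaximalNontrivial (by omega) (by omega))
    (famH_isMaximalNontrivial (l := k - 1) (by omega) (by omega) (by omega) (by omega))
    (famH_isMaximalNontrivial (l := k - 2) (by omega) (by omega) (by omega) (by omega))
    (famG_isMaximalNontrivial (by omega) (by omega))
    (famS₁_isMaximalNontrivial (by omega) (by omega))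
    (famS_isMaximalNontrivial (by omega) (by omega))
    h1 h2 h3 h4 h5 (fun 𝓖 h𝓖 hlt => ?_) 𝓕
  have h6 := pairCount_le_card_famS₂ (n := n) (k := k) (by omega) (by omega)
  have h7 := card_famH_two_lt (by omega) hn
  have h8 := card_famH_sub_three_lt hk hn
  have := h𝓖.card_cases (by omega) hn
  omega

end DWise

theorem mainTheorem7 (n k : ℕ) (hk : 5 ≤ k) (hn : DWise.n₁ k 3 < n) :
    (∃ 𝓕 : Finset (Finset ℕ), DWise.IsNthLargest n k 3 6 𝓕) ∧
    ∀ 𝓕 : Finset (Finset ℕ), DWise.IsNthLargest n k 3 6 𝓕 →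
      (k = 5 → DWise.Isomorphic n 𝓕 (DWise.famS n 5)) ∧
      (k = 6 ∨ k = 7 → DWise.Isomorphic n 𝓕 (DWise.famS₁ n k)) ∧
      (k = 8 → DWise.Isomorphic n 𝓕 (DWise.famH n 8 3 5)) ∧
      (9 ≤ k → DWise.Isomorphic n 𝓕 (DWise.famS₂ n k) ∨
        DWise.Isomorphic n 𝓕 (DWise.famS₃ n k)) := by
  have h100 := DWise.lt_of_n₁_lt hk hn
  have g0 := DWise.card_famH_sub_two_lt hk hn
  have g1 := DWise.card_famG_lt (n := n) (k := k) (by omega) (by omega)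
  have g2 := DWise.card_famS₁_lt (n := n) (k := k) (by omega) (by omega)
  have g3 := DWise.card_famS_lt (n := n) (k := k) (by omega) (by omega)
  have g4 := DWise.pairCount_le_card_famS (n := n) (k := k) (by omega) (by omega)
  rcases (by omega : k = 5 ∨ k = 6 ∨ k = 7 ∨ k = 8 ∨ 9 ≤ k) with rfl | rfl | rfl | rfl | hk9
  · refine ⟨⟨_, (DWise.isNthLargest_six_of_five hn _).2
      ⟨DWise.famS_isMaximalNontrivial (by omega) (by omega), rfl⟩⟩, fun 𝓕 h𝓕 => ?_⟩
    obtain ⟨h, hc⟩ := (DWise.isNthLargest_six_of_five hn _).1 h𝓕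
    have h1 := DWise.card_famH_four_lt_of_five (n := n) (by omega)
    have := h.card_cases (by omega) hn
    simp only [Nat.reduceSub] at *
    refine ⟨fun _ => ?_, by omega, by omega, by omega⟩
    -- Without the isomorphism, the size of `𝓕` would be that of another listed family or below
    -- `pairCount`, and all of these differ from the sixth size.
    by_contra hnot
    simp only [hnot, and_false, false_or] at this
    omega
  · refine ⟨⟨_, (DWise.isNthLargest_six_of_six hn _).2
      ⟨DWise.famS₁_isMaximalNontrivial (by omega) (by omega), rfl⟩⟩, fun 𝓕 h𝓕 => ?_⟩
    obtain ⟨h, hc⟩ := (DWise.isNthLargest_six_of_six hn _).1 h𝓕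
    have h1 := DWise.card_famH_two_of_six (n := n) (by omega)
    have h2 := DWise.card_famH_three_of_six (n := n) (by omega)
    have h3 := DWise.card_famS₂_lt (n := n) (k := 6) (by omega) (by omega)
    have := h.card_cases (by omega) hn
    simp only [Nat.reduceSub] at *
    refine ⟨by omega, fun _ => ?_, by omega, by omega⟩
    by_contra hnot
    simp only [hnot, and_false, false_or] at this
    omega
  · refine ⟨⟨_, (DWise.isNthLargest_six_of_seven hn _).2
      ⟨DWise.famS₁_isMaximalNontrivial (by omega) (by omega), rfl⟩⟩, fun 𝓕 h𝓕 => ?_⟩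
    obtain ⟨h, hc⟩ := (DWise.isNthLargest_six_of_seven hn _).1 h𝓕
    have h1 := DWise.card_famH_two_of_seven (n := n) (by omega)
    have h2 := DWise.card_famH_four_of_seven (n := n) (by omega)
    have h3 := DWise.card_famS₂_lt (n := n) (k := 7) (by omega) (by omega)
    have := h.card_cases (by omega) hn
    simp only [Nat.reduceSub] at *
    refine ⟨by omega, fun _ => ?_, by omega, by omega⟩
    by_contra hnot
    simp only [hnot, and_false, false_or] at this
    omega
  · refine ⟨⟨_, (DWise.isNthLargest_six_of_eight hn _).2
      ⟨DWise.famH_isMaximalNontrivial (by omega) (by omega) (by omega) (by omega), rfl⟩⟩,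
      fun 𝓕 h𝓕 => ?_⟩
    obtain ⟨h, hc⟩ := (DWise.isNthLargest_six_of_eight hn _).1 h𝓕
    have h1 := DWise.card_famH_two_lt (by omega) hn
    have h2 := DWise.card_famH_five_of_eight (n := n) (by omega)
    have h3 := DWise.pairCount_le_card_famS₂ (n := n) (k := 8) (by omega) (by omega)
    have := h.card_cases (by omega) hn
    simp only [Nat.reduceSub] at *
    refine ⟨by omega, by omega, fun _ => ?_, by omega⟩
    by_contra hnot
    simp only [hnot, and_false, false_or] at this
    omega
  · refine ⟨⟨_, (DWise.isNthLargest_six_of_nine_le hk9 hn _).2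
      ⟨DWise.famS₂_isMaximalNontrivial (by omega) (by omega), rfl⟩⟩, fun 𝓕 h𝓕 => ?_⟩
    obtain ⟨h, hc⟩ := (DWise.isNthLargest_six_of_nine_le hk9 hn _).1 h𝓕
    have h1 := DWise.card_famH_two_lt (by omega) hn
    have h2 := DWise.card_famH_sub_three_lt hk9 hn
    have h3 := DWise.pairCount_le_card_famS₂ (n := n) (k := k) (by omega) (by omega)
    have h4 := DWise.card_famS₂_lt (n := n) (k := k) (by omega) (by omega)
    have := h.card_cases (by omega) hn
    refine ⟨by omega, by omega, by omega, fun _ => ?_⟩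
    by_contra hnot
    simp only [hnot, and_false, or_false] at this
    omega
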